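/- **Theorem 3.2 (Reduction).** Let $X$ be a smooth manifold of dimension $n$, let $x\in X$ and let $r\ge 0$ be an integer. *Notation.* $J^r_x\mathcal C$ is the manifold of $r$-jets at $x$ of smooth linear connections defined near $x$; the values at $x$ of the partial derivatives of order $\le r$ of the Christoffel symbols $\Gamma_{ij}^k$ in a chart around $x$ are global coordinates on it. $C_m$ is the vector space of $(1,m+2)$-tensors $T^l_{ijk_1\cdots k_m}$ on $T_xX$ that are symmetric in the last $m$ covariant indices $k_1,\dots,k_m$ and whose symmetrization over all $m+2$ covariant indices vanishes. A chart centred at $x$ is *normal* for $\nabla$ if in it the geodesics passing through $x$ at $t=0$ are precisely the straight lines $t\mapsto tv$. The $m$-th *normal tensor* $\Gamma^m_x$ of $\nabla$ at $x$ is the tensor on $T_xX$ whose components in a normal chart $(x_1,\dots,x_n)$ are $\dfrac{\partial^m\Gamma_{ij}^k}{\partial x_{a_1}\cdots\partial x_{a_m}}(0)$, where $\nabla_{\partial_i}\partial_j=\sum_k\Gamma_{ij}^k\partial_k$; normal charts exist, and $\Gamma^m_x$ does not depend on the normal chart. $H^{r+2}_x$ is the group of $(r+2)$-jets at $x$ of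 local diffeomorphisms $\tau$ of $X$ with $\tau(x)=x$ and $d_x\tau=\mathrm{id}$, that is, the kernel of $\mathrm{Diff}^{r+2}_x\to \mathrm{Gl}(T_xX)$. It acts on $J^r_x\mathcal C$ by $j^{r+2}_x\tau\cdot j^r_x\nabla=j^r_x(\tau\cdot\nabla)$, where $(\tau\cdot\nabla)_D\bar D=\tau_*^{-1}(\nabla_{\tau_*D}\,\tau_*\bar D)$. *Claim.* For $m\le r$, the normal tensor $\Gamma^m_x$ of $\nabla$ lies in $C_m$ and depends only on $j^r_x\nabla$. The resulting map $$\pi_r\colon J^r_x\mathcal C\longrightarrow C_0\times\cdots\times C_r,\qquad j^r_x\nabla\longmapsto(\Gamma^0_x,\dots,\Gamma^r_x),$$ is a surjective smooth submersion, and the fibre of $\pi_r$ through any jet is exactly its $H^{r+2}_x$-orbit. Consequently the quotient $(J^r_x\mathcal C)/H^{r+2}_x$, with the quotient topology and with those functions being smooth whose pull-backs to $J^r_x\mathcal C$ are smooth, is a smooth manifold, and $\pi_r$ induces a diffeomorphism $$(J^r_x\mathcal C)/H^{r+2}_x\;\cong\;C_0\times\cdots\times C_r .$$ The same statements hold with symmetric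 (torsion-free) connections in place of linear connections: replace $J^r_x\mathcal C$ by the manifold $J^r_x\widetilde{\mathcal C}$ of $r$-jets at $x$ of symmetric connections, and $C_m$ by the subspace $\widetilde C_m\subseteq C_m$ of tensors that are, in addition, symmetric in the first two covariant indices $i,j$. -/

import Mathlib

open scoped Manifold ContDiff Topology

noncomputable section

namespace ConnectionJets

/-- Linear connections come in two kinds: arbitrary ones, and symmetric (torsion-free) ones. -/
inductive Kind
  | general
  | symmetric

section Calculus

lemma iteratedFDeriv_swap {E F : Type*} [NormedAddCommGroup E] [NormedSpace ℝ E]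
    [NormedAddCommGroup F] [NormedSpace ℝ F] {f : E → F} (n : ℕ) :
    ∀ (i : Fin n) {x : E} (_ : ContDiffAt ℝ ((n + 1 : ℕ) : WithTop ℕ∞) f x) (v : Fin (n + 1) → E),
    iteratedFDeriv ℝ (n + 1) f x (v ∘ Equiv.swap i.castSucc i.succ) =
      iteratedFDeriv ℝ (n + 1) f x v := by
  induction n with
  | zero => exact fun i => i.elim0
  | succ n ih =>
    intro i x hf v
    refine Fin.cases ?_ (fun j => ?_) i
    · have hg : ContDiffAt ℝ 2 (iteratedFDeriv ℝ n f) x :=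
        hf.iteratedFDeriv_right (m := 2) (i := n) (by norm_cast; omega)
      have hs : IsSymmSndFDerivAt ℝ (iteratedFDeriv ℝ n f) x := hg.isSymmSndFDerivAt (by simp)
      have hg' : DifferentiableAt ℝ (fderiv ℝ (iteratedFDeriv ℝ n f)) x :=
        (hg.fderiv_right (m := 1) (by norm_num)).differentiableAt (by simp)
      have hd : DifferentiableAt ℝ (iteratedFDeriv ℝ (n + 1) f) x :=
        (hf.iteratedFDeriv_right (m := 1) (i := n + 1)
          (by norm_cast; omega)).differentiableAt (by simp)
      have key : ∀ w : Fin (n + 2) → E, iteratedFDeriv ℝ (n + 2) f x w =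
          fderiv ℝ (fderiv ℝ (iteratedFDeriv ℝ n f)) x (w 0) (w 1)
            (Fin.tail (Fin.tail w)) := by
        intro w
        rw [hd.iteratedFDeriv_succ_apply_left']
        have h1 : (fun y => iteratedFDeriv ℝ (n + 1) f y (Fin.tail w)) = fun y =>
          (fderiv ℝ (iteratedFDeriv ℝ n f) y (w 1)) (Fin.tail (Fin.tail w)) := rfl
        rw [h1, fderiv_continuousMultilinear_apply_const_apply
          (hg'.clm_apply (differentiableAt_const _)), fderiv_clm_apply hg' (differentiableAt_const _)]
        simp
      rw [key, key]
      have e : Fin.tail (Fin.tail (v ∘ Equiv.swap (0 : Fin (n + 1)).castSucc (0 : Fin (n + 1)).succ)) =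
          Fin.tail (Fin.tail v) := by
        ext k
        simp only [Fin.tail, Function.comp]
        rw [Equiv.swap_apply_of_ne_of_ne] <;> simp [Fin.ext_iff]
      rw [e, hs.eq]
      simp
    · rw [iteratedFDeriv_succ_apply_left, iteratedFDeriv_succ_apply_left]
      have hd : DifferentiableAt ℝ (iteratedFDeriv ℝ (n + 1) f) x :=
        (hf.iteratedFDeriv_right (m := 1) (i := n + 1)
          (by norm_cast; omega)).differentiableAt (by simp)
      have happ : ∀ (w : Fin (n + 1) → E) (a : E), fderiv ℝ (iteratedFDeriv ℝ (n + 1) f) x a w =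
          fderiv ℝ (fun y => iteratedFDeriv ℝ (n + 1) f y w) x a := by
        intro w a
        have := ((ContinuousMultilinearMap.apply ℝ (fun _ : Fin (n + 1) => E) F w).hasFDerivAt.comp x
          hd.hasFDerivAt).fderiv
        exact (congrArg (fun L => L a) this).symm
      have e0 : (v ∘ Equiv.swap j.succ.castSucc j.succ.succ) 0 = v 0 := by
        simp only [Function.comp]
        rw [Equiv.swap_apply_of_ne_of_ne] <;> simp [Fin.ext_iff]
      have e1 : Fin.tail (v ∘ Equiv.swap j.succ.castSucc j.succ.succ) =
          Fin.tail v ∘ Equiv.swap j.castSucc j.succ := by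
        ext k
        simp only [Fin.tail, Function.comp]
        congr 1
        simp only [Equiv.swap_apply_def, Fin.ext_iff]
        split_ifs <;> simp_all
      rw [e0, e1, happ, happ]
      have : (fun y => iteratedFDeriv ℝ (n + 1) f y (Fin.tail v ∘ Equiv.swap j.castSucc j.succ)) =ᶠ[𝓝 x]
          fun y => iteratedFDeriv ℝ (n + 1) f y (Fin.tail v) := by
        filter_upwards [hf.eventually (by simp)] with y hy
        exact ih j (hy.of_le (by norm_cast; omega)) _
      rw [this.fderiv_eq]

lemma iteratedFDeriv_perm {E F : Type*} [NormedAddCommGroup E] [NormedSpace ℝ E]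
    [NormedAddCommGroup F] [NormedSpace ℝ F] {f : E → F} {x : E} (hf : ContDiffAt ℝ ∞ f x) {n : ℕ}
    (σ : Equiv.Perm (Fin n)) (v : Fin n → E) :
    iteratedFDeriv ℝ n f x (v ∘ σ) = iteratedFDeriv ℝ n f x v := by
  cases n with
  | zero => exact congrArg _ (Subsingleton.elim _ _)
  | succ n =>
    have hσ : σ ∈ Submonoid.closure (Set.range fun i : Fin n => Equiv.swap i.castSucc i.succ) := by
      rw [Equiv.Perm.mclosure_swap_castSucc_succ]; trivial
    induction hσ using Submonoid.closure_induction generalizing v with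
    | mem s hs => obtain ⟨i, rfl⟩ := hs; exact iteratedFDeriv_swap n i (hf.of_le (by exact_mod_cast le_top)) v
    | one => rfl
    | mul s t _ _ hs ht =>
      have : v ∘ (s * t : Equiv.Perm (Fin (n + 1))) = (v ∘ s) ∘ t := rfl
      rw [this, ht, hs]

lemma exists_taylor_polynomial {E F : Type*} [NormedAddCommGroup E] [NormedSpace ℝ E]
    [NormedAddCommGroup F] [NormedSpace ℝ F] [CompleteSpace F] {r : ℕ}
    (A : ∀ m : Fin (r + 1), E [×(m : ℕ)]→L[ℝ] F)
    (hA : ∀ (m : Fin (r + 1)) (σ : Equiv.Perm (Fin m)) (a : Fin m → E), A m (a ∘ σ) = A m a)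
    (a : E) :
    ∃ G : E → F, ContDiff ℝ ∞ G ∧
      (∀ u, G u = ∑ m : Fin (r + 1), ((m : ℕ).factorial : ℝ)⁻¹ • A m fun _ => u - a) ∧
      ∀ m : Fin (r + 1), iteratedFDeriv ℝ m G a = A m := by
  let p : FormalMultilinearSeries ℝ E F := fun n =>
    if h : n < r + 1 then ((n.factorial : ℝ)⁻¹) • A ⟨n, h⟩ else 0
  have hp0 : ∀ n, ¬ n < r + 1 → p n = 0 := fun n hn => dif_neg hn
  have hp1 : ∀ m : Fin (r + 1), p m = ((m : ℕ).factorial : ℝ)⁻¹ • A m := fun m => dif_pos m.2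
  clear_value p
  have hp : p.radius = ⊤ := p.radius_eq_top_of_forall_image_add_eq_zero (r + 1) fun m =>
    hp0 _ (by omega)
  have hps : HasFPowerSeriesOnBall p.sum p 0 ⊤ := by
    rw [← hp]; exact p.hasFPowerSeriesOnBall (by rw [hp]; exact ENNReal.zero_lt_top)
  have hGp : HasFPowerSeriesOnBall (fun u => p.sum (u - a)) p a ⊤ := by
    simpa using hps.comp_sub a
  refine ⟨fun u => p.sum (u - a),
    contDiff_iff_contDiffAt.2 fun u => (hGp.analyticOnNhd u (by simp)).contDiffAt,
    fun u => ?_, fun m => ?_⟩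
  · have hsum : p.sum (u - a) = ∑ n ∈ Finset.range (r + 1), p n fun _ => u - a :=
      tsum_eq_sum fun n hn => by
        rw [hp0 n (by simpa using hn)]; rfl
    refine hsum.trans ?_
    rw [Finset.sum_range]
    exact Finset.sum_congr rfl fun m _ => by rw [hp1]; rfl
  · ext1 v
    rw [hGp.iteratedFDeriv_eq_sum_of_completeSpace]
    have h1 : ∀ σ : Equiv.Perm (Fin m), p m (fun i => v (σ i)) =
        (((m : ℕ).factorial : ℝ)⁻¹) • A m v := by
      intro σ
      rw [hp1]
      exact congrArg (fun z => (((m : ℕ).factorial : ℝ)⁻¹) • z) (hA m σ v)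
    rw [Finset.sum_congr rfl fun σ _ => h1 σ, Finset.sum_const, Finset.card_univ,
      Fintype.card_perm, Fintype.card_fin, ← Nat.cast_smul_eq_nsmul ℝ, smul_smul,
      mul_inv_cancel₀ (Nat.cast_ne_zero.2 (Nat.factorial_ne_zero _)), one_smul]

end Calculus

section Connections

variable {E : Type*} [NormedAddCommGroup E] [NormedSpace ℝ E]
variable {X : Type*} [TopologicalSpace X] [ChartedSpace E X] [IsManifold 𝓘(ℝ, E) ∞ X]

/-- The covariant derivative `cov` is torsion-free on `s`: `∇_D D' - ∇_{D'} D = [D, D']`. -/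
def IsTorsionFreeOn
    (cov : (Π y : X, TangentSpace 𝓘(ℝ, E) y) →
      (Π y : X, TangentSpace 𝓘(ℝ, E) y →L[ℝ] TangentSpace 𝓘(ℝ, E) y)) (s : Set X) : Prop :=
  ∀ y ∈ s, ∀ D D' : Π z : X, TangentSpace 𝓘(ℝ, E) z, MDiffAt (T% D) y → MDiffAt (T% D') y →
    cov D' y (D y) - cov D y (D' y) = VectorField.mlieBracket 𝓘(ℝ, E) D D' y

variable (E) in
/-- A smooth linear connection (of the given kind) on an open neighbourhood of `x`. -/
structure LocalConnection (κ : Kind) (x : X) where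
  /-- the open neighbourhood of `x` where the connection lives -/
  domain : Set X
  isOpen_domain : IsOpen domain
  mem_domain : x ∈ domain
  /-- the covariant derivative: `cov D' y v` is `∇_v D'` at `y` -/
  cov : (Π y : X, TangentSpace 𝓘(ℝ, E) y) →
    (Π y : X, TangentSpace 𝓘(ℝ, E) y →L[ℝ] TangentSpace 𝓘(ℝ, E) y)
  isCovariantDerivativeOn : IsCovariantDerivativeOn E cov domain
  contMDiff : ∀ V ⊆ domain, IsOpen V → ContMDiffCovariantDerivativeOn E ∞ cov V
  torsionFree : κ = .symmetric → IsTorsionFreeOn cov domain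

variable (E) in
/-- The coordinate vector field with constant components `w` in the chart `φ`
(junk outside `φ.source`). -/
def coordField (φ : OpenPartialHomeomorph X E) (w : E) : Π y : X, TangentSpace 𝓘(ℝ, E) y :=
  fun y => (mvfderiv 𝓘(ℝ, E) φ y).inverse w

/-- The Christoffel symbols in the chart `φ`: the bilinear map `(v, w) ↦ dφ (∇_{∂_v} ∂_w)` at the
point with coordinates `u`. -/
def christoffel [FiniteDimensional ℝ E] {κ : Kind} {x : X} (nabla : LocalConnection E κ x)
    (φ : OpenPartialHomeomorph X E) (u : E) : E →L[ℝ] E →L[ℝ] E :=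
  (LinearMap.toContinuousLinearMap <| (Module.finBasis ℝ E).constr ℝ fun j =>
    mvfderiv 𝓘(ℝ, E) φ (φ.symm u) ∘L
      nabla.cov (coordField E φ (Module.finBasis ℝ E j)) (φ.symm u) ∘L
      (mvfderiv 𝓘(ℝ, E) φ (φ.symm u)).inverse).flip

/-! ### Vector fields and connections in the preferred chart -/

/-- `dφ_z` for the preferred chart `φ` at `x`. -/
def chartD (x z : X) : TangentSpace 𝓘(ℝ, E) z →L[ℝ] E :=
  (trivializationAt E (TangentSpace 𝓘(ℝ, E)) x).continuousLinearMapAt ℝ z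

/-- The inverse of `chartD x z`. -/
def chartDSymm (x z : X) : E →L[ℝ] TangentSpace 𝓘(ℝ, E) z :=
  (trivializationAt E (TangentSpace 𝓘(ℝ, E)) x).symmL ℝ z

/-- Components of a vector field in the preferred chart at `x`. -/
def comps (x : X) (D : Π z : X, TangentSpace 𝓘(ℝ, E) z) (u : E) : E :=
  chartD x ((chartAt E x).symm u) (D ((chartAt E x).symm u))

lemma chartD_symm {x z : X} (hz : z ∈ (chartAt E x).source) (w : E) :
    chartD x z (chartDSymm x z w) = w :=
  (trivializationAt E (TangentSpace 𝓘(ℝ, E)) x).continuousLinearMapAt_symmL (R := ℝ)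
    (by simpa using hz) w

lemma chartDSymm_chartD {x z : X} (hz : z ∈ (chartAt E x).source) (w : TangentSpace 𝓘(ℝ, E) z) :
    chartDSymm x z (chartD x z w) = w :=
  (trivializationAt E (TangentSpace 𝓘(ℝ, E)) x).symmL_continuousLinearMapAt (R := ℝ)
    (by simpa using hz) w

lemma chartD_eq_mvfderiv {x z : X} (hz : z ∈ (chartAt E x).source) :
    mvfderiv 𝓘(ℝ, E) (chartAt E x) z = chartD (E := E) x z := by
  have h := TangentBundle.continuousLinearMapAt_trivializationAt (I := 𝓘(ℝ, E)) hz
  ext v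
  exact (DFunLike.congr_fun h v).symm

lemma mvfderiv_inverse {x z : X} (hz : z ∈ (chartAt E x).source) :
    (mvfderiv 𝓘(ℝ, E) (chartAt E x) z).inverse = chartDSymm (E := E) x z := by
  rw [chartD_eq_mvfderiv hz]
  exact ContinuousLinearMap.inverse_eq (f := chartD x z) (g := chartDSymm x z)
    (ContinuousLinearMap.ext fun w => chartD_symm hz w)
    (ContinuousLinearMap.ext fun w => chartDSymm_chartD hz w)

lemma triv_eq {x y : X} (D : Π z : X, TangentSpace 𝓘(ℝ, E) z) (hy : y ∈ (chartAt E x).source) :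
    ((trivializationAt E (TangentSpace 𝓘(ℝ, E)) x) ⟨y, D y⟩).2 = chartD x y (D y) := by
  have hy' : y ∈ (trivializationAt E (TangentSpace 𝓘(ℝ, E)) x).baseSet := by simpa using hy
  simp only [chartD, Bundle.Trivialization.continuousLinearMapAt_apply]
  rw [Bundle.Trivialization.coe_linearMapAt_of_mem _ hy']

lemma contMDiffAt_comp_chart {F : Type*} [NormedAddCommGroup F] [NormedSpace ℝ F]
    {x y : X} (hy : y ∈ (chartAt E x).source) (n : ℕ∞) (f : X → F) :
    ContMDiffAt 𝓘(ℝ, E) 𝓘(ℝ, F) n f y ↔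
      ContDiffAt ℝ n (f ∘ (chartAt E x).symm) (chartAt E x y) := by
  have := IsManifold.of_le (I := 𝓘(ℝ, E)) (M := X) (m := (n : WithTop ℕ∞)) (n := ∞) (by exact_mod_cast le_top)
  have h1 := contMDiffAt_iff_source_of_mem_source (I := 𝓘(ℝ, E)) (I' := 𝓘(ℝ, F)) (n := (n : WithTop ℕ∞)) (f := f) hy
  rw [h1]
  simp only [mfld_simps, contMDiffWithinAt_univ, contMDiffAt_iff_contDiffAt]

lemma contMDiffAt_iff_comps {x y : X} (hy : y ∈ (chartAt E x).source) (n : ℕ∞)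
    (D : Π z : X, TangentSpace 𝓘(ℝ, E) z) :
    CMDiffAt (n : WithTop ℕ∞) (T% D) y ↔ ContDiffAt ℝ n (comps x D) (chartAt E x y) := by
  have hy' : y ∈ (trivializationAt E (TangentSpace 𝓘(ℝ, E)) x).baseSet := by simpa using hy
  have : IsManifold 𝓘(ℝ, E) (∞ + 1) X := ‹_›
  have := TangentBundle.contMDiffVectorBundle (I := 𝓘(ℝ, E)) (M := X) (n := ∞)
  have : ContMDiffVectorBundle (n : WithTop ℕ∞) E (TangentSpace 𝓘(ℝ, E) : X → Type _) 𝓘(ℝ, E) := 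
    ContMDiffVectorBundle.of_le (n := ∞) (by exact_mod_cast le_top)
  rw [Bundle.Trivialization.contMDiffAt_section_iff (n := (n : WithTop ℕ∞)) (IB := 𝓘(ℝ, E)) (s := D)
    (trivializationAt E (TangentSpace 𝓘(ℝ, E)) x) hy', contMDiffAt_comp_chart hy]
  have key : (fun z => ((trivializationAt E (TangentSpace 𝓘(ℝ, E)) x) ⟨z, D z⟩).2) ∘
      (chartAt E x).symm =ᶠ[𝓝 (chartAt E x y)] comps x D := by
    filter_upwards [(chartAt E x).open_target.mem_nhds ((chartAt E x).map_source hy)] with u hu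
    exact triv_eq D ((chartAt E x).map_target hu)
  exact ⟨fun H => H.congr_of_eventuallyEq key.symm, fun H => H.congr_of_eventuallyEq key⟩

lemma mdifferentiableAt_iff_comps {x y : X} (hy : y ∈ (chartAt E x).source)
    (D : Π z : X, TangentSpace 𝓘(ℝ, E) z) :
    MDiffAt (T% D) y ↔ DifferentiableAt ℝ (comps x D) (chartAt E x y) := by
  have hy' : y ∈ (trivializationAt E (TangentSpace 𝓘(ℝ, E)) x).baseSet := by simpa using hy
  rw [Bundle.Trivialization.mdifferentiableAt_section_iff (IB := 𝓘(ℝ, E))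
    (trivializationAt E (TangentSpace 𝓘(ℝ, E)) x) D hy']
  rw [mdifferentiableAt_iff_source_of_mem_source (x := x) hy]
  simp only [mfld_simps, mdifferentiableWithinAt_univ, mdifferentiableAt_iff_differentiableAt]
  refine Filter.EventuallyEq.differentiableAt_iff ?_
  filter_upwards [(chartAt E x).open_target.mem_nhds ((chartAt E x).map_source hy)] with u hu
  exact triv_eq D ((chartAt E x).map_target hu)

/-- The covariant derivative with Christoffel symbols `G` in the preferred chart at `x`. -/
def covOf (x : X) (G : E → E →L[ℝ] E →L[ℝ] E) (D : Π y : X, TangentSpace 𝓘(ℝ, E) y) (y : X) :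
    TangentSpace 𝓘(ℝ, E) y →L[ℝ] TangentSpace 𝓘(ℝ, E) y :=
  chartDSymm x y ∘L (fderiv ℝ (comps x D) (chartAt E x y) +
    (G (chartAt E x y)).flip (comps x D (chartAt E x y))) ∘L chartD x y

lemma comps_add (x : X) (D D' : Π y : X, TangentSpace 𝓘(ℝ, E) y) :
    comps x (D + D') = comps x D + comps x D' := by
  ext u; simp [comps]

lemma comps_smul (x : X) (g : X → ℝ) (D : Π y : X, TangentSpace 𝓘(ℝ, E) y) :
    comps x (g • D) = (g ∘ (chartAt E x).symm) • comps x D := by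
  ext u; simp [comps]

lemma fderiv_comp_chart {x y : X} (hy : y ∈ (chartAt E x).source) (g : X → ℝ)
    (hg : MDifferentiableAt 𝓘(ℝ, E) 𝓘(ℝ, ℝ) g y) :
    DifferentiableAt ℝ (g ∘ (chartAt E x).symm) (chartAt E x y) ∧
    fderiv ℝ (g ∘ (chartAt E x).symm) (chartAt E x y) ∘L chartD x y = mvfderiv 𝓘(ℝ, E) g y := by
  have hd : DifferentiableAt ℝ (g ∘ (chartAt E x).symm) (chartAt E x y) := by
    rw [mdifferentiableAt_iff_source_of_mem_source (x := x) hy] at hg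
    simpa only [mfld_simps, mdifferentiableWithinAt_univ, mdifferentiableAt_iff_differentiableAt]
      using hg
  refine ⟨hd, ?_⟩
  have hc : MDifferentiableAt 𝓘(ℝ, E) 𝓘(ℝ, E) (chartAt E x) y :=
    mdifferentiableAt_atlas (chart_mem_atlas E x) hy
  have hev : g =ᶠ[𝓝 y] (g ∘ (chartAt E x).symm) ∘ chartAt E x := by
    filter_upwards [(chartAt E x).open_source.mem_nhds hy] with z hz
    simp [(chartAt E x).left_inv hz]
  rw [← chartD_eq_mvfderiv hy]
  ext v
  have h2 := mfderiv_comp y hd.mdifferentiableAt hc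
  rw [← hev.mfderiv_eq, mfderiv_eq_fderiv] at h2
  exact (DFunLike.congr_fun h2 v).symm

lemma covOf_isCov (x : X) (G : E → E →L[ℝ] E →L[ℝ] E) :
    IsCovariantDerivativeOn E (covOf x G) (chartAt E x).source where
  add {D D' y} hD hD' hy := by
    rw [mdifferentiableAt_iff_comps hy] at hD hD'
    simp only [covOf, comps_add, fderiv_add hD hD', Pi.add_apply, map_add]
    ext v
    simp
    abel
  leibniz {D g y} hD hg hy := by
    rw [mdifferentiableAt_iff_comps hy] at hD
    obtain ⟨h1, h2⟩ := fderiv_comp_chart hy g hg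
    rw [← h2]
    have e1 : comps x D (chartAt E x y) = chartD x y (D y) := by
      simp only [comps]; rw [(chartAt E x).left_inv hy]
    simp only [covOf, comps_smul, fderiv_smul h1 hD]
    ext v
    simp [(chartAt E x).left_inv hy, e1, chartDSymm_chartD hy]
    abel


/-- Components, in the preferred chart at `x`, of a field of endomorphisms. -/
def endComps (x : X) (A : Π z : X, TangentSpace 𝓘(ℝ, E) z →L[ℝ] TangentSpace 𝓘(ℝ, E) z) (u : E) :
    E →L[ℝ] E :=
  chartD x ((chartAt E x).symm u) ∘L A ((chartAt E x).symm u) ∘L chartDSymm x ((chartAt E x).symm u)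

lemma contMDiffAt_hom_iff {x y : X} (hy : y ∈ (chartAt E x).source) 
    (A : Π z : X, TangentSpace 𝓘(ℝ, E) z →L[ℝ] TangentSpace 𝓘(ℝ, E) z) :
    ContMDiffAt 𝓘(ℝ, E) (𝓘(ℝ, E).prod 𝓘(ℝ, E →L[ℝ] E)) ∞
      (fun z => (⟨z, A z⟩ : Bundle.TotalSpace (E →L[ℝ] E)
        fun z : X => TangentSpace 𝓘(ℝ, E) z →L[ℝ] TangentSpace 𝓘(ℝ, E) z)) y ↔
      ContDiffAt ℝ ∞ (endComps x A) (chartAt E x y) := by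
  have : IsManifold 𝓘(ℝ, E) (∞ + 1) X := ‹_›
  have := TangentBundle.contMDiffVectorBundle (I := 𝓘(ℝ, E)) (M := X) (n := ∞)
  have h0 := Bundle.Trivialization.contMDiffAt_section_iff (n := ∞) (IB := 𝓘(ℝ, E)) (s := A)
    (F := E →L[ℝ] E) (E := fun z : X => TangentSpace 𝓘(ℝ, E) z →L[ℝ] TangentSpace 𝓘(ℝ, E) z)
    (trivializationAt (E →L[ℝ] E)
      (fun z : X => TangentSpace 𝓘(ℝ, E) z →L[ℝ] TangentSpace 𝓘(ℝ, E) z) x) (x₀ := y)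
      (by simpa using hy)
  refine h0.trans ?_
  rw [contMDiffAt_comp_chart (n := ⊤) hy]
  have key : (fun z => ((trivializationAt (E →L[ℝ] E)
      (fun z : X => TangentSpace 𝓘(ℝ, E) z →L[ℝ] TangentSpace 𝓘(ℝ, E) z) x) ⟨z, A z⟩).2) ∘
      (chartAt E x).symm =ᶠ[𝓝 (chartAt E x y)] endComps x A := by
    filter_upwards [(chartAt E x).open_target.mem_nhds ((chartAt E x).map_source hy)] with u hu
    rfl
  exact ⟨fun H => H.congr_of_eventuallyEq key.symm, fun H => H.congr_of_eventuallyEq key⟩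

lemma covOf_smooth (x : X) {G : E → E →L[ℝ] E →L[ℝ] E} (hG : ContDiff ℝ ∞ G) (V : Set X)
    (hV : V ⊆ (chartAt E x).source) (hVo : IsOpen V) :
    ContMDiffCovariantDerivativeOn E ∞ (covOf x G) V where
  contMDiff {D} hD y hy := by
    refine ContMDiffAt.contMDiffWithinAt ?_
    have hy' := hV hy
    have hD' := (hD y hy).contMDiffAt (hVo.mem_nhds hy)
    have hD2 : ContDiffAt ℝ ∞ (comps x D) (chartAt E x y) := 
      (contMDiffAt_iff_comps hy' ⊤ D).1 hD'
    rw [contMDiffAt_hom_iff hy']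
    have key : (fun u => fderiv ℝ (comps x D) u + (G u).flip (comps x D u))
        =ᶠ[𝓝 (chartAt E x y)] endComps x (covOf x G D) := by
      filter_upwards [(chartAt E x).open_target.mem_nhds ((chartAt E x).map_source hy')] with u hu
      have hz := (chartAt E x).map_target hu
      ext v
      simp [endComps, covOf, chartD_symm hz, (chartAt E x).right_inv hu]
    refine ContDiffAt.congr_of_eventuallyEq ?_ key.symm
    have hf : ContDiffAt ℝ ∞ (fderiv ℝ (comps x D)) (chartAt E x y) :=
      hD2.fderiv_right (m := ∞) (by simp)
    have hfl : ContDiffAt ℝ ∞ (fun u => (G u).flip) (chartAt E x y) :=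
      ((ContinuousLinearMap.flipₗᵢ ℝ E E E).contDiff.comp hG).contDiffAt
    exact hf.add (hfl.clm_apply hD2)

lemma comps_coordField {x : X} {u : E} (hu : u ∈ (chartAt E x).target) (w : E) :
    comps x (coordField E (chartAt E x) w) u = w := by
  have hz := (chartAt E x).map_target hu
  simp only [comps, coordField]
  rw [mvfderiv_inverse hz, chartD_symm hz]

section fd
variable [FiniteDimensional ℝ E]

lemma christoffel_apply_basis {κ : Kind} {x : X} (nabla : LocalConnection E κ x) {u : E}
    (hu : u ∈ (chartAt E x).target) (v : E) (j) :
    christoffel nabla (chartAt E x) u v (Module.finBasis ℝ E j) =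
      endComps x (nabla.cov (coordField E (chartAt E x) (Module.finBasis ℝ E j))) u v := by
  have hz := (chartAt E x).map_target hu
  simp only [christoffel, ContinuousLinearMap.flip_apply, LinearMap.coe_toContinuousLinearMap',
    Module.Basis.constr_basis, endComps]
  rw [mvfderiv_inverse hz, chartD_eq_mvfderiv hz]

lemma christoffel_of_covOf {κ : Kind} {x : X} (nabla : LocalConnection E κ x) 
    {G : E → E →L[ℝ] E →L[ℝ] E} (h : nabla.cov = covOf x G) {u : E} 
    (hu : u ∈ (chartAt E x).target) : christoffel nabla (chartAt E x) u = G u := by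
  have hz := (chartAt E x).map_target hu
  ext v w
  have : (christoffel nabla (chartAt E x) u v : E →ₗ[ℝ] E) = (G u v : E →ₗ[ℝ] E) := by
    refine (Module.finBasis ℝ E).ext fun j => ?_
    have key : comps x (coordField E (chartAt E x) (Module.finBasis ℝ E j)) =ᶠ[𝓝 u]
        fun _ => Module.finBasis ℝ E j := by
      filter_upwards [(chartAt E x).open_target.mem_nhds hu] with u' hu'
      exact comps_coordField hu' _
    simp only [ContinuousLinearMap.coe_coe, christoffel_apply_basis nabla hu, h, endComps]
    simp [covOf, chartD_symm hz, (chartAt E x).right_inv hu, key.fderiv_eq, comps_coordField hu]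
  exact LinearMap.congr_fun this w

lemma christoffel_contDiffAt {κ : Kind} {x : X} (nabla : LocalConnection E κ x) :
    ContDiffAt ℝ ∞ (christoffel nabla (chartAt E x)) (chartAt E x x) := by
  set φ := chartAt E x with hφ
  have hx : x ∈ φ.source := mem_chart_source E x
  set V := nabla.domain ∩ φ.source with hV
  have hVo : IsOpen V := nabla.isOpen_domain.inter φ.open_source
  have hxV : x ∈ V := ⟨nabla.mem_domain, hx⟩
  have hA : ∀ j, ContDiffAt ℝ ∞
      (endComps x (nabla.cov (coordField E φ (Module.finBasis ℝ E j)))) (φ x) := by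
    intro j
    rw [← contMDiffAt_hom_iff hx]
    refine ((nabla.contMDiff V Set.inter_subset_left hVo).contMDiff (σ := coordField E φ (Module.finBasis ℝ E j)) ?_ x hxV).contMDiffAt
      (hVo.mem_nhds hxV)
    intro y hy
    refine ContMDiffAt.contMDiffWithinAt ?_
    refine (contMDiffAt_iff_comps hy.2 ⊤ _).2 ?_
    refine (contDiffAt_const (c := Module.finBasis ℝ E j)).congr_of_eventuallyEq ?_
    filter_upwards [φ.open_target.mem_nhds (φ.map_source hy.2)] with u' hu'
    exact comps_coordField hu' _
  have key : christoffel nabla φ =ᶠ[𝓝 (φ x)] fun u =>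
      ContinuousLinearMap.flipₗᵢ ℝ E E E (∑ j, ContinuousLinearMap.smulRightL ℝ E (E →L[ℝ] E)
        (LinearMap.toContinuousLinearMap ((Module.finBasis ℝ E).coord j))
        (endComps x (nabla.cov (coordField E φ (Module.finBasis ℝ E j))) u)) := by
    filter_upwards [φ.open_target.mem_nhds (φ.map_source hx)] with u hu
    ext v w
    conv_lhs => rw [← (Module.finBasis ℝ E).sum_repr w]
    simp only [map_sum, map_smul]
    simp [hφ]
    exact Finset.sum_congr rfl fun j _ => by rw [christoffel_apply_basis nabla hu]
  refine ContDiffAt.congr_of_eventuallyEq ?_ key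
  exact (ContinuousLinearMap.flipₗᵢ ℝ E E E).contDiff.contDiffAt.comp _
    (ContDiffAt.sum fun j _ => (ContinuousLinearMap.contDiff _).contDiffAt.comp _ (hA j))

end fd

lemma mlieBracket_model {V W : Π u : E, TangentSpace 𝓘(ℝ, E) u} {v w : E → E} {a : E}
    (hV : ∀ᶠ u in 𝓝 a, V u = v u) (hW : ∀ᶠ u in 𝓝 a, W u = w u) :
    VectorField.mlieBracket 𝓘(ℝ, E) V W a = fderiv ℝ w a (v a) - fderiv ℝ v a (w a) := by
  let V' : E → E := V
  let W' : E → E := W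
  have h1 : VectorField.mlieBracket 𝓘(ℝ, E) V W a = VectorField.lieBracket ℝ V' W' a := by
    rw [← VectorField.mlieBracketWithin_univ, VectorField.mlieBracketWithin_eq_lieBracketWithin]
    exact congrFun VectorField.lieBracketWithin_univ a
  have hV' : V' =ᶠ[𝓝 a] v := hV
  have hW' : W' =ᶠ[𝓝 a] w := hW
  exact h1.trans (hV'.lieBracket_vectorField_eq (𝕜 := ℝ) hW')

lemma chartD_mlieBracket {x y : X} (hy : y ∈ (chartAt E x).source) [CompleteSpace E]
    {D D' : Π z : X, TangentSpace 𝓘(ℝ, E) z} (hD : MDiffAt (T% D) y) (hD' : MDiffAt (T% D') y) :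
    chartD x y (VectorField.mlieBracket 𝓘(ℝ, E) D D' y) =
      fderiv ℝ (comps x D') (chartAt E x y) (comps x D (chartAt E x y)) -
      fderiv ℝ (comps x D) (chartAt E x y) (comps x D' (chartAt E x y)) := by
  set φ := chartAt E x with hφ
  have hu := φ.map_source hy
  have hinv : ∀ u ∈ φ.target, ∀ V : Π z : X, TangentSpace 𝓘(ℝ, E) z,
      VectorField.mpullback 𝓘(ℝ, E) 𝓘(ℝ, E) φ.symm V u = comps x V u := by
    intro u hu V
    have hz := φ.map_target hu
    have h1 := TangentBundle.symmL_trivializationAt (I := 𝓘(ℝ, E)) (x₀ := x) hz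
    have h2 : mfderiv 𝓘(ℝ, E) 𝓘(ℝ, E) φ.symm u = chartDSymm (E := E) x (φ.symm u) := by
      have h3 : extChartAt 𝓘(ℝ, E) x (φ.symm u) = u := by simp [← hφ, φ.right_inv hu, mfld_simps]
      rw [h3] at h1
      simp only [mfld_simps, mfderivWithin_univ] at h1
      exact h1.symm
    have h4 : (chartDSymm (E := E) x (φ.symm u)).inverse = chartD x (φ.symm u) :=
      ContinuousLinearMap.inverse_eq (f := chartDSymm x (φ.symm u)) (g := chartD x (φ.symm u))
      (ContinuousLinearMap.ext fun w => chartDSymm_chartD hz w)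
      (ContinuousLinearMap.ext fun w => chartD_symm hz w)
    exact (congrArg (fun f : E →L[ℝ] TangentSpace 𝓘(ℝ, E) (φ.symm u) =>
      f.inverse (V (φ.symm u))) h2).trans (congrArg (fun f => f (V (φ.symm u))) h4)
  have hfy : φ.symm (φ y) = y := φ.left_inv hy
  have := IsManifold.of_le (I := 𝓘(ℝ, E)) (M := X) (m := minSmoothness ℝ 3) (n := ∞) (by simp; exact WithTop.coe_le_coe.2 le_top)
  have h := VectorField.mpullback_mlieBracket (I := 𝓘(ℝ, E)) (I' := 𝓘(ℝ, E)) (f := φ.symm)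
    (x₀ := φ y) (V := D) (W := D') (n := ∞) (by rw [hfy]; exact hD) (by rw [hfy]; exact hD')
    ((contMDiffOn_chart_symm (n := ∞) (x := x)).contMDiffAt (φ.open_target.mem_nhds hu))
    (by simp; exact WithTop.coe_le_coe.2 le_top)
  rw [hinv _ hu] at h
  have e1 : chartD x y (VectorField.mlieBracket 𝓘(ℝ, E) D D' y) =
      comps x (VectorField.mlieBracket 𝓘(ℝ, E) D D') (φ y) := by
    simp only [comps]; rw [hfy]
  rw [e1, h]
  refine mlieBracket_model ?_ ?_
  · filter_upwards [φ.open_target.mem_nhds hu] with u hu using hinv u hu D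
  · filter_upwards [φ.open_target.mem_nhds hu] with u hu using hinv u hu D'

lemma covOf_torsionFree [CompleteSpace E] (x : X) {G : E → E →L[ℝ] E →L[ℝ] E}
    (hG : ∀ u v w, G u v w = G u w v) :
    IsTorsionFreeOn (covOf x G) (chartAt E x).source := by
  intro y hy D D' hD hD'
  have e : ∀ D : Π z : X, TangentSpace 𝓘(ℝ, E) z, comps x D (chartAt E x y) = chartD x y (D y) :=
    fun D => by simp only [comps]; rw [(chartAt E x).left_inv hy]
  rw [← chartDSymm_chartD hy (VectorField.mlieBracket 𝓘(ℝ, E) D D' y),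
    chartD_mlieBracket hy hD hD']
  simp [covOf, e]
  rw [hG _ (chartD x y (D y))]
  abel

section fd2
variable [FiniteDimensional ℝ E]
lemma christoffel_symm {x : X} (nabla : LocalConnection E .symmetric x) {u : E}
    (hu : u ∈ (chartAt E x).target) (hu' : (chartAt E x).symm u ∈ nabla.domain) (v w : E) :
    christoffel nabla (chartAt E x) u v w = christoffel nabla (chartAt E x) u w v := by
  have := FiniteDimensional.complete ℝ E
  have hz := (chartAt E x).map_target hu
  have hr := (chartAt E x).right_inv hu
  set b := Module.finBasis ℝ E
  have hmd : ∀ w, MDiffAt (T% (coordField E (chartAt E x) w)) ((chartAt E x).symm u) ∧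
      comps x (coordField E (chartAt E x) w) =ᶠ[𝓝 u] fun _ => w := by
    intro w
    have key : comps x (coordField E (chartAt E x) w) =ᶠ[𝓝 u] fun _ => w := by
      filter_upwards [(chartAt E x).open_target.mem_nhds hu] with u' hu'
      exact comps_coordField hu' _
    refine ⟨(mdifferentiableAt_iff_comps hz _).2 ?_, key⟩
    rw [hr]
    exact (differentiableAt_const w).congr_of_eventuallyEq key
  have hb : ∀ i j, christoffel nabla (chartAt E x) u (b i) (b j) =
      christoffel nabla (chartAt E x) u (b j) (b i) := by
    intro i j
    rw [christoffel_apply_basis nabla hu, christoffel_apply_basis nabla hu]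
    have h := nabla.torsionFree rfl _ hu' _ _ (hmd (b i)).1 (hmd (b j)).1
    have h2 := chartD_mlieBracket hz (hmd (b i)).1 (hmd (b j)).1
    rw [hr, (hmd (b i)).2.fderiv_eq, (hmd (b j)).2.fderiv_eq] at h2
    rw [← h] at h2
    simp only [fderiv_fun_const, Pi.zero_apply, map_sub] at h2
    simp only [coordField, mvfderiv_inverse hz] at h2
    simpa [endComps, sub_eq_zero] using! h2
  have : (christoffel nabla (chartAt E x) u : E →L[ℝ] E →L[ℝ] E) =
      (christoffel nabla (chartAt E x) u).flip := by
    refine ContinuousLinearMap.coe_injective (b.ext fun i => ?_)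
    refine ContinuousLinearMap.coe_injective (b.ext fun j => ?_)
    exact hb i j
  exact congrArg (fun f => f v w) this

/-- Families of multilinear maps of degree `0, …, r` on `E`, with values in `F`. -/
def TaylorCoeff (E F : Type*) [NormedAddCommGroup E] [NormedSpace ℝ E]
    [NormedAddCommGroup F] [NormedSpace ℝ F] (r : ℕ) : Type _ :=
  ∀ m : Fin (r + 1), E [×(m : ℕ)]→L[ℝ] F

instance (E F : Type*) [NormedAddCommGroup E] [NormedSpace ℝ E]
    [NormedAddCommGroup F] [NormedSpace ℝ F] (r : ℕ) : NormedAddCommGroup (TaylorCoeff E F r) :=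
  inferInstanceAs (NormedAddCommGroup (∀ m : Fin (r + 1), E [×(m : ℕ)]→L[ℝ] F))

instance (E F : Type*) [NormedAddCommGroup E] [NormedSpace ℝ E]
    [NormedAddCommGroup F] [NormedSpace ℝ F] (r : ℕ) : NormedSpace ℝ (TaylorCoeff E F r) :=
  inferInstanceAs (NormedSpace ℝ (∀ m : Fin (r + 1), E [×(m : ℕ)]→L[ℝ] F))

variable (E) in
/-- The coefficients of an `r`-jet at a point: the derivatives of order `≤ r` of the Christoffel
symbols; derivatives are symmetric, and for symmetric connections their values are, too. -/
def JetCoeff (κ : Kind) (r : ℕ) : Submodule ℝ (TaylorCoeff E (E →L[ℝ] E →L[ℝ] E) r) where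
  carrier := {A | (∀ (m : Fin (r + 1)) (σ : Equiv.Perm (Fin m)) (a : Fin m → E),
      A m (a ∘ σ) = A m a) ∧
    (κ = .symmetric → ∀ (m : Fin (r + 1)) (a : Fin m → E) (v w : E), A m a v w = A m a w v)}
  add_mem' hA hB := ⟨fun m σ a => congrArg₂ (· + ·) (hA.1 m σ a) (hB.1 m σ a),
    fun h m a v w => congrArg₂ (· + ·) (hA.2 h m a v w) (hB.2 h m a v w)⟩
  zero_mem' := ⟨fun _ _ _ => rfl, fun _ _ _ _ _ => rfl⟩
  smul_mem' c _ hA := ⟨fun m σ a => congrArg (c • ·) (hA.1 m σ a),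
    fun h m a v w => congrArg (c • ·) (hA.2 h m a v w)⟩

/-- The derivatives of order `≤ r` at `x` of the Christoffel symbols in the preferred chart. -/
def jetCoeff {κ : Kind} {x : X} (r : ℕ) (nabla : LocalConnection E κ x) : JetCoeff E κ r :=
  ⟨fun m => iteratedFDeriv ℝ m (christoffel nabla (chartAt E x)) (chartAt E x x), by
    have := FiniteDimensional.complete ℝ E
    refine ⟨fun m σ a => ?_, ?_⟩
    · exact iteratedFDeriv_perm (christoffel_contDiffAt nabla) σ a
    · rintro rfl m a v w
      let φ := chartAt E x
      have hx : φ x ∈ φ.target := φ.map_source (mem_chart_source E x)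
      have hev : ContinuousLinearMap.flipₗᵢ ℝ E E E ∘ christoffel nabla φ
          =ᶠ[𝓝 (φ x)] christoffel nabla φ := by
        have hc : ContinuousAt φ.symm (φ x) := φ.continuousAt_symm hx
        have hd : nabla.domain ∈ 𝓝 (φ.symm (φ x)) := by
          rw [φ.left_inv (mem_chart_source E x)]
          exact nabla.isOpen_domain.mem_nhds nabla.mem_domain
        filter_upwards [φ.open_target.mem_nhds hx, hc hd] with u hu hu'
        ext v w
        exact christoffel_symm nabla hu hu' w v
      have h := ContinuousLinearMap.iteratedFDeriv_comp_left
        ((ContinuousLinearMap.flipₗᵢ ℝ E E E).toContinuousLinearEquiv :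
          (E →L[ℝ] E →L[ℝ] E) →L[ℝ] (E →L[ℝ] E →L[ℝ] E))
        (christoffel_contDiffAt nabla) (i := m) (by exact_mod_cast le_top)
      change iteratedFDeriv ℝ m (ContinuousLinearMap.flipₗᵢ ℝ E E E ∘ christoffel nabla φ) (φ x) =
        _ at h
      rw [(hev.iteratedFDeriv ℝ m).eq_of_nhds] at h
      exact congrArg (fun f => f a v w) h⟩

/-- The connection near `x` whose Christoffel symbols in the preferred chart are `G`. -/
def connectionOf {κ : Kind} (x : X) (G : E → E →L[ℝ] E →L[ℝ] E) (hG : ContDiff ℝ ∞ G)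
    (hs : κ = .symmetric → ∀ u v w, G u v w = G u w v) : LocalConnection E κ x where
  domain := (chartAt E x).source
  isOpen_domain := (chartAt E x).open_source
  mem_domain := mem_chart_source E x
  cov := covOf x G
  isCovariantDerivativeOn := covOf_isCov x G
  contMDiff V hV hVo := covOf_smooth x hG V hV hVo
  torsionFree h :=
    haveI := FiniteDimensional.complete ℝ E
    covOf_torsionFree x (hs h)

lemma jetCoeff_surjective {κ : Kind} {x : X} (r : ℕ) :
    Function.Surjective (jetCoeff r : LocalConnection E κ x → JetCoeff E κ r) := by
  rintro ⟨A, hA⟩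
  have := FiniteDimensional.complete ℝ E
  obtain ⟨G, hG, hsum, hGA⟩ := exists_taylor_polynomial
    (F := E →L[ℝ] E →L[ℝ] E) A hA.1 (chartAt E x x)
  have hs : κ = .symmetric → ∀ u v w, G u v w = G u w v := by
    intro h u v w
    simp only [hsum, sum_apply, smul_apply]
    exact Finset.sum_congr rfl fun m _ => by rw [hA.2 h m _ v w]
  refine ⟨connectionOf x G hG hs, Subtype.ext (funext fun m => ?_)⟩
  have hev : christoffel (connectionOf x G hG hs) (chartAt E x) =ᶠ[𝓝 (chartAt E x x)] G := by
    filter_upwards [(chartAt E x).open_target.mem_nhds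
      ((chartAt E x).map_source (mem_chart_source E x))] with u hu
    exact christoffel_of_covOf _ rfl hu
  exact ((hev.iteratedFDeriv ℝ m).eq_of_nhds).trans (hGA m)


/-! ### Jets of connections -/

variable (E) in
/-- The space of `r`-jets at `x` of linear connections of the given kind: two connections near `x`
have the same `r`-jet when their Christoffel symbols have the same derivatives of order `≤ r`
at `x` (this does not depend on the chart; we use the preferred one). -/
def ConnJet (κ : Kind) (x : X) (r : ℕ) : Type _ :=
  Quotient (Setoid.ker (jetCoeff r : LocalConnection E κ x → JetCoeff E κ r))

/-- The `r`-jet at `x` of a connection. -/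
def jet {κ : Kind} {x : X} (r : ℕ) (nabla : LocalConnection E κ x) : ConnJet E κ x r :=
  Quotient.mk _ nabla

variable (E) in
/-- The global coordinates on the space of `r`-jets. -/
def jetEquiv (κ : Kind) (x : X) (r : ℕ) : ConnJet E κ x r ≃ JetCoeff E κ r :=
  Setoid.quotientKerEquivOfSurjective _ (jetCoeff_surjective r)

instance (κ : Kind) (x : X) (r : ℕ) : TopologicalSpace (ConnJet E κ x r) :=
  TopologicalSpace.induced (jetEquiv E κ x r) inferInstance

variable (E) in
/-- `jetEquiv` as a homeomorphism. -/
def jetHomeo (κ : Kind) (x : X) (r : ℕ) : ConnJet E κ x r ≃ₜ JetCoeff E κ r :=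
  (jetEquiv E κ x r).toHomeomorphOfIsInducing ⟨rfl⟩

/-- The manifold structure on the space of `r`-jets: the coefficients are a global chart. -/
instance (κ : Kind) (x : X) (r : ℕ) : ChartedSpace (JetCoeff E κ r) (ConnJet E κ x r) :=
  (jetHomeo E κ x r).toOpenPartialHomeomorph.singletonChartedSpace rfl

instance (κ : Kind) (x : X) (r : ℕ) :
    IsManifold 𝓘(ℝ, JetCoeff E κ r) ∞ (ConnJet E κ x r) :=
  (jetHomeo E κ x r).toOpenPartialHomeomorph.isManifold_singleton rfl

/-! ### Jets of diffeomorphisms and their action -/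

variable (E) in
/-- A smooth diffeomorphism between open neighbourhoods of `x`, leaving `x` fixed. -/
structure LocalDiffeo (x : X) where
  /-- the underlying partial diffeomorphism -/
  toPartialDiffeo : PartialDiffeomorph 𝓘(ℝ, E) 𝓘(ℝ, E) X X ∞
  mem_source : x ∈ toPartialDiffeo.source
  map_eq : toPartialDiffeo x = x

/-- A local diffeomorphism written in the preferred chart at `x`. -/
def LocalDiffeo.inChart {x : X} (τ : LocalDiffeo E x) : E → E :=
  chartAt E x ∘ τ.toPartialDiffeo ∘ (chartAt E x).symm

variable (E) in
/-- The `k`-jets at `x` of local diffeomorphisms leaving `x` fixed. -/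
def DiffJet (x : X) (k : ℕ) : Type _ :=
  Quotient (Setoid.ker fun (τ : LocalDiffeo E x) (m : Fin (k + 1)) =>
    iteratedFDeriv ℝ m τ.inChart (chartAt E x x))

/-- The `k`-jet at `x` of a local diffeomorphism. -/
def LocalDiffeo.jet {x : X} (k : ℕ) (τ : LocalDiffeo E x) : DiffJet E x k :=
  Quotient.mk _ τ

variable (E) in
/-- `H^k_x`: the `k`-jets of local diffeomorphisms `τ` with `τ x = x` and `d_x τ = id`, that is, the
kernel of the projection of the group of `k`-jets onto the general linear group of the tangent space
(for `k ≥ 1`). -/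
def H (x : X) (k : ℕ) : Set (DiffJet E x k) :=
  {h | ∃ τ : LocalDiffeo E x, τ.jet k = h ∧
    fderiv ℝ τ.inChart (chartAt E x x) = ContinuousLinearMap.id ℝ E}

/-- `nabla' = τ · nabla` near `x`, where `(τ · ∇)_v D = τ_*⁻¹ (∇_{τ_* v} (τ_* D))`. -/
def IsTransform {κ : Kind} {x : X} (τ : LocalDiffeo E x) (nabla nabla' : LocalConnection E κ x) :
    Prop :=
  ∀ᶠ y in 𝓝 x, ∀ D : Π z : X, TangentSpace 𝓘(ℝ, E) z, MDiffAt (T% D) y →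
    ∀ v : TangentSpace 𝓘(ℝ, E) y,
      nabla'.cov D y v = (mfderiv 𝓘(ℝ, E) 𝓘(ℝ, E) τ.toPartialDiffeo y).inverse
        (nabla.cov (VectorField.mpullback 𝓘(ℝ, E) 𝓘(ℝ, E) τ.toPartialDiffeo.symm D)
          (τ.toPartialDiffeo y) (mfderiv 𝓘(ℝ, E) 𝓘(ℝ, E) τ.toPartialDiffeo y v))

/-- The orbit of an `r`-jet of connections under `H^{r+2}_x`, where the `(r+2)`-jet of `τ` takes the
`r`-jet of `∇` to the `r`-jet of `τ · ∇`. -/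
def orbit {κ : Kind} {x : X} {r : ℕ} (j : ConnJet E κ x r) : Set (ConnJet E κ x r) :=
  {j' | ∃ h ∈ H E x (r + 2), ∃ (τ : LocalDiffeo E x) (nabla nabla' : LocalConnection E κ x),
    τ.jet (r + 2) = h ∧ jet r nabla = j ∧ jet r nabla' = j' ∧ IsTransform τ nabla nabla'}

variable (E) in
/-- The orbit space `J^r_x / H^{r+2}_x`, with the quotient topology. -/
abbrev OrbitSpace (κ : Kind) (x : X) (r : ℕ) : Type _ :=
  Quot fun j j' : ConnJet E κ x r => j' ∈ orbit j

/-! ### Geodesics, normal charts and normal tensors -/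

/-- `γ` is, at the times in `s`, a smooth curve in the domain of the connection satisfying the
geodesic equation `c'' + Γ(c', c') = 0` in any local coordinates. -/
def IsGeodesicOn {κ : Kind} {x : X} (nabla : LocalConnection E κ x) (γ : ℝ → X) (s : Set ℝ) :
    Prop :=
  ContMDiffOn 𝓘(ℝ, ℝ) 𝓘(ℝ, E) ∞ γ s ∧ ∀ t ∈ s, γ t ∈ nabla.domain ∧
    ∀ ψ ∈ IsManifold.maximalAtlas 𝓘(ℝ, E) ∞ X, γ t ∈ ψ.source →
      deriv (deriv (ψ ∘ γ)) t +
        christoffel nabla ψ (ψ (γ t)) (deriv (ψ ∘ γ) t) (deriv (ψ ∘ γ) t) = 0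

/-- `φ` is a normal chart of the connection at `x`: a chart centred at `x` in which the geodesics
passing through `x` at time `0` are precisely the straight lines `t ↦ t v`. -/
structure IsNormalChart {κ : Kind} {x : X} (nabla : LocalConnection E κ x)
    (φ : OpenPartialHomeomorph X E) : Prop where
  mem_maximalAtlas : φ ∈ IsManifold.maximalAtlas 𝓘(ℝ, E) ∞ X
  mem_source : x ∈ φ.source
  map_eq_zero : φ x = 0
  isGeodesicOn : ∃ ε > 0, Metric.ball 0 ε ⊆ φ.target ∧
    ∀ v : E, IsGeodesicOn nabla (fun t => φ.symm (t • v)) {t | t • v ∈ Metric.ball 0 ε}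
  eq_line : ∀ (γ : ℝ → X) (δ : ℝ), 0 < δ → IsGeodesicOn nabla γ (Set.Ioo (-δ) δ) → γ 0 = x →
    ∃ v : E, ∀ᶠ t in 𝓝 (0 : ℝ), γ t = φ.symm (t • v)

/-- The tensor `T` on the tangent space of `X` at `x` (which is `E`, by definition) is the `m`-th
normal tensor of the connection at `x`: normal charts exist and, in each of them, `T` has the
components `∂^m Γ_{ij}^k / ∂x_{a_1} ⋯ ∂x_{a_m} (0)`. The covariant arguments are ordered as
`i, j, a_1, …, a_m`. -/
def IsNormalTensor {κ : Kind} {x : X} (nabla : LocalConnection E κ x) (m : ℕ)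
    (T : E [×(m + 2)]→L[ℝ] E) : Prop :=
  (∃ φ, IsNormalChart nabla φ) ∧ ∀ φ, IsNormalChart nabla φ → ∀ (v w : E) (a : Fin m → E),
    T (Matrix.vecCons v (Matrix.vecCons w a)) = (mvfderiv 𝓘(ℝ, E) φ x).inverse
      (iteratedFDeriv ℝ m (christoffel nabla φ) 0 (fun i => mvfderiv 𝓘(ℝ, E) φ x (a i))
        (mvfderiv 𝓘(ℝ, E) φ x v) (mvfderiv 𝓘(ℝ, E) φ x w))

end fd2

end Connections

section NormalTensors

variable (V : Type*) [NormedAddCommGroup V] [NormedSpace ℝ V]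

/-- The space of normal tensors of order `m` on `V`: the `(1, m+2)`-tensors `T_{i j k_1 ⋯ k_m}^l`
which are symmetric in the last `m` covariant indices and whose symmetrization over the `m + 2`
covariant indices vanishes; for symmetric connections, symmetry in `i, j` is required, too. -/
def NormalTensor (κ : Kind) (m : ℕ) : Submodule ℝ (V [×(m + 2)]→L[ℝ] V) where
  carrier := {T |
    (∀ (σ : Equiv.Perm (Fin m)) (v w : V) (a : Fin m → V),
      T (Matrix.vecCons v (Matrix.vecCons w (a ∘ σ))) =
        T (Matrix.vecCons v (Matrix.vecCons w a))) ∧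
    (∀ a : Fin (m + 2) → V, ∑ σ : Equiv.Perm (Fin (m + 2)), T (a ∘ σ) = 0) ∧
    (κ = .symmetric → ∀ (v w : V) (a : Fin m → V),
      T (Matrix.vecCons v (Matrix.vecCons w a)) = T (Matrix.vecCons w (Matrix.vecCons v a)))}
  add_mem' {S T} hS hT := ⟨fun σ v w a => by simp [hS.1 σ v w a, hT.1 σ v w a],
    fun a => by simp [Finset.sum_add_distrib, hS.2.1 a, hT.2.1 a],
    fun h v w a => by simp [hS.2.2 h v w a, hT.2.2 h v w a]⟩
  zero_mem' := ⟨fun _ _ _ _ => by simp, fun _ => by simp, fun _ _ _ _ => by simp⟩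
  smul_mem' c T hT := ⟨fun σ v w a => by simp [hT.1 σ v w a],
    fun a => by simp [← Finset.smul_sum, hT.2.1 a],
    fun h v w a => by simp [hT.2.2 h v w a]⟩

instance (κ : Kind) (m : ℕ) : NormedAddCommGroup (NormalTensor V κ m) :=
  Submodule.normedAddCommGroup _

instance (κ : Kind) (m : ℕ) : NormedSpace ℝ (NormalTensor V κ m) :=
  Submodule.normedSpace _

/-- The product `C_0 × ⋯ × C_r` of the spaces of normal tensors of order `0, …, r`. -/
abbrev NormalTensors (κ : Kind) (r : ℕ) : Type _ :=
  ∀ m : Fin (r + 1), NormalTensor V κ m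

end NormalTensors

end ConnectionJets

end

/-! In the preferred chart, centred at `x`, a connection is a germ `Γ` of functions with bilinear
values. A change of coordinates `g` fixing `0` with `Dg(0) = id` replaces it by `pullback Γ g`,
whose value at `u` is `Dg⁻¹ (Γ(g u)(Dg ·, Dg ·) + D²g)`. Coordinates are normal when the radial
contraction `Γ(u)(u, u)` vanishes near `0`, which is the geodesic equation for the lines `t ↦ t u`.
Jets are compared through orders of vanishing: two smooth germs have the same `k`-jet if and only if
their difference is `O(|u|^(k+1))` (`sub_isBigO_iff`). This replaces chain rules of higher order by
Lipschitz estimates.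

For an `r`-jet the relevant condition is `Γ(u)(u, u) = O(|u|^(r+3))`. It can be achieved degree by
degree: adding to `g` a homogeneous `σ` of degree `n` changes the defect in the geodesic equation by
`n (n - 1) σ` to leading order, so the leading term of the defect can be cancelled
(`exists_normalizer`), smoothly in parameters. The `(r+2)`-jet of such a `g` is unique, since
agreement of two candidates to one order forces agreement to the next (`sub_isBigO_of_defect`).
Hence the jet in normal coordinates, `normalForm`, is a smooth function of the `r`-jet and is
invariant under maps tangent to the identity (`normalForm_pullJet`). Two jets with the same normal
form are related by one normalizer composed with the inverse of the other (`exists_pullJet_eq`). So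
the fibres are the orbits.

A jet in normal form is the same thing as a tuple of normal tensors. The homogeneous parts of
`Γ(u)(u, u)` are the diagonal values of the derivatives of `Γ` at `0`, and a symmetrization vanishes
if and only if the tensor vanishes on the diagonal (`sum_perm_eq_zero_iff`). Conversely, the
polynomial with coefficients in the spaces of normal tensors satisfies `Γ(u)(u, u) = 0` exactly and
is its own normal form, which gives surjectivity. Transporting these polynomials by the inverse of a
normalizer of `A` yields a smooth global section through `A` (`exists_section`). Sections make the
differential surjective, hence the map a submersion, and they make the inverse of the induced
bijection on the quotient continuous and smooth.

The geometric statements are reduced to these germs by the transformation laws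
`christoffel_eq_pullback` and `isTransform_iff`. Exact normal charts come from an exponential map,
obtained by the inverse function theorem on a Banach space of curves (`exists_defect_eq_zero`);
uniqueness for ordinary differential equations shows that all geodesics through `x` are lines there.
-/

open scoped Manifold ContDiff Topology

noncomputable section

namespace ConnectionJets

open Asymptotics Filter

set_option linter.unusedSectionVars false

/-! ### Orders of vanishing and Taylor polynomials. -/

section JetOrder

variable {E F G : Type*} [NormedAddCommGroup E] [NormedSpace ℝ E]
  [NormedAddCommGroup F] [NormedSpace ℝ F] [NormedAddCommGroup G] [NormedSpace ℝ G]

/-- `f(u) = O(|u|^k)` as `u → 0`. -/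
abbrev IsOrder (k : ℕ) (f : E → F) : Prop := f =O[𝓝 0] fun u : E => ‖u‖ ^ k

lemma isBigO_pow_norm_of_le {f : E → F} {j k : ℕ} (hf : IsOrder k f)
    (h : j ≤ k) : IsOrder j f :=
  hf.trans (IsBigO.of_norm_eventuallyLE (by
    filter_upwards [Metric.ball_mem_nhds (0 : E) one_pos] with u hu
    rw [norm_pow, norm_norm]
    exact pow_le_pow_of_le_one (norm_nonneg _) (by simpa using (mem_ball_zero_iff.1 hu).le) h))

lemma isBigO_clm_apply {A : E → F →L[ℝ] G} {v : E → F} {i j k : ℕ}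
    (hA : IsOrder i A) (hv : IsOrder j v) (h : i + j = k) :
    IsOrder k (fun u => A u (v u)) := by
  subst h
  unfold IsOrder
  simp only [pow_add]
  exact (IsBigO.of_bound 1 (Eventually.of_forall fun u => by
    rw [one_mul, norm_mul, norm_norm, norm_norm]; exact (A u).le_opNorm _)).trans
    (hA.norm_left.mul hv.norm_left)

lemma isBigO_pow_zero {f : E → F} (hf : ContinuousAt f 0) :
    IsOrder 0 f := by
  unfold IsOrder
  simp only [pow_zero]
  exact hf.tendsto.isBigO_one ℝ

lemma isBigO_self_pow_one : IsOrder 1 (fun u : E => u) := by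
  unfold IsOrder
  simp only [pow_one]
  exact (isBigO_refl (fun u : E => u) (𝓝 0)).norm_right

lemma IsOrder.eq_zero {f : E → F} {k : ℕ} (hf : IsOrder (k + 1) f) : f 0 = 0 :=
  hf.eq_zero_imp.self_of_nhds (by simp)

lemma IsOrder.tendsto {f : E → F} {k : ℕ} (hf : IsOrder (k + 1) f) : Tendsto f (𝓝 0) (𝓝 0) :=
  IsBigO.trans_tendsto hf
    ((by fun_prop : Continuous fun u : E => ‖u‖ ^ (k + 1)).tendsto' _ _ (by simp))

lemma contDiffAt_fderiv {f : E → F} {a : E} (hf : ContDiffAt ℝ ∞ f a) :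
    ContDiffAt ℝ ∞ (fderiv ℝ f) a :=
  hf.fderiv_right (m := ∞) (by simp)

lemma eventually_differentiableAt {f : E → F} {a : E} (hf : ContDiffAt ℝ ∞ f a) :
    ∀ᶠ u in 𝓝 a, DifferentiableAt ℝ f u :=
  ((hf.of_le (m := 1) (by exact_mod_cast le_top)).eventually (by simp)).mono
    fun _ h => h.differentiableAt (by simp)

lemma contDiffAt_differentiableAt {f : E → F} {a : E} (hf : ContDiffAt ℝ ∞ f a) :
    DifferentiableAt ℝ f a := hf.differentiableAt (by simp)

/-- A function with derivative `O(|u|^k)` which vanishes at `0` is `O(|u|^{k+1})`. -/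
lemma isBigO_of_fderiv {f : E → F} {k : ℕ} (hd : ∀ᶠ u in 𝓝 0, DifferentiableAt ℝ f u)
    (h0 : f 0 = 0) (h : IsOrder k (fderiv ℝ f)) :
    IsOrder (k + 1) f := by
  obtain ⟨C, hC⟩ := h.bound
  obtain ⟨ε, hε, hb⟩ := Metric.eventually_nhds_iff_ball.1 (hd.and hC)
  refine IsBigO.of_bound C ?_
  filter_upwards [Metric.ball_mem_nhds (0 : E) hε] with u hu
  have hsub : Metric.closedBall (0 : E) ‖u‖ ⊆ Metric.ball 0 ε :=
    Metric.closedBall_subset_ball (by simpa using hu)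
  have hC0 : 0 ≤ C * ‖u‖ ^ k := by
    have := (hb u hu).2
    simp only [norm_pow, norm_norm] at this
    exact (norm_nonneg _).trans this
  have key := (convex_closedBall (0 : E) ‖u‖).norm_image_sub_le_of_norm_fderiv_le (𝕜 := ℝ)
    (f := f) (C := C * ‖u‖ ^ k) (fun y hy => (hb y (hsub hy)).1) (fun y hy => ?_)
    (x := 0) (y := u) (by simp) (by simp)
  · rw [h0, sub_zero, sub_zero] at key
    simpa [pow_succ, mul_assoc] using key
  · have h1 := (hb y (hsub hy)).2
    have h2 := (hb 0 (Metric.mem_ball_self hε)).2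
    simp only [norm_pow, norm_norm] at h1
    have hy' : ‖y‖ ≤ ‖u‖ := by simpa using hy
    -- The constant of a big-O bound may be negative; then the bound at `y` forces `‖y‖ ^ k = 0` and
    -- the derivative vanishes there.
    rcases le_or_gt 0 C with hC | hC
    · exact h1.trans (by gcongr)
    · have : (0:ℝ) ≤ C * ‖y‖ ^ k := (norm_nonneg _).trans h1
      have h3 : ‖y‖ ^ k = 0 := le_antisymm (by nlinarith) (by positivity)
      rw [h3, mul_zero] at h1
      exact h1.trans hC0

/-- Descending induction on the order `j` of differentiation: the derivative of order `k + 1` is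
bounded, and each integration from `0` gains one power of `|u|`. -/
lemma isBigO_of_iteratedFDeriv_eq_zero (k : ℕ) {f : E → F} (hf : ContDiffAt ℝ ∞ f 0)
    (h : ∀ m ≤ k, iteratedFDeriv ℝ m f 0 = 0) : IsOrder (k + 1) f := by
  have key : ∀ d j : ℕ, j + d = k + 1 → IsOrder d (iteratedFDeriv ℝ j f) := by
    intro d
    induction d with
    | zero => exact fun j _ =>
        isBigO_pow_zero (hf.iteratedFDeriv_right (m := ∞) (i := j) le_rfl).continuousAt
    | succ d ih =>
      intro j hj
      refine isBigO_of_fderiv (eventually_differentiableAt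
        (hf.iteratedFDeriv_right (m := ∞) (i := j) le_rfl)) (h j (by omega)) ?_
      refine IsBigO.of_norm_left ?_
      simp only [norm_fderiv_iteratedFDeriv]
      exact (ih (j + 1) (by omega)).norm_left
  have := (key (k + 1) 0 (by omega)).norm_left
  simp only [norm_iteratedFDeriv_zero] at this
  exact this.of_norm_left

/-- A symmetric multilinear map is determined by its values on the diagonal. -/
lemma eq_zero_of_diagonal [CompleteSpace F] {m : ℕ} (A : E [×m]→L[ℝ] F)
    (hs : ∀ (σ : Equiv.Perm (Fin m)) (a : Fin m → E), A (a ∘ σ) = A a)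
    (hd : ∀ u : E, A (fun _ => u) = 0) : A = 0 := by
  -- With `A` as the only nonzero coefficient, the polynomial `A(u, …, u) / m!` is identically zero,
  -- while its `m`-th derivative is `A`; this is polarization without a formula.
  let B : ∀ j : Fin (m + 1), E [×(j : ℕ)]→L[ℝ] F := Function.update 0 (Fin.last m) A
  have hBl : B (Fin.last m) = A := Function.update_self ..
  have hB : ∀ j : Fin (m + 1), (∀ (σ : Equiv.Perm (Fin j)) (a : Fin j → E), B j (a ∘ σ) = B j a) ∧
      ∀ u : E, B j (fun _ => u) = 0 := by
    intro j
    by_cases h : j = Fin.last m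
    · subst h
      rw [hBl]
      exact ⟨hs, hd⟩
    · have : B j = 0 := Function.update_of_ne h _ _
      simp [this]
  obtain ⟨G, -, hG, hG'⟩ := exists_taylor_polynomial B (fun j => (hB j).1) (0 : E)
  have hG0 : G = 0 := by
    ext u
    rw [hG]
    exact Finset.sum_eq_zero fun j _ => by rw [(hB j).2, smul_zero]
  have := hG' (Fin.last m)
  rw [hG0, hBl] at this
  rw [← this]
  exact iteratedFDeriv_fun_zero (𝕜 := ℝ) (E := E) (F := F) ▸ rfl

/-- The Taylor expansion with remainder. -/
lemma taylor_isBigO [CompleteSpace F] {f : E → F} (hf : ContDiffAt ℝ ∞ f 0) (k : ℕ) :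
    IsOrder (k + 1) (fun u => f u - ∑ m ∈ Finset.range (k + 1), (m.factorial : ℝ)⁻¹ •
      iteratedFDeriv ℝ m f 0 fun _ => u) := by
  obtain ⟨G, hGs, hG, hG'⟩ := exists_taylor_polynomial
    (fun m : Fin (k + 1) => iteratedFDeriv ℝ m f 0) (fun m => iteratedFDeriv_perm hf) (0 : E)
  have h : IsOrder (k + 1) (fun u => f u - G u) := by
    refine isBigO_of_iteratedFDeriv_eq_zero k (hf.sub hGs.contDiffAt) fun m hm => ?_
    rw [fun_iteratedFDeriv_sub_apply (hf.of_le (by exact_mod_cast le_top))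
      (hGs.contDiffAt.of_le (by exact_mod_cast le_top)), hG' ⟨m, by omega⟩, sub_self]
  refine h.congr_left fun u => ?_
  rw [hG, Finset.sum_range]
  simp

/-- Along the ray `t u` the left side is homogeneous of degree `m` in `t`, so dividing by `t ^ m`
leaves a bound of size `O(t)`. -/
lemma eq_zero_of_diagonal_isBigO {m : ℕ} (A : E [×m]→L[ℝ] F)
    (h : IsOrder (m + 1) (fun u => A fun _ => u)) (u : E) :
    A (fun _ => u) = 0 := by
  obtain ⟨C, hC⟩ := h.bound
  obtain ⟨ε, hε, hb⟩ := Metric.eventually_nhds_iff_ball.1 hC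
  have hlim : Tendsto (fun t : ℝ => C * (t * ‖u‖ ^ (m + 1))) (𝓝[>] 0) (𝓝 0) := by
    have : Tendsto (fun t : ℝ => C * (t * ‖u‖ ^ (m + 1))) (𝓝 0) (𝓝 (C * (0 * ‖u‖ ^ (m + 1)))) :=
      (by fun_prop : Continuous fun t : ℝ => C * (t * ‖u‖ ^ (m + 1))).tendsto 0
    simpa using this.mono_left nhdsWithin_le_nhds
  have hle : ∀ᶠ t in 𝓝[>] (0 : ℝ), ‖A fun _ => u‖ ≤ C * (t * ‖u‖ ^ (m + 1)) := by
    have hcont : Tendsto (fun t : ℝ => t • u) (𝓝 0) (𝓝 0) := by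
      simpa using (by fun_prop : Continuous fun t : ℝ => t • u).tendsto 0
    filter_upwards [self_mem_nhdsWithin, nhdsWithin_le_nhds
      (hcont (Metric.ball_mem_nhds (0 : E) hε))] with t ht htu
    have ht' : (0 : ℝ) < t := ht
    have h1 := hb (t • u) htu
    have h2 : A (fun _ => t • u) = t ^ m • A fun _ => u := by
      simpa using A.map_smul_univ (fun _ => t) fun _ => u
    rw [h2, norm_smul, norm_pow, norm_pow, norm_norm, norm_smul, Real.norm_of_nonneg ht'.le] at h1
    have h3 : t ^ m * ‖A fun _ => u‖ ≤ t ^ m * (C * (t * ‖u‖ ^ (m + 1))) := by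
      refine h1.trans (le_of_eq ?_); ring
    exact le_of_mul_le_mul_left h3 (by positivity)
  exact norm_le_zero_iff.1 (ge_of_tendsto hlim hle)

/-- Once the lower derivatives vanish, the Taylor expansion leaves the term of degree `m`, which is
of higher order and hence zero on the diagonal; symmetry of the derivative does the rest. -/
lemma iteratedFDeriv_eq_zero_of_isBigO [CompleteSpace F] {f : E → F} (hf : ContDiffAt ℝ ∞ f 0)
    {k : ℕ} (h : IsOrder (k + 1) f) {m : ℕ} (hm : m ≤ k) :
    iteratedFDeriv ℝ m f 0 = 0 := by
  induction m using Nat.strong_induction_on with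
  | _ m ih =>
    refine eq_zero_of_diagonal _ (fun σ a => iteratedFDeriv_perm hf σ a) fun u => ?_
    have h1 := (isBigO_pow_norm_of_le h (by omega : m + 1 ≤ k + 1)).sub (taylor_isBigO hf m)
    have h2 : IsOrder (m + 1) (fun u => (m.factorial : ℝ)⁻¹ • iteratedFDeriv ℝ m f 0 fun _ => u) := by
      refine h1.congr_left fun u => ?_
      rw [Finset.sum_range_succ, Finset.sum_eq_zero]
      · abel
      · intro j hj
        rw [ih j (by simpa using hj) (by have := Finset.mem_range.1 hj; omega)]
        simp
    refine eq_zero_of_diagonal_isBigO _ ?_ u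
    exact (isBigO_const_smul_left (by positivity)).1 h2

/-- Two smooth germs have the same jet of order `k` if and only if they agree up to
`O(|u|^{k+1})`. -/
lemma sub_isBigO_iff [CompleteSpace F] {f g : E → F} (hf : ContDiffAt ℝ ∞ f 0)
    (hg : ContDiffAt ℝ ∞ g 0) {k : ℕ} :
    IsOrder (k + 1) (fun u => f u - g u) ↔
      ∀ m ≤ k, iteratedFDeriv ℝ m f 0 = iteratedFDeriv ℝ m g 0 := by
  have key : ∀ m, iteratedFDeriv ℝ m (fun u => f u - g u) 0 =
      iteratedFDeriv ℝ m f 0 - iteratedFDeriv ℝ m g 0 := fun m =>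
    fun_iteratedFDeriv_sub_apply (hf.of_le (by exact_mod_cast le_top))
      (hg.of_le (by exact_mod_cast le_top))
  constructor
  · intro h m hm
    rw [← sub_eq_zero, ← key]
    exact iteratedFDeriv_eq_zero_of_isBigO (hf.sub hg) h hm
  · intro h
    exact isBigO_of_iteratedFDeriv_eq_zero k (hf.sub hg) fun m hm => by
      rw [key, h m hm, sub_self]

/-- Big-O bounds cannot be differentiated in general. For smooth germs they can, because they are
equivalent to the vanishing of a jet, and the jet of the derivative is a shift of that of `f`. -/
lemma isBigO_fderiv [CompleteSpace F] {f : E → F} (hf : ContDiffAt ℝ ∞ f 0) {k : ℕ}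
    (h : IsOrder (k + 1) f) : IsOrder k (fderiv ℝ f) := by
  cases k with
  | zero => exact isBigO_pow_zero (contDiffAt_fderiv hf).continuousAt
  | succ k =>
    refine isBigO_of_iteratedFDeriv_eq_zero k (contDiffAt_fderiv hf) fun m hm => ?_
    have := iteratedFDeriv_eq_zero_of_isBigO hf h (m := m + 1) (by omega)
    rw [iteratedFDeriv_succ_eq_comp_right] at this
    exact (LinearIsometryEquiv.map_eq_zero_iff _).1 this

lemma isBigO_fderiv_sub [CompleteSpace F] {f g : E → F} (hf : ContDiffAt ℝ ∞ f 0)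
    (hg : ContDiffAt ℝ ∞ g 0) {k : ℕ}
    (h : IsOrder (k + 1) (fun u => f u - g u)) :
    IsOrder k (fun u => fderiv ℝ f u - fderiv ℝ g u) := by
  refine (isBigO_fderiv (hf.sub hg) h).congr' ?_ EventuallyEq.rfl
  filter_upwards [eventually_differentiableAt hf, eventually_differentiableAt hg] with u h1 h2
  exact fderiv_fun_sub h1 h2

/-- The leading term of a smooth germ. -/
lemma sub_leading_isBigO [CompleteSpace F] {f : E → F} (hf : ContDiffAt ℝ ∞ f 0) {k : ℕ}
    (h : IsOrder k f) :
    IsOrder (k + 1) (fun u => f u - (k.factorial : ℝ)⁻¹ • iteratedFDeriv ℝ k f 0 fun _ => u) := by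
  refine (taylor_isBigO hf k).congr_left fun u => ?_
  rw [Finset.sum_range_succ, Finset.sum_eq_zero, zero_add]
  intro j hj
  have hj := Finset.mem_range.1 hj
  obtain ⟨k, rfl⟩ : ∃ l, k = l + 1 := ⟨k - 1, by omega⟩
  rw [iteratedFDeriv_eq_zero_of_isBigO hf h (by omega)]
  simp

/-- Derivatives along a line. -/
lemma hasDerivAt_line {f : E → F} {u : E} {t : ℝ} (hf : DifferentiableAt ℝ f (t • u)) :
    HasDerivAt (fun s : ℝ => f (s • u)) (fderiv ℝ f (t • u) u) t := by
  have h1 : HasDerivAt (fun s : ℝ => s • u) u t := by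
    simpa using (hasDerivAt_id t).smul_const u
  exact hf.hasFDerivAt.comp_hasDerivAt t h1

lemma hasDerivAt_fderiv_line {f : E → F} {u : E} {t : ℝ} (hf : ContDiffAt ℝ 2 f (t • u)) :
    HasDerivAt (fun s : ℝ => fderiv ℝ f (s • u) u) (fderiv ℝ (fderiv ℝ f) (t • u) u u) t := by
  have h1 := hasDerivAt_line (u := u) (t := t)
    ((hf.fderiv_right (m := 1) (by norm_num)).differentiableAt (by simp))
  simpa using h1.clm_apply (hasDerivAt_const t u)

lemma contDiffAt_two {f : E → F} {a : E} (hf : ContDiffAt ℝ ∞ f a) : ContDiffAt ℝ 2 f a :=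
  hf.of_le (by simpa using (WithTop.coe_le_coe.2 (le_top : (2 : ℕ∞) ≤ ⊤)))

/-- If `D²f(u)(u, u)` is `O(|u|^k)` and the `1`-jet of `f` vanishes, then `f` is `O(|u|^k)`. -/
lemma isBigO_of_radial {f : E → F} (hf : ContDiffAt ℝ ∞ f 0) (h0 : f 0 = 0)
    (h1 : fderiv ℝ f 0 = 0) {k : ℕ}
    (h : IsOrder (k + 2) (fun u => fderiv ℝ (fderiv ℝ f) u u u)) :
    IsOrder (k + 2) f := by
  obtain ⟨C, hC⟩ := h.bound
  obtain ⟨ε, hε, hb⟩ := Metric.eventually_nhds_iff_ball.1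
    (((contDiffAt_two hf).eventually (by simp)).and hC)
  refine IsBigO.of_bound |C| ?_
  filter_upwards [Metric.ball_mem_nhds (0 : E) hε] with u hu
  have hmem : ∀ t ∈ Set.Icc (0 : ℝ) 1, t • u ∈ Metric.ball (0 : E) ε := by
    intro t ht
    rw [mem_ball_zero_iff, norm_smul, Real.norm_of_nonneg ht.1]
    have := mem_ball_zero_iff.1 hu
    nlinarith [norm_nonneg u, ht.2]
  have hd2 : ∀ t ∈ Set.Icc (0 : ℝ) 1, HasDerivAt (fun s : ℝ => fderiv ℝ f (s • u) u)
      (fderiv ℝ (fderiv ℝ f) (t • u) u u) t := fun t ht =>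
    hasDerivAt_fderiv_line (hb _ (hmem t ht)).1
  have hd1 : ∀ t ∈ Set.Icc (0 : ℝ) 1, HasDerivAt (fun s : ℝ => f (s • u))
      (fderiv ℝ f (t • u) u) t := fun t ht =>
    hasDerivAt_line ((hb _ (hmem t ht)).1.differentiableAt (by simp))
  -- The hypothesis at `t u` carries a factor `t ^ 2` on the left and `t ^ (k + 2)` on the right;
  -- cancelling `t ^ 2` gives a bound uniform in `t`, which is then integrated twice along the ray.
  have hpos : ∀ t ∈ Set.Ioo (0 : ℝ) 1,
      ‖fderiv ℝ (fderiv ℝ f) (t • u) u u‖ ≤ |C| * ‖u‖ ^ (k + 2) := by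
    intro t ht
    have h2 := (hb _ (hmem t ⟨ht.1.le, ht.2.le⟩)).2
    simp only [map_smul, smul_apply, norm_smul, norm_pow, norm_norm, norm_mul,
      Real.norm_of_nonneg ht.1.le, mul_pow] at h2
    have h3 : t ^ 2 * ‖fderiv ℝ (fderiv ℝ f) (t • u) u u‖ ≤
        t ^ 2 * (|C| * ‖u‖ ^ (k + 2)) := by
      calc _ = t * (t * ‖fderiv ℝ (fderiv ℝ f) (t • u) u u‖) := by ring
        _ ≤ C * (t ^ (k + 2) * ‖u‖ ^ (k + 2)) := h2
        _ ≤ |C| * (t ^ 2 * ‖u‖ ^ (k + 2)) := by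
          have : t ^ (k + 2) ≤ t ^ 2 := pow_le_pow_of_le_one ht.1.le ht.2.le (by omega)
          have := le_abs_self C
          have := ht.1.le
          gcongr
        _ = _ := by ring
    have := ht.1
    exact le_of_mul_le_mul_left h3 (by positivity)
  have hbound2 : ∀ t ∈ Set.Ico (0 : ℝ) 1,
      ‖fderiv ℝ (fderiv ℝ f) (t • u) u u‖ ≤ |C| * ‖u‖ ^ (k + 2) := by
    intro t ht
    rcases ht.1.eq_or_lt with h | h
    · subst h
      -- At `t = 0` nothing can be cancelled; the bound passes to the limit.
      have hc : ContinuousAt (fun t : ℝ => ‖fderiv ℝ (fderiv ℝ f) (t • u) u u‖) 0 := by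
        have h1 : ContinuousAt (fun t : ℝ => fderiv ℝ (fderiv ℝ f) (t • u)) 0 :=
          ContinuousAt.comp (g := fderiv ℝ (fderiv ℝ f)) (f := fun t : ℝ => t • u)
            (by simpa using (contDiffAt_fderiv (contDiffAt_fderiv hf)).continuousAt) (by fun_prop)
        exact ((h1.clm_apply continuousAt_const).clm_apply continuousAt_const).norm
      refine le_of_tendsto (hc.tendsto.mono_left nhdsWithin_le_nhds : Tendsto _ (𝓝[>] (0 : ℝ)) _) ?_
      filter_upwards [Ioo_mem_nhdsGT (zero_lt_one' ℝ)] with t ht using hpos t ht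
    · exact hpos t ⟨h, ht.2⟩
  have hbound1 : ∀ t ∈ Set.Icc (0 : ℝ) 1, ‖fderiv ℝ f (t • u) u‖ ≤ |C| * ‖u‖ ^ (k + 2) := by
    intro t ht
    have := norm_image_sub_le_of_norm_deriv_le_segment'
      (fun t ht => (hd2 t ht).hasDerivWithinAt) hbound2 t ht
    rw [zero_smul, h1, zero_apply, sub_zero, sub_zero] at this
    exact this.trans (mul_le_of_le_one_right (by positivity) ht.2)
  have := norm_image_sub_le_of_norm_deriv_le_segment'
    (fun t ht => (hd1 t ht).hasDerivWithinAt) (fun t ht => hbound1 t ⟨ht.1, ht.2.le⟩) 1 (by simp)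
  simpa [h0] using this

lemma IsOrder.prodMk {f : E → F} {g : E → G} {k : ℕ} (hf : IsOrder k f) (hg : IsOrder k g) :
    IsOrder k fun u => (f u, g u) :=
  IsBigO.prod_left hf hg

/-- A smooth map is strictly differentiable, hence Lipschitz near `z`. No regularity of `a` and `b`
is needed beyond their common limit. -/
lemma isOrder_comp_sub_comp {Φ : F → G} {z : F} (hΦ : ContDiffAt ℝ ∞ Φ z) {a b : E → F}
    (ha : Tendsto a (𝓝 0) (𝓝 z)) (hb : Tendsto b (𝓝 0) (𝓝 z)) {k : ℕ}
    (h : IsOrder k fun u => a u - b u) : IsOrder k fun u => Φ (a u) - Φ (b u) :=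
  IsBigO.trans ((hΦ.hasStrictFDerivAt (by simp)).isBigO_sub.comp_tendsto (ha.prodMk_nhds hb)) h

end JetOrder

/-! ### Local inversion of smooth maps. -/

lemma isOpen_setOf_isInvertible {E F : Type*} [NormedAddCommGroup E] [NormedSpace ℝ E]
    [NormedAddCommGroup F] [NormedSpace ℝ F] [CompleteSpace E] :
    IsOpen {L : E →L[ℝ] F | L.IsInvertible} :=
  ContinuousLinearEquiv.isOpen

/-- The inverse function theorem for smooth germs. -/
lemma exists_openPartialHomeomorph {E F : Type*} [NormedAddCommGroup E] [NormedSpace ℝ E]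
    [NormedAddCommGroup F] [NormedSpace ℝ F] [CompleteSpace E] {f : E → F} {a : E}
    (hf : ∀ᶠ u in 𝓝 a, ContDiffAt ℝ ∞ f u) (hf' : (fderiv ℝ f a).IsInvertible)
    {p : E → Prop} (hp : ∀ᶠ u in 𝓝 a, p u) :
    ∃ Φ : OpenPartialHomeomorph E F, (Φ : E → F) = f ∧ a ∈ Φ.source ∧
      (∀ u ∈ Φ.source, p u ∧ ContDiffAt ℝ ∞ f u ∧ (fderiv ℝ f u).IsInvertible) ∧
      ∀ v ∈ Φ.target, ContDiffAt ℝ ∞ Φ.symm v := by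
  have hfa := hf.self_of_nhds
  obtain ⟨f', hf'⟩ := hf'
  have hd : HasFDerivAt f (f' : E →L[ℝ] F) a := by
    rw [hf']; exact (contDiffAt_differentiableAt hfa).hasFDerivAt
  have hev : ∀ᶠ u in 𝓝 a, p u ∧ ContDiffAt ℝ ∞ f u ∧ (fderiv ℝ f u).IsInvertible := by
    refine hp.and (hf.and ?_)
    exact (contDiffAt_fderiv hfa).continuousAt (isOpen_setOf_isInvertible.mem_nhds ⟨f', hf'⟩)
  -- Shrinking the source to `U` keeps the derivative invertible at every point, so that the inverse
  -- is smooth on the whole target.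
  obtain ⟨U, hU, hUo, haU⟩ := eventually_nhds_iff.1 hev
  let Φ := (hfa.toOpenPartialHomeomorph f hd (by simp)).restrOpen U hUo
  have hsource : ∀ u ∈ Φ.source, u ∈ U := fun u hu => hu.2
  refine ⟨Φ, rfl, ⟨hfa.mem_toOpenPartialHomeomorph_source hd (by simp), haU⟩,
    fun u hu => hU u (hsource u hu), fun v hv => ?_⟩
  obtain ⟨-, h1, ⟨g, hg⟩⟩ := hU _ (hsource _ (Φ.map_target hv))
  exact Φ.contDiffAt_symm hv (f₀' := g)
    (by rw [hg]; exact (contDiffAt_differentiableAt h1).hasFDerivAt) h1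

/-! ### Christoffel symbols under changes of coordinates tangent to the identity. -/

section Germs

variable {E : Type*} [NormedAddCommGroup E] [NormedSpace ℝ E]

/-- The bilinear map `(v, w) ↦ A (L v) (L w)`. -/
def pairComp (A : E →L[ℝ] E →L[ℝ] E) (L : E →L[ℝ] E) : E →L[ℝ] E →L[ℝ] E :=
  ((ContinuousLinearMap.compL ℝ E E E).flip L) ∘L A ∘L L

@[simp] lemma pairComp_apply (A : E →L[ℝ] E →L[ℝ] E) (L : E →L[ℝ] E) (v w : E) :
    pairComp A L v w = A (L v) (L w) := rfl

lemma contDiff_pairComp :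
    ContDiff ℝ ∞ fun z : (E →L[ℝ] E →L[ℝ] E) × (E →L[ℝ] E) => pairComp z.1 z.2 := by
  unfold pairComp
  fun_prop

/-- The transformation rule of Christoffel symbols, as a function of the symbols and of the first
two derivatives of the change of coordinates. -/
def transform (z : (E →L[ℝ] E →L[ℝ] E) × (E →L[ℝ] E) × (E →L[ℝ] E →L[ℝ] E)) :
    E →L[ℝ] E →L[ℝ] E :=
  (ContinuousLinearMap.compL ℝ E E E z.2.1.inverse) ∘L (pairComp z.1 z.2.1 + z.2.2)

lemma transform_apply (A : E →L[ℝ] E →L[ℝ] E) (L : E →L[ℝ] E) (Q : E →L[ℝ] E →L[ℝ] E) (v w : E) :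
    transform (A, L, Q) v w = L.inverse (A (L v) (L w) + Q v w) := rfl

lemma contDiffAt_transform [CompleteSpace E]
    {z : (E →L[ℝ] E →L[ℝ] E) × (E →L[ℝ] E) × (E →L[ℝ] E →L[ℝ] E)} (hz : z.2.1.IsInvertible) :
    ContDiffAt ℝ ∞ transform z := by
  have h1 : ContDiffAt ℝ ∞ (fun z : (E →L[ℝ] E →L[ℝ] E) × (E →L[ℝ] E) × (E →L[ℝ] E →L[ℝ] E) =>
      z.2.1.inverse) z :=
    ContDiffAt.comp z hz.contDiffAt_map_inverse contDiff_snd.fst.contDiffAt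
  have h2 : ContDiffAt ℝ ∞ (fun z : (E →L[ℝ] E →L[ℝ] E) × (E →L[ℝ] E) × (E →L[ℝ] E →L[ℝ] E) =>
      pairComp z.1 z.2.1) z :=
    (contDiff_pairComp.comp (contDiff_fst.prodMk contDiff_snd.fst)).contDiffAt
  exact ((ContinuousLinearMap.compL ℝ E E E).contDiff.contDiffAt.comp z h1).clm_comp
    (h2.add contDiff_snd.snd.contDiffAt)

/-- The Christoffel symbols `Γ`, transformed by the change of coordinates `g`. -/
def pullback (Γ : E → E →L[ℝ] E →L[ℝ] E) (g : E → E) (u : E) : E →L[ℝ] E →L[ℝ] E :=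
  transform (Γ (g u), fderiv ℝ g u, fderiv ℝ (fderiv ℝ g) u)

/-- The defect in the equation satisfied by `g` when the straight lines through `0` are mapped by
`g` to geodesics. -/
def defect (Γ : E → E →L[ℝ] E →L[ℝ] E) (g : E → E) (u : E) : E :=
  fderiv ℝ (fderiv ℝ g) u u u + Γ (g u) (fderiv ℝ g u u) (fderiv ℝ g u u)

variable {Γ Γ' : E → E →L[ℝ] E →L[ℝ] E} {g g' h : E → E} {u : E} {r : ℕ}

lemma fderiv_pullback (hg : (fderiv ℝ g u).IsInvertible) (v w : E) :
    fderiv ℝ g u (pullback Γ g u v w) =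
      Γ (g u) (fderiv ℝ g u v) (fderiv ℝ g u w) + fderiv ℝ (fderiv ℝ g) u v w :=
  hg.self_apply_inverse _

lemma pullback_eq_of_forall (hg : (fderiv ℝ g u).IsInvertible) {A : E →L[ℝ] E →L[ℝ] E}
    (h : ∀ v w, fderiv ℝ g u (A v w) =
      Γ (g u) (fderiv ℝ g u v) (fderiv ℝ g u w) + fderiv ℝ (fderiv ℝ g) u v w) :
    pullback Γ g u = A := by
  ext v w
  exact hg.injective (by rw [fderiv_pullback hg, h])

/-- The defect at `u` is the left side of the geodesic equation for `t ↦ g (t u)` at `t = 1`, so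
normality of the transformed symbols is an equation for `g`. -/
lemma fderiv_pullback_self (hg : (fderiv ℝ g u).IsInvertible) :
    fderiv ℝ g u (pullback Γ g u u u) = defect Γ g u := by
  rw [fderiv_pullback hg, defect, add_comm]

lemma fderiv_fderiv_comp {F G H : Type*} [NormedAddCommGroup F] [NormedSpace ℝ F]
    [NormedAddCommGroup G] [NormedSpace ℝ G] [NormedAddCommGroup H] [NormedSpace ℝ H]
    {g : G → H} {h : F → G} {u : F} (hg : ContDiffAt ℝ 2 g (h u)) (hh : ContDiffAt ℝ 2 h u)
    (v w : F) : fderiv ℝ (fderiv ℝ (g ∘ h)) u v w =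
      fderiv ℝ (fderiv ℝ g) (h u) (fderiv ℝ h u v) (fderiv ℝ h u w) +
        fderiv ℝ g (h u) (fderiv ℝ (fderiv ℝ h) u v w) := by
  have hg1 : DifferentiableAt ℝ (fderiv ℝ g) (h u) :=
    (hg.fderiv_right (m := 1) (by norm_num)).differentiableAt (by simp)
  have hh1 : DifferentiableAt ℝ (fderiv ℝ h) u :=
    (hh.fderiv_right (m := 1) (by norm_num)).differentiableAt (by simp)
  have hh0 : DifferentiableAt ℝ h u := hh.differentiableAt (by simp)
  have hev : fderiv ℝ (g ∘ h) =ᶠ[𝓝 u] fun y => (fderiv ℝ g (h y)).comp (fderiv ℝ h y) := by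
    filter_upwards [hh.continuousAt (hg.eventually (by simp)), hh.eventually (by simp)] with y h1 h2
    have h1 : ContDiffAt ℝ 2 g (h y) := h1
    exact fderiv_comp y (h1.differentiableAt (by simp)) (h2.differentiableAt (by simp))
  have hd := (hg1.hasFDerivAt.comp u hh0.hasFDerivAt).clm_comp hh1.hasFDerivAt
  rw [hev.fderiv_eq]
  have := congrArg (fun L => L v w) hd.fderiv
  refine this.trans ?_
  simp [add_comm]

/-- Smooth germs of maps at `0` fixing `0`, with derivative the identity there. -/
structure IsTangentToId (g : E → E) : Prop where
  contDiffAt : ∀ᶠ u in 𝓝 0, ContDiffAt ℝ ∞ g u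
  map_zero : g 0 = 0
  fderiv_zero : fderiv ℝ g 0 = ContinuousLinearMap.id ℝ E

namespace IsTangentToId

lemma smooth (hg : IsTangentToId g) : ContDiffAt ℝ ∞ g 0 := hg.contDiffAt.self_of_nhds

lemma tendsto (hg : IsTangentToId g) : Tendsto g (𝓝 0) (𝓝 0) := by
  simpa [hg.map_zero] using hg.smooth.continuousAt.tendsto

lemma isInvertible_zero (hg : IsTangentToId g) : (fderiv ℝ g 0).IsInvertible :=
  ⟨ContinuousLinearEquiv.refl ℝ E, by rw [hg.fderiv_zero]; rfl⟩

lemma isInvertible [CompleteSpace E] (hg : IsTangentToId g) :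
    ∀ᶠ u in 𝓝 0, (fderiv ℝ g u).IsInvertible :=
  (contDiffAt_fderiv hg.smooth).continuousAt
    (isOpen_setOf_isInvertible.mem_nhds hg.isInvertible_zero)

lemma isBigO (hg : IsTangentToId g) : g =O[𝓝 0] fun u : E => ‖u‖ := by
  simpa [hg.map_zero] using (contDiffAt_differentiableAt hg.smooth).isBigO_sub.norm_right

lemma id : IsTangentToId (fun u : E => u) where
  contDiffAt := Eventually.of_forall fun _ => contDiffAt_id
  map_zero := rfl
  fderiv_zero := fderiv_fun_id

lemma comp (hg : IsTangentToId g) (hh : IsTangentToId h) : IsTangentToId (g ∘ h) where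
  contDiffAt := by
    filter_upwards [hh.tendsto hg.contDiffAt, hh.contDiffAt] with u h1 h2
    have h1 : ContDiffAt ℝ ∞ g (h u) := h1
    exact h1.comp u h2
  map_zero := by simp [hg.map_zero, hh.map_zero]
  fderiv_zero := by
    have hg' := contDiffAt_differentiableAt hg.smooth
    rw [← hh.map_zero] at hg'
    rw [fderiv_comp _ hg' (contDiffAt_differentiableAt hh.smooth), hh.map_zero, hg.fderiv_zero,
      hh.fderiv_zero, ContinuousLinearMap.id_comp]

lemma exists_inverse [CompleteSpace E] (hg : IsTangentToId g) :
    ∃ h, IsTangentToId h ∧ g ∘ h =ᶠ[𝓝 0] _root_.id ∧ h ∘ g =ᶠ[𝓝 0] _root_.id := by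
  obtain ⟨Φ, rfl, h0, hs, ht⟩ := exists_openPartialHomeomorph hg.contDiffAt hg.isInvertible_zero
    (Eventually.of_forall fun _ => trivial)
  have h0' : (0 : E) ∈ Φ.target := by simpa [hg.map_zero] using Φ.map_source h0
  have hr : Φ ∘ Φ.symm =ᶠ[𝓝 0] _root_.id := by
    filter_upwards [Φ.open_target.mem_nhds h0'] with u hu using Φ.right_inv hu
  have hl : Φ.symm ∘ Φ =ᶠ[𝓝 0] _root_.id := by
    filter_upwards [Φ.open_source.mem_nhds h0] with u hu using Φ.left_inv hu
  have hm : Φ.symm 0 = 0 := by simpa [hg.map_zero] using Φ.left_inv h0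
  refine ⟨Φ.symm, ⟨?_, hm, ?_⟩, hr, hl⟩
  · filter_upwards [Φ.open_target.mem_nhds h0'] with u hu using ht u hu
  · have h1 := hl.fderiv_eq (𝕜 := ℝ)
    have h2 : DifferentiableAt ℝ Φ.symm (Φ 0) := by
      rw [hg.map_zero]; exact contDiffAt_differentiableAt (ht 0 h0')
    rw [fderiv_comp _ h2 (contDiffAt_differentiableAt hg.smooth), hg.fderiv_zero, hg.map_zero,
      ContinuousLinearMap.comp_id] at h1
    rw [h1, fderiv_id]

end IsTangentToId

lemma isBigO_two_of {F : Type*} [NormedAddCommGroup F] [NormedSpace ℝ F] {f : E → F}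
    (hf : ContDiffAt ℝ ∞ f 0) (h0 : f 0 = 0) (h1 : fderiv ℝ f 0 = 0) :
    IsOrder 2 f :=
  isBigO_of_fderiv (eventually_differentiableAt hf) h0
    (isBigO_of_fderiv (eventually_differentiableAt (contDiffAt_fderiv hf)) h1
      (isBigO_pow_zero (contDiffAt_fderiv (contDiffAt_fderiv hf)).continuousAt))

variable [CompleteSpace E]

lemma contDiffAt_pullback_of (hΓ : ContDiffAt ℝ ∞ Γ (g u)) (hg : ContDiffAt ℝ ∞ g u)
    (hi : (fderiv ℝ g u).IsInvertible) : ContDiffAt ℝ ∞ (pullback Γ g) u :=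
  ContDiffAt.comp u (contDiffAt_transform hi) ((hΓ.comp u hg).prodMk
    ((contDiffAt_fderiv hg).prodMk (contDiffAt_fderiv (contDiffAt_fderiv hg))))

lemma contDiffAt_pullback (hΓ : ContDiffAt ℝ ∞ Γ 0) (hg : IsTangentToId g) :
    ContDiffAt ℝ ∞ (pullback Γ g) 0 :=
  contDiffAt_pullback_of (by rwa [hg.map_zero]) hg.smooth hg.isInvertible_zero

lemma pullback_id : pullback Γ (fun u => u) = Γ := by
  ext u v w
  have : fderiv ℝ (fun u : E => u) = fun _ => ContinuousLinearMap.id ℝ E :=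
    funext fun _ => fderiv_fun_id
  simp [pullback, transform_apply, this]

lemma pullback_congr_left (hg : IsTangentToId g) (h : Γ =ᶠ[𝓝 0] Γ') :
    pullback Γ g =ᶠ[𝓝 0] pullback Γ' g := by
  filter_upwards [hg.tendsto h] with u hu
  have hu : Γ (g u) = Γ' (g u) := hu
  rw [pullback, pullback, hu]

lemma pullback_congr_right (h : g =ᶠ[𝓝 0] g') : pullback Γ g =ᶠ[𝓝 0] pullback Γ g' := by
  filter_upwards [h, h.fderiv (𝕜 := ℝ), (h.fderiv (𝕜 := ℝ)).fderiv (𝕜 := ℝ)] with u h1 h2 h3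
  rw [pullback, pullback, h1, h2, h3]

/-- The second-order chain rule: the two contributions of second derivatives are exactly those of
the two successive transformations. This is what makes `pullback` a right action. -/
lemma pullback_comp (hg : IsTangentToId g) (hh : IsTangentToId h) :
    pullback Γ (g ∘ h) =ᶠ[𝓝 0] pullback (pullback Γ g) h := by
  filter_upwards [hh.isInvertible, hh.tendsto hg.isInvertible, hh.contDiffAt,
    hh.tendsto hg.contDiffAt] with u h1 h2 h3 h4
  have hd : fderiv ℝ (g ∘ h) u = (fderiv ℝ g (h u)).comp (fderiv ℝ h u) :=
    fderiv_comp _ (contDiffAt_differentiableAt h4) (contDiffAt_differentiableAt h3)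
  have h2' : (fderiv ℝ g (h u)).IsInvertible := h2
  refine pullback_eq_of_forall (by rw [hd]; exact h2'.comp h1) fun v w => ?_
  rw [fderiv_fderiv_comp (contDiffAt_two h4) (contDiffAt_two h3), hd]
  simp only [ContinuousLinearMap.comp_apply, Function.comp_apply]
  rw [fderiv_pullback h1, map_add, fderiv_pullback h2', add_assoc]

lemma isBigO_inverse_fderiv (hg : IsTangentToId g) :
    IsOrder 0 (fun u => (fderiv ℝ g u).inverse) :=
  isBigO_pow_zero (ContDiffAt.continuousAt (n := ∞) (ContDiffAt.comp (0 : E)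
    (hg.isInvertible_zero.contDiffAt_map_inverse) (contDiffAt_fderiv hg.smooth)))

/-- The two functions differ by the factor `Dg`, which is bounded near `0` together with its
inverse. -/
lemma pullback_self_isBigO_iff (hg : IsTangentToId g) {k : ℕ} :
    IsOrder k (fun u => pullback Γ g u u u) ↔
      IsOrder k (defect Γ g) := by
  constructor
  · intro h
    refine (isBigO_clm_apply (isBigO_pow_zero (contDiffAt_fderiv hg.smooth).continuousAt) h
      (zero_add k)).congr' ?_ EventuallyEq.rfl
    filter_upwards [hg.isInvertible] with u hu using fderiv_pullback_self hu
  · intro h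
    refine (isBigO_clm_apply (isBigO_inverse_fderiv hg) h (zero_add k)).congr' ?_ EventuallyEq.rfl
    filter_upwards [hg.isInvertible] with u hu
    rw [← fderiv_pullback_self hu, hu.inverse_apply_self]

/-- The intermediate term is `Γ (g' u)`: `Γ` is Lipschitz near `0`, and `g' u = O(|u|)` preserves
orders under composition. -/
lemma comp_sub_comp_isBigO (hΓ : ContDiffAt ℝ ∞ Γ 0) (hg : IsTangentToId g)
    (hg' : IsTangentToId g') {k : ℕ} (hΓΓ' : IsOrder k (fun u => Γ u - Γ' u))
    (hgg' : IsOrder k (fun u => g u - g' u)) :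
    IsOrder k (fun u => Γ (g u) - Γ' (g' u)) := by
  have h1 : IsOrder k (fun u => Γ (g u) - Γ (g' u)) :=
    isOrder_comp_sub_comp hΓ hg.tendsto hg'.tendsto hgg'
  have h2 : IsOrder k (fun u => Γ (g' u) - Γ' (g' u)) :=
    (hΓΓ'.comp_tendsto hg'.tendsto).trans (hg'.isBigO.norm_left.pow k)
  simpa using h1.add h2

/-- The `r`-jet of `pullback Γ g` depends only on the `r`-jet of `Γ` and the `(r+2)`-jet of `g`. -/
lemma pullback_sub_isBigO (hΓ : ContDiffAt ℝ ∞ Γ 0) (hg : IsTangentToId g)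
    (hg' : IsTangentToId g')
    (hΓΓ' : IsOrder (r + 1) (fun u => Γ u - Γ' u))
    (hgg' : IsOrder (r + 3) (fun u => g u - g' u)) :
    IsOrder (r + 1) (fun u => pullback Γ g u - pullback Γ' g' u) := by
  have h0 := comp_sub_comp_isBigO hΓ hg hg' hΓΓ' (isBigO_pow_norm_of_le hgg' (by omega))
  -- The transformation rule involves two derivatives of `g`; each costs one order, which is why `r
  -- + 3` is required.
  have h1 := isBigO_fderiv_sub hg.smooth hg'.smooth hgg'
  have h2 := isBigO_fderiv_sub (contDiffAt_fderiv hg.smooth) (contDiffAt_fderiv hg'.smooth) h1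
  have hΓ0 : Γ' 0 = Γ 0 := by
    have := h0.eq_zero
    rw [hg.map_zero, hg'.map_zero, sub_eq_zero] at this
    exact this.symm
  have e1 : fderiv ℝ g' 0 = fderiv ℝ g 0 := by rw [hg.fderiv_zero, hg'.fderiv_zero]
  have e2 : fderiv ℝ (fderiv ℝ g') 0 = fderiv ℝ (fderiv ℝ g) 0 := by
    exact (sub_eq_zero.1 h2.eq_zero).symm
  have hc0 : Tendsto (fun u => Γ (g u)) (𝓝 0) (𝓝 (Γ 0)) := hΓ.continuousAt.tendsto.comp hg.tendsto
  -- Smoothness of `Γ'` is not available; its limit along `g'` is that of `Γ` along `g`, because the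
  -- difference tends to zero.
  have hc0' : Tendsto (fun u => Γ' (g' u)) (𝓝 0) (𝓝 (Γ 0)) := by
    simpa using hc0.sub h0.tendsto
  have ht : Tendsto (fun u => (Γ (g u), fderiv ℝ g u, fderiv ℝ (fderiv ℝ g) u)) (𝓝 0)
      (𝓝 (Γ 0, fderiv ℝ g 0, fderiv ℝ (fderiv ℝ g) 0)) :=
    hc0.prodMk_nhds ((contDiffAt_fderiv hg.smooth).continuousAt.tendsto.prodMk_nhds
      (contDiffAt_fderiv (contDiffAt_fderiv hg.smooth)).continuousAt.tendsto)
  have ht' : Tendsto (fun u => (Γ' (g' u), fderiv ℝ g' u, fderiv ℝ (fderiv ℝ g') u)) (𝓝 0)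
      (𝓝 (Γ 0, fderiv ℝ g 0, fderiv ℝ (fderiv ℝ g) 0)) := by
    rw [← e1, ← e2]
    exact hc0'.prodMk_nhds ((contDiffAt_fderiv hg'.smooth).continuousAt.tendsto.prodMk_nhds
      (contDiffAt_fderiv (contDiffAt_fderiv hg'.smooth)).continuousAt.tendsto)
  refine isOrder_comp_sub_comp (contDiffAt_transform hg.isInvertible_zero) ht ht' ?_
  exact h0.prodMk (IsOrder.prodMk (isBigO_pow_norm_of_le h1 (by omega)) h2)

/-- A map straightening the geodesics through `0` up to order `r` is unique up to order `r + 2`. -/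
lemma sub_isBigO_of_defect (hΓ : ContDiffAt ℝ ∞ Γ 0) (hg : IsTangentToId g)
    (hg' : IsTangentToId g')
    (hΓΓ' : IsOrder (r + 1) (fun u => Γ u - Γ' u))
    (hd : IsOrder (r + 3) (defect Γ g))
    (hd' : IsOrder (r + 3) (defect Γ' g')) :
    IsOrder (r + 3) (fun u => g u - g' u) := by
  have hs := hg.smooth.sub hg'.smooth
  have h1 : fderiv ℝ (fun u => g u - g' u) 0 = 0 := by
    rw [fderiv_fun_sub (contDiffAt_differentiableAt hg.smooth)
      (contDiffAt_differentiableAt hg'.smooth), hg.fderiv_zero, hg'.fderiv_zero, sub_self]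
  have h0 : g 0 - g' 0 = 0 := by rw [hg.map_zero, hg'.map_zero, sub_self]
  -- If `g - g'` has order `k + 2`, then `Γ(g)` and `Dg` agree with their counterparts to order `k +
  -- 1`. The quadratic terms, contracted twice with `u`, agree to order `k + 3`. Since the defects
  -- are small, so is `D²(g - g')(u, u)`, and the radial estimate gains one order.
  have key : ∀ k ≤ r + 1, IsOrder (k + 2) (fun u => g u - g' u) := by
    intro k
    induction k with
    | zero => exact fun _ => isBigO_two_of hs h0 h1
    | succ k ih =>
      intro hk
      have hi := ih (by omega)
      refine isBigO_of_radial hs h0 h1 (k := k + 1) ?_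
      have hA : IsOrder (k + 1) (fun u => Γ (g u) - Γ' (g' u)) :=
        comp_sub_comp_isBigO hΓ hg hg' (isBigO_pow_norm_of_le hΓΓ' (by omega))
          (isBigO_pow_norm_of_le hi (by omega))
      have hL : IsOrder (k + 1) (fun u => fderiv ℝ g u - fderiv ℝ g' u) :=
        isBigO_fderiv_sub hg.smooth hg'.smooth hi
      have hΓ0 : Tendsto (fun u => Γ (g u)) (𝓝 0) (𝓝 (Γ 0)) :=
        hΓ.continuousAt.tendsto.comp hg.tendsto
      have hΓ'0 : Tendsto (fun u => Γ' (g' u)) (𝓝 0) (𝓝 (Γ 0)) := by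
        simpa using hΓ0.sub hA.tendsto
      have hL0 := (contDiffAt_fderiv hg.smooth).continuousAt.tendsto
      have hL'0 := (contDiffAt_fderiv hg'.smooth).continuousAt.tendsto
      rw [hg.fderiv_zero] at hL0
      rw [hg'.fderiv_zero] at hL'0
      have hp : IsOrder (k + 1) (fun u => pairComp (Γ (g u)) (fderiv ℝ g u) - pairComp (Γ' (g' u)) (fderiv ℝ g' u)) :=
        isOrder_comp_sub_comp contDiff_pairComp.contDiffAt (hΓ0.prodMk_nhds hL0)
          (hΓ'0.prodMk_nhds hL'0) (hA.prodMk hL)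
      have hp2 := isBigO_clm_apply (isBigO_clm_apply hp isBigO_self_pow_one rfl)
        isBigO_self_pow_one rfl
      have hdd := isBigO_pow_norm_of_le (hd.sub hd') (by omega : k + 1 + 2 ≤ r + 3)
      refine (hdd.sub hp2).congr' ?_ EventuallyEq.rfl
      filter_upwards [eventually_differentiableAt hg.smooth, eventually_differentiableAt hg'.smooth,
        (eventually_differentiableAt hg.smooth).eventually_nhds,
        (eventually_differentiableAt hg'.smooth).eventually_nhds,
        eventually_differentiableAt (contDiffAt_fderiv hg.smooth),
        eventually_differentiableAt (contDiffAt_fderiv hg'.smooth)] with u h1 h2 h3 h4 h5 h6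
      have e : fderiv ℝ (fun u => g u - g' u) =ᶠ[𝓝 u] fun u => fderiv ℝ g u - fderiv ℝ g' u := by
        filter_upwards [h3, h4] with y h3 h4 using fderiv_fun_sub h3 h4
      rw [e.fderiv_eq, fderiv_fun_sub h5 h6]
      simp only [defect, sub_apply, pairComp_apply]
      abel
  exact key (r + 1) le_rfl

/-- The normal form of the `r`-jet of `Γ` is unique. -/
lemma pullback_sub_isBigO_of_normal (hΓ : ContDiffAt ℝ ∞ Γ 0) (hg : IsTangentToId g)
    (hg' : IsTangentToId g')
    (hΓΓ' : IsOrder (r + 1) (fun u => Γ u - Γ' u))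
    (hd : IsOrder (r + 3) (fun u => pullback Γ g u u u))
    (hd' : IsOrder (r + 3) (fun u => pullback Γ' g' u u u)) :
    IsOrder (r + 1) (fun u => pullback Γ g u - pullback Γ' g' u) :=
  pullback_sub_isBigO hΓ hg hg' hΓΓ' (sub_isBigO_of_defect hΓ hg hg' hΓΓ'
    ((pullback_self_isBigO_iff hg).1 hd) ((pullback_self_isBigO_iff hg').1 hd'))

end Germs

universe u

/-! ### Smoothness of composition operators on spaces of continuous maps. -/

section Nemytskii

/-- The Banach space of continuous maps on a compact space, with the supremum norm. -/
def Curves (K E : Type*) [TopologicalSpace K] [NormedAddCommGroup E] : Type _ := C(K, E)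

variable {K : Type*} [TopologicalSpace K] [CompactSpace K]
variable {E F G : Type u} [NormedAddCommGroup E] [NormedSpace ℝ E]
  [NormedAddCommGroup F] [NormedSpace ℝ F] [NormedAddCommGroup G] [NormedSpace ℝ G]

namespace Curves

instance : NormedAddCommGroup (Curves K E) := inferInstanceAs (NormedAddCommGroup C(K, E))

instance : NormedSpace ℝ (Curves K E) := inferInstanceAs (NormedSpace ℝ C(K, E))

instance [CompleteSpace E] : CompleteSpace (Curves K E) :=
  inferInstanceAs (CompleteSpace C(K, E))

instance : FunLike (Curves K E) K E := inferInstanceAs (FunLike C(K, E) K E)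

/-- The element of `Curves K E` given by a continuous map. -/
def mk (f : K → E) (hf : Continuous f) : Curves K E := (⟨f, hf⟩ : C(K, E))

@[simp] lemma mk_apply (f : K → E) (hf : Continuous f) (t : K) : mk f hf t = f t := rfl

@[ext] lemma ext {p q : Curves K E} (h : ∀ t, p t = q t) : p = q := DFunLike.ext _ _ h

@[simp] lemma add_apply (p q : Curves K E) (t : K) : (p + q) t = p t + q t := rfl

@[simp] lemma sub_apply (p q : Curves K E) (t : K) : (p - q) t = p t - q t := rfl

@[simp] lemma smul_apply (c : ℝ) (p : Curves K E) (t : K) : (c • p) t = c • p t := rfl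

lemma continuous (p : Curves K E) : Continuous p := ContinuousMap.continuous (p : C(K, E))

lemma norm_le (p : Curves K E) {C : ℝ} (hC : 0 ≤ C) : ‖p‖ ≤ C ↔ ∀ t, ‖p t‖ ≤ C :=
  ContinuousMap.norm_le (p : C(K, E)) hC

lemma norm_coe_le_norm (p : Curves K E) (t : K) : ‖p t‖ ≤ ‖p‖ :=
  ContinuousMap.norm_coe_le_norm (p : C(K, E)) t

variable (E) in
/-- Evaluation at a point. -/
def eval (t : K) : Curves K E →L[ℝ] E :=
  LinearMap.mkContinuous ⟨⟨fun p => p t, fun _ _ => rfl⟩, fun _ _ => rfl⟩ 1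
    fun p => (norm_coe_le_norm p t).trans (one_mul ‖p‖).ge

variable (K E) in
/-- Constant maps. -/
def const : E →L[ℝ] Curves K E :=
  LinearMap.mkContinuous ⟨⟨fun v => mk (fun _ => v) continuous_const, fun _ _ => rfl⟩,
    fun _ _ => rfl⟩ 1 fun v => (norm_le _ (by positivity)).2 fun _ => (one_mul ‖v‖).ge

/-- Composition with a continuous map. -/
def map {f : E → F} (hf : Continuous f) (p : Curves K E) : Curves K F :=
  mk (fun t => f (p t)) (hf.comp p.continuous)

@[simp] lemma map_apply {f : E → F} (hf : Continuous f) (p : Curves K E) (t : K) :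
    map hf p t = f (p t) := rfl

lemma continuous_map {f : E → F} (hf : Continuous f) : Continuous (map hf : Curves K E → _) :=
  ContinuousMap.continuous_postcomp (X := K) ⟨f, hf⟩

end Curves

variable (K E F) in
/-- Pointwise application of continuous families of linear maps. -/
def pointwiseApply : Curves K (E →L[ℝ] F) →L[ℝ] Curves K E →L[ℝ] Curves K F :=
  LinearMap.mkContinuous₂ (LinearMap.mk₂ ℝ
    (fun (A : Curves K (E →L[ℝ] F)) (p : Curves K E) =>
      Curves.mk (fun t => A t (p t)) (A.continuous.clm_apply p.continuous))
    (fun _ _ _ => by ext; simp) (fun _ _ _ => by ext; simp)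
    (fun _ _ _ => by ext; simp) (fun _ _ _ => by ext; simp)) 1 fun A p => by
      rw [one_mul]
      refine (Curves.norm_le _ (by positivity)).2 fun t => ?_
      exact ((A t).le_opNorm _).trans
        (mul_le_mul (A.norm_coe_le_norm t) (p.norm_coe_le_norm t) (norm_nonneg _) (norm_nonneg _))

@[simp] lemma pointwiseApply_apply (A : Curves K (E →L[ℝ] F)) (p : Curves K E) (t : K) :
    pointwiseApply K E F A p t = A t (p t) := rfl

lemma contDiff_pointwiseApply {A : G → Curves K (E →L[ℝ] F)} {p : G → Curves K E} {n : WithTop ℕ∞}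
    (hA : ContDiff ℝ n A) (hp : ContDiff ℝ n p) :
    ContDiff ℝ n fun x => pointwiseApply K E F (A x) (p x) :=
  ((pointwiseApply K E F).contDiff.comp hA).clm_apply hp

/-- Both factors vanish at `0`, so both terms of the product rule do. -/
lemma hasFDerivAt_pointwiseApply_zero {A : Curves K E → Curves K (E →L[ℝ] F)}
    (hA : DifferentiableAt ℝ A 0) (h0 : A 0 = 0) :
    HasFDerivAt (fun p => pointwiseApply K E F (A p) p) (0 : Curves K E →L[ℝ] Curves K F) 0 := by
  have := ((pointwiseApply K E F).hasFDerivAt.comp 0 hA.hasFDerivAt).clm_apply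
    (hasFDerivAt_id (0 : Curves K E))
  refine this.congr_fderiv ?_
  ext p : 1
  simp [h0]

/-- The mean value inequality is applied pointwise on the segment from `p t` to `p t + q t`. The
estimate is uniform in `t` because composition with `fderiv ℝ f` is continuous in the supremum norm.
-/
lemma hasFDerivAt_postcomp {f : E → F} (hf : ContDiff ℝ 1 f) (p : Curves K E) :
    HasFDerivAt (fun p : Curves K E => Curves.map hf.continuous p)
      (pointwiseApply K E F
        (Curves.map (hf.continuous_fderiv (by simp)) p)) p := by
  rw [hasFDerivAt_iff_isLittleO_nhds_zero, Asymptotics.isLittleO_iff]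
  intro ε hε
  set N : Curves K E → Curves K (E →L[ℝ] F) := fun p =>
    Curves.map (hf.continuous_fderiv (by simp)) p with hN
  have hNc : Continuous N := Curves.continuous_map _
  obtain ⟨δ, hδ, hb⟩ := Metric.continuousAt_iff.1 (hNc.continuousAt (x := p)) ε hε
  filter_upwards [Metric.ball_mem_nhds (0 : Curves K E) hδ] with q hq
  refine (Curves.norm_le _ (by positivity)).2 fun t => ?_
  have hbound : ∀ y ∈ segment ℝ (p t) (p t + q t), ‖fderiv ℝ f y - fderiv ℝ f (p t)‖ ≤ ε := by
    intro y hy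
    rw [segment_eq_image'] at hy
    obtain ⟨s, hs, rfl⟩ := hy
    have hsq : dist (p + s • q) p < δ := by
      rw [dist_eq_norm, add_sub_cancel_left, norm_smul, Real.norm_of_nonneg hs.1]
      have := mem_ball_zero_iff.1 hq
      nlinarith [norm_nonneg q, hs.2]
    have h1 := hb hsq
    rw [dist_eq_norm] at h1
    have h2 := ((N (p + s • q) - N p).norm_coe_le_norm t).trans h1.le
    simpa [hN] using h2
  have := Convex.norm_image_sub_le_of_norm_fderiv_le' (𝕜 := ℝ)
    (fun y _ => (hf.differentiable (by simp)) y) hbound (convex_segment _ _)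
    (left_mem_segment ℝ _ _) (right_mem_segment ℝ _ _)
  rw [add_sub_cancel_left] at this
  exact this.trans (by gcongr; exact q.norm_coe_le_norm t)

/-- The derivative of composition with `f` is composition with `fderiv ℝ f`, followed by a bounded
bilinear operation. The induction therefore changes the target to `E →L[ℝ] F`, which is why `F` is
quantified and lives in the universe of `E`. -/
lemma contDiff_postcomp_nat (n : ℕ) : ∀ {F : Type u} [NormedAddCommGroup F] [NormedSpace ℝ F]
    {f : E → F} (hf : ContDiff ℝ ∞ f),
    ContDiff ℝ n (fun p : Curves K E => Curves.map hf.continuous p) := by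
  induction n with
  | zero => exact fun hf => contDiff_zero.2 (Curves.continuous_map _)
  | succ n ih =>
    intro F _ _ f hf
    push_cast
    rw [contDiff_succ_iff_hasFDerivAt]
    exact ⟨fun p => pointwiseApply K E F (Curves.map (hf.continuous_fderiv (by simp)) p),
      (pointwiseApply K E F).contDiff.comp (ih (hf.fderiv_right (m := ∞) (by simp))),
      fun p => hasFDerivAt_postcomp (hf.of_le (by exact_mod_cast le_top)) p⟩

/-- Composition with a smooth map is a smooth map between spaces of continuous maps. -/
lemma contDiff_postcomp {f : E → F} (hf : ContDiff ℝ ∞ f) :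
    ContDiff ℝ ∞ (fun p : Curves K E => Curves.map hf.continuous p) :=
  contDiff_infty.2 fun n => contDiff_postcomp_nat n hf

end Nemytskii

/-! ### The exponential map, by inverting the integrated geodesic equation. -/

section Exponential

variable {E : Type u} [NormedAddCommGroup E] [NormedSpace ℝ E]

local notation "𝕀" => Set.Icc (0 : ℝ) 1

/-- The continuous extension of a path to the real line. -/
def extendPath (p : Curves 𝕀 E) : ℝ → E := Set.IccExtend zero_le_one p

lemma continuous_extendPath (p : Curves 𝕀 E) : Continuous (extendPath p) := p.continuous.Icc_extend'

lemma extendPath_of_mem (p : Curves 𝕀 E) {t : ℝ} (ht : t ∈ 𝕀) : extendPath p t = p ⟨t, ht⟩ :=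
  Set.IccExtend_of_mem _ _ ht

lemma norm_extendPath_le (p : Curves 𝕀 E) (t : ℝ) : ‖extendPath p t‖ ≤ ‖p‖ :=
  p.norm_coe_le_norm _

variable (E) in
/-- The primitive of a path vanishing at time `0`. -/
def primitive : Curves 𝕀 E →L[ℝ] Curves 𝕀 E :=
  LinearMap.mkContinuous
    { toFun p := Curves.mk (fun t : 𝕀 => ∫ s in (0 : ℝ)..t, extendPath p s)
        ((intervalIntegral.continuous_primitive
          (fun a b => (continuous_extendPath p).intervalIntegrable a b) 0).comp
          continuous_subtype_val)
      map_add' p q := by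
        ext t
        exact intervalIntegral.integral_add ((continuous_extendPath p).intervalIntegrable _ _)
          ((continuous_extendPath q).intervalIntegrable _ _)
      map_smul' c p := by
        ext t
        exact intervalIntegral.integral_smul c (extendPath p) } 1 fun p => by
    refine (Curves.norm_le _ (by positivity)).2 fun t => ?_
    refine (intervalIntegral.norm_integral_le_of_norm_le_const
      fun s _ => norm_extendPath_le p s).trans ?_
    rw [sub_zero, abs_of_nonneg t.2.1, one_mul]
    exact mul_le_of_le_one_right (norm_nonneg _) t.2.2

lemma primitive_apply (p : Curves 𝕀 E) (t : 𝕀) :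
    primitive E p t = ∫ s in (0 : ℝ)..t, extendPath p s := rfl

/-- The path `t ↦ s p(s t)`. -/
def rescale (s : 𝕀) (p : Curves 𝕀 E) : Curves 𝕀 E :=
  Curves.mk (fun t => (s : ℝ) • p (s * t))
    ((p.continuous.comp (continuous_const.mul continuous_id)).const_smul _)

lemma extendPath_rescale (s : 𝕀) (p : Curves 𝕀 E) {t : ℝ} (ht : t ∈ 𝕀) :
    extendPath (rescale s p) t = (s : ℝ) • extendPath p (s * t) := by
  rw [extendPath_of_mem _ ht, extendPath_of_mem p (t := s * t) (s * ⟨t, ht⟩ : 𝕀).2]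
  rfl

lemma primitive_rescale (s : 𝕀) (p : Curves 𝕀 E) (t : 𝕀) :
    primitive E (rescale s p) t = primitive E p (s * t) := by
  rw [primitive_apply, primitive_apply]
  have h1 : ∫ τ in (0 : ℝ)..t, extendPath (rescale s p) τ =
      ∫ τ in (0 : ℝ)..t, (s : ℝ) • extendPath p (s * τ) := by
    refine intervalIntegral.integral_congr fun τ hτ => ?_
    rw [Set.uIcc_of_le t.2.1] at hτ
    exact extendPath_rescale s p ⟨hτ.1, hτ.2.trans t.2.2⟩
  rw [h1, intervalIntegral.integral_smul, intervalIntegral.smul_integral_comp_mul_left, mul_zero]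
  rfl

lemma norm_rescale_le (s : 𝕀) (p : Curves 𝕀 E) : ‖rescale s p‖ ≤ ‖p‖ := by
  refine (Curves.norm_le _ (by positivity)).2 fun t => ?_
  simp only [rescale, Curves.mk_apply, norm_smul, Real.norm_of_nonneg s.2.1]
  exact (mul_le_of_le_one_left (norm_nonneg _) s.2.2).trans (p.norm_coe_le_norm _)

/-- The acceleration term of the geodesic equation, for the curve starting at `0` with
velocity `p`. -/
def geodesicTerm {Γ : E → E →L[ℝ] E →L[ℝ] E} (hΓ : Continuous Γ) (p : Curves 𝕀 E) : Curves 𝕀 E :=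
  pointwiseApply 𝕀 E E (pointwiseApply 𝕀 E (E →L[ℝ] E)
    (Curves.map hΓ (primitive E p)) p) p

variable {Γ : E → E →L[ℝ] E →L[ℝ] E}

lemma geodesicTerm_apply (hΓ : Continuous Γ) (p : Curves 𝕀 E) (t : 𝕀) :
    geodesicTerm hΓ p t = Γ (primitive E p t) (p t) (p t) := rfl

lemma geodesicTerm_rescale (hΓ : Continuous Γ) (s : 𝕀) (p : Curves 𝕀 E) :
    geodesicTerm hΓ (rescale s p) = (s : ℝ) • rescale s (geodesicTerm hΓ p) := by
  ext t
  rw [geodesicTerm_apply, primitive_rescale]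
  simp [rescale, geodesicTerm_apply]

/-- The integrated geodesic equation for the curve starting at `0` with velocity `p` reads
`geodesicMap p = v`, where `v` is the initial velocity. -/
def geodesicMap (hΓ : Continuous Γ) (p : Curves 𝕀 E) : Curves 𝕀 E :=
  p + primitive E (geodesicTerm hΓ p)

/-- The homogeneity of geodesics: if `c` is one then so is `t ↦ c (s t)`, with velocity `s` times as
large. It holds because the acceleration term is quadratic in the velocity. -/
lemma geodesicMap_rescale (hΓ : Continuous Γ) (s : 𝕀) (p : Curves 𝕀 E) :
    geodesicMap hΓ (rescale s p) = rescale s (geodesicMap hΓ p) := by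
  ext t
  simp only [geodesicMap, geodesicTerm_rescale, map_smul, Curves.add_apply,
    Curves.smul_apply, primitive_rescale]
  simp [rescale]

variable [CompleteSpace E]

/-- The acceleration term is a product of `p` with a factor that vanishes at `p = 0`, so it
contributes nothing to the derivative there. -/
lemma isTangentToId_geodesicMap (hΓ : ContDiff ℝ ∞ Γ) :
    IsTangentToId (geodesicMap hΓ.continuous) := by
  set A : Curves 𝕀 E → Curves 𝕀 (E →L[ℝ] E) := fun p => pointwiseApply 𝕀 E (E →L[ℝ] E)
    (Curves.map hΓ.continuous (primitive E p)) p with hA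
  have hAs : ContDiff ℝ ∞ A :=
    contDiff_pointwiseApply ((contDiff_postcomp hΓ).comp (primitive E).contDiff) contDiff_id
  have hT : ContDiff ℝ ∞ fun p => pointwiseApply 𝕀 E E (A p) p :=
    contDiff_pointwiseApply hAs contDiff_id
  have hs : ContDiff ℝ ∞ (geodesicMap hΓ.continuous) :=
    contDiff_id.add ((primitive E).contDiff.comp hT)
  refine ⟨Eventually.of_forall fun p => hs.contDiffAt, ?_, ?_⟩
  · simp [geodesicMap, geodesicTerm]
  · have hA0 : A 0 = 0 := by ext; simp [hA]
    have d3 := hasFDerivAt_pointwiseApply_zero (hAs.differentiable (by simp)).differentiableAt hA0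
    have := (hasFDerivAt_id (0 : Curves 𝕀 E)).add ((primitive E).hasFDerivAt.comp 0 d3)
    rw [ContinuousLinearMap.comp_zero, add_zero] at this
    exact this.fderiv

lemma hasDerivAt_integral_extendPath (p : Curves 𝕀 E) (t : ℝ) :
    HasDerivAt (fun t => ∫ s in (0 : ℝ)..t, extendPath p s) (extendPath p t) t :=
  intervalIntegral.integral_hasDerivAt_right ((continuous_extendPath p).intervalIntegrable _ _)
    (continuous_extendPath p).stronglyMeasurable.stronglyMeasurableAtFilter
    (continuous_extendPath p).continuousAt

/-- The exponential map of a connection on a vector space: there are coordinates at `0` in which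
the straight lines through `0` are geodesics. -/
lemma exists_defect_eq_zero (hΓ : ContDiff ℝ ∞ Γ) :
    ∃ e : E → E, IsTangentToId e ∧ ∀ᶠ u in 𝓝 0, defect Γ e u = 0 := by
  -- `W` sends a constant path `v` to the velocity of the geodesic with initial velocity `v`;
  -- working with velocities on `[0, 1]` gives smooth dependence on `v` at once.
  obtain ⟨W, hW, hMW, hWM⟩ := (isTangentToId_geodesicMap hΓ).exists_inverse
  let ev : Curves 𝕀 E →L[ℝ] E := Curves.eval E (1 : 𝕀)
  let c : E →L[ℝ] Curves 𝕀 E := Curves.const 𝕀 E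
  have hc : Tendsto c (𝓝 0) (𝓝 0) := c.continuous.tendsto' _ _ (map_zero c)
  -- The endpoint at time `1` of the geodesic with initial velocity `v`.
  set e : E → E := fun v => (ev ∘L primitive E) (W (c v)) with he
  have hes : ∀ᶠ v in 𝓝 0, ContDiffAt ℝ ∞ e v := by
    filter_upwards [hc hW.contDiffAt] with v hv
    have hv : ContDiffAt ℝ ∞ W (c v) := hv
    exact (ev ∘L primitive E).contDiff.contDiffAt.comp v (hv.comp v c.contDiff.contDiffAt)
  refine ⟨e, ⟨hes, ?_, ?_⟩, ?_⟩
  · simp [he, hW.map_zero]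
  · have h1 : HasFDerivAt W (ContinuousLinearMap.id ℝ (Curves 𝕀 E)) (c 0) := by
      rw [← hW.fderiv_zero, map_zero]
      exact (contDiffAt_differentiableAt hW.smooth).hasFDerivAt
    have h2 : HasFDerivAt e _ 0 :=
      (ev ∘L primitive E).hasFDerivAt.comp 0 (h1.comp 0 c.hasFDerivAt)
    rw [h2.fderiv]
    ext v
    have : ∀ s : ℝ, extendPath (c v) s = v := fun s => rfl
    change ∫ s in (0 : ℝ)..1, extendPath (c v) s = v
    simp [this]
  · obtain ⟨ρ, hρ, hball⟩ := Metric.eventually_nhds_iff_ball.1 hWM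
    -- By rescaling, `s ↦ e (s v)` is the geodesic itself on `[0, 1]`.
    have hline : ∀ᶠ v in 𝓝 (0 : E), ∀ s : 𝕀, e ((s : ℝ) • v) =
        ∫ t in (0 : ℝ)..s, extendPath (W (c v)) t := by
      filter_upwards [hc hMW, (hW.tendsto.comp hc) (Metric.ball_mem_nhds _ hρ)] with v h1 h2 s
      have h1 : geodesicMap hΓ.continuous (W (c v)) = c v := h1
      have h2 : W (c v) ∈ Metric.ball 0 ρ := h2
      have h3 : geodesicMap hΓ.continuous (rescale s (W (c v))) = c ((s : ℝ) • v) := by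
        rw [geodesicMap_rescale, h1]; rfl
      -- Rescaling by `s ≤ 1` does not increase the norm, so the path stays in the ball where `W` is
      -- a left inverse.
      have h4 : rescale s (W (c v)) ∈ Metric.ball 0 ρ := by
        rw [mem_ball_zero_iff] at h2 ⊢
        exact (norm_rescale_le _ _).trans_lt h2
      have h5 : W (geodesicMap hΓ.continuous (rescale s (W (c v)))) = rescale s (W (c v)) :=
        hball _ h4
      rw [h3] at h5
      simp only [he, h5]
      change primitive E (rescale s (W (c v))) 1 = _
      rw [primitive_rescale, mul_one]
      rfl
    -- Paths live on `[0, 1]`, so the equation is differentiated at the interior time `1 / 2`, and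
    -- `v = 2 u` is substituted afterwards.
    have hgeo : ∀ᶠ v in 𝓝 (0 : E), defect Γ e ((1 / 2 : ℝ) • v) = 0 := by
      have hsm : ∀ᶠ v in 𝓝 (0 : E), ContDiffAt ℝ ∞ e ((1 / 2 : ℝ) • v) :=
        (by fun_prop : Continuous fun v : E => (1 / 2 : ℝ) • v).tendsto' 0 0 (by simp) hes
      filter_upwards [hline, hsm, hc hMW] with v h1 h2 h3
      have h3 : geodesicMap hΓ.continuous (W (c v)) = c v := h3
      set p := W (c v) with hp
      obtain ⟨ε, hε, hnear⟩ := Metric.eventually_nhds_iff_ball.1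
        (((by fun_prop : Continuous fun s : ℝ => s • v).tendsto (1 / 2))
          ((contDiffAt_two h2).eventually (by simp)))
      have hmem : ∀ᶠ s in 𝓝 (1 / 2 : ℝ), s ∈ Set.Ioo (0 : ℝ) 1 ∧ s ∈ Metric.ball (1 / 2 : ℝ) ε :=
        Eventually.and (Ioo_mem_nhds (by norm_num) (by norm_num)) (Metric.ball_mem_nhds _ hε)
      have hI : ∀ {s : ℝ}, s ∈ Set.Ioo (0 : ℝ) 1 → s ∈ 𝕀 := fun hs => ⟨hs.1.le, hs.2.le⟩
      have d1 : ∀ s, s ∈ Set.Ioo (0 : ℝ) 1 → s ∈ Metric.ball (1 / 2 : ℝ) ε →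
          fderiv ℝ e (s • v) v = extendPath p s := by
        intro s hs hsε
        have hce : ContDiffAt ℝ 2 e (s • v) := hnear s hsε
        have e1 := hasDerivAt_line (u := v) (t := s) (hce.differentiableAt (by simp))
        have e2 : HasDerivAt (fun s : ℝ => e (s • v)) (extendPath p s) s := by
          refine (hasDerivAt_integral_extendPath p s).congr_of_eventuallyEq ?_
          filter_upwards [Ioo_mem_nhds hs.1 hs.2] with τ hτ using h1 ⟨τ, hI hτ⟩
        exact e1.unique e2
      have hpt : ∀ s, (hs : s ∈ Set.Ioo (0 : ℝ) 1) → extendPath p s =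
          v - ∫ t in (0 : ℝ)..s, extendPath (geodesicTerm hΓ.continuous p) t := by
        intro s hs
        have := congrArg (fun q : Curves 𝕀 E => q ⟨s, hI hs⟩) h3
        rw [extendPath_of_mem _ (hI hs), eq_sub_iff_add_eq]
        exact this
      have hhalf : (1 / 2 : ℝ) ∈ Set.Ioo (0 : ℝ) 1 := by norm_num
      have e1 := hasDerivAt_fderiv_line (u := v) (t := 1 / 2) (contDiffAt_two h2)
      have e2 : HasDerivAt (fun s : ℝ => fderiv ℝ e (s • v) v)
          (-extendPath (geodesicTerm hΓ.continuous p) (1 / 2)) (1 / 2) := by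
        refine ((hasDerivAt_integral_extendPath (geodesicTerm hΓ.continuous p)
          (1 / 2)).const_sub v).congr_of_eventuallyEq ?_
        filter_upwards [hmem] with s hs
        rw [d1 s hs.1 hs.2, hpt s hs.1]
      have e3 := e1.unique e2
      rw [extendPath_of_mem _ (hI hhalf), geodesicTerm_apply] at e3
      have e4 : primitive E p ⟨1 / 2, hI hhalf⟩ = e ((1 / 2 : ℝ) • v) :=
        (h1 ⟨1 / 2, hI hhalf⟩).symm
      have e5 : p ⟨1 / 2, hI hhalf⟩ = fderiv ℝ e ((1 / 2 : ℝ) • v) v := by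
        rw [d1 _ hhalf (Metric.mem_ball_self hε), extendPath_of_mem _ (hI hhalf)]
      rw [e4, e5] at e3
      simp only [defect, map_smul, smul_apply]
      rw [e3, ← smul_add, ← smul_add, neg_add_cancel, smul_zero, smul_zero]
    have := (by fun_prop : Continuous fun v : E => (2 : ℝ) • v).tendsto' 0 0 (by simp) hgeo
    filter_upwards [this] with u hu
    simpa [smul_smul] using hu

end Exponential

/-! ### Derivatives in one variable, smoothly in a parameter. -/

section Slices

variable {P E F : Type*} [NormedAddCommGroup P] [NormedSpace ℝ P] [NormedAddCommGroup E]
  [NormedSpace ℝ E] [NormedAddCommGroup F] [NormedSpace ℝ F]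

lemma contDiffAt_fderiv_slice {f : P → E → F} {q : P × E}
    (hf : ContDiffAt ℝ ∞ (fun q : P × E => f q.1 q.2) q) :
    ContDiffAt ℝ ∞ (fun q : P × E => fderiv ℝ (f q.1) q.2) q := by
  refine ContDiffAt.fderiv (f := fun q : P × E => f q.1) (g := Prod.snd) (n := ∞) ?_ contDiffAt_snd
    (by simp)
  exact ContDiffAt.comp (g := fun q : P × E => f q.1 q.2)
    (f := fun z : (P × E) × E => (z.1.1, z.2)) (q, q.2) hf (by fun_prop)

lemma contDiffAt_iteratedFDeriv_slice {f : P → E → F} {q : P × E}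
    (hf : ContDiffAt ℝ ∞ (fun q : P × E => f q.1 q.2) q) (m : ℕ) :
    ContDiffAt ℝ ∞ (fun q : P × E => iteratedFDeriv ℝ m (f q.1) q.2) q := by
  induction m with
  | zero =>
    exact (continuousMultilinearCurryFin0 ℝ E F).symm.contDiff.contDiffAt.comp q hf
  | succ m ih =>
    exact (continuousMultilinearCurryLeftEquiv ℝ (fun _ : Fin (m + 1) => E) F).symm.contDiff.contDiffAt.comp q
      (contDiffAt_fderiv_slice (f := fun p => iteratedFDeriv ℝ m (f p)) ih)

lemma contDiff_iteratedFDeriv_slice {f : P → E → F} {a : E}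
    (hf : ∀ p, ContDiffAt ℝ ∞ (fun q : P × E => f q.1 q.2) (p, a)) (m : ℕ) :
    ContDiff ℝ ∞ fun p => iteratedFDeriv ℝ m (f p) a := by
  refine contDiff_iff_contDiffAt.2 fun p => ?_
  exact ContDiffAt.comp (f := fun p => (p, a)) p (contDiffAt_iteratedFDeriv_slice (hf p) m)
    (by fun_prop)

lemma contDiffAt_slice {f : P → E → F} {p : P} {a : E}
    (hf : ContDiffAt ℝ ∞ (fun q : P × E => f q.1 q.2) (p, a)) : ContDiffAt ℝ ∞ (f p) a :=
  ContDiffAt.comp (f := fun u => (p, u)) a hf (by fun_prop)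

lemma contDiff_multilinear_diagonal [CompleteSpace F] {n : ℕ} {c : P → E [×n]→L[ℝ] F} (hc : ContDiff ℝ ∞ c) :
    ContDiff ℝ ∞ fun q : P × E => c q.1 fun _ => q.2 := by
  refine contDiff_iff_contDiffAt.2 fun q => ?_
  exact ContDiffAt.comp (g := fun z : (E [×n]→L[ℝ] F) × (Fin n → E) => z.1 z.2)
    (f := fun q : P × E => (c q.1, fun _ => q.2)) q
    ((ContinuousLinearMap.id ℝ (E [×n]→L[ℝ] F)).analyticAt_uncurry_of_multilinear).contDiffAt
    (by fun_prop)

end Slices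

/-! ### Euler's relation. -/

section Homogeneous

variable {E F : Type*} [NormedAddCommGroup E] [NormedSpace ℝ E] [NormedAddCommGroup F]
  [NormedSpace ℝ F]

/-- Along the ray, `σ (t u) = t ^ n σ u`; this is differentiated twice at `t = 1`. -/
lemma fderiv_fderiv_of_homogeneous {σ : E → F} (hσ : ContDiff ℝ ∞ σ) {n : ℕ}
    (h : ∀ (s : ℝ) u, σ (s • u) = s ^ n • σ u) (u : E) :
    fderiv ℝ (fderiv ℝ σ) u u u = ((n : ℝ) * (n - 1 : ℕ)) • σ u := by
  have h1 : ∀ s : ℝ, fderiv ℝ σ (s • u) u = ((n : ℝ) * s ^ (n - 1)) • σ u := fun s => by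
    have e1 := hasDerivAt_line (f := σ) (u := u) (t := s) (contDiffAt_differentiableAt hσ.contDiffAt)
    have e2 := (hasDerivAt_pow n s).smul_const (σ u)
    simp only [h] at e1
    exact e1.unique e2
  have e1 := hasDerivAt_fderiv_line (f := σ) (u := u) (t := 1) (contDiffAt_two hσ.contDiffAt)
  simp only [h1, one_smul] at e1
  have e2 := ((hasDerivAt_pow (n - 1) (1 : ℝ)).const_mul (n : ℝ)).smul_const (σ u)
  simpa using e1.unique e2

end Homogeneous

/-! ### Approximate normal coordinates depending smoothly on parameters. -/

section Normalizer

variable {P E : Type*} [NormedAddCommGroup P] [NormedSpace ℝ P] [NormedAddCommGroup E]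
  [NormedSpace ℝ E] [CompleteSpace E]

/-- Only the second derivative of `σ` matters to this order: `σ` and `Dσ` change the quadratic
coefficient by `O(|u|^(k+1))`, and contraction with `u` twice adds two orders. -/
lemma defect_add_isBigO {Γ : E → E →L[ℝ] E →L[ℝ] E} {g σ : E → E} (hΓ : ContDiffAt ℝ ∞ Γ 0)
    (hg : IsTangentToId g) (hσ : ContDiffAt ℝ ∞ σ 0) {k : ℕ} (h : IsOrder (k + 2) σ) :
    IsOrder (k + 3) (fun u => defect Γ (fun u => g u + σ u) u - defect Γ g u - fderiv ℝ (fderiv ℝ σ) u u u) := by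
  have hD := isBigO_fderiv hσ (k := k + 1) h
  have hσ0 := h.eq_zero
  have hDσ0 := hD.eq_zero
  have hgσ : Tendsto (fun u => g u + σ u) (𝓝 0) (𝓝 0) := by
    simpa using hg.tendsto.add h.tendsto
  have hA : IsOrder (k + 1) (fun u => Γ (g u + σ u) - Γ (g u)) :=
    isOrder_comp_sub_comp hΓ hgσ hg.tendsto
      (by simpa using isBigO_pow_norm_of_le h (by omega))
  have hL0 := (contDiffAt_fderiv hg.smooth).continuousAt.tendsto
  have hL1 := (contDiffAt_fderiv hσ).continuousAt.tendsto
  have hL2 := hL0.add hL1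
  rw [hDσ0, add_zero] at hL2
  have hp : IsOrder (k + 1) (fun u => pairComp (Γ (g u + σ u)) (fderiv ℝ g u + fderiv ℝ σ u) -
      pairComp (Γ (g u)) (fderiv ℝ g u)) :=
    isOrder_comp_sub_comp contDiff_pairComp.contDiffAt
      ((hΓ.continuousAt.tendsto.comp hgσ).prodMk_nhds hL2)
      ((hΓ.continuousAt.tendsto.comp hg.tendsto).prodMk_nhds hL0)
      (hA.prodMk (by simpa using hD))
  have hp2 := isBigO_clm_apply (isBigO_clm_apply hp isBigO_self_pow_one rfl)
    isBigO_self_pow_one rfl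
  refine hp2.congr' ?_ EventuallyEq.rfl
  filter_upwards [eventually_differentiableAt hg.smooth, eventually_differentiableAt hσ,
    (eventually_differentiableAt hg.smooth).eventually_nhds,
    (eventually_differentiableAt hσ).eventually_nhds,
    eventually_differentiableAt (contDiffAt_fderiv hg.smooth),
    eventually_differentiableAt (contDiffAt_fderiv hσ)] with u h1 h2 h3 h4 h5 h6
  have e : fderiv ℝ (fun u => g u + σ u) =ᶠ[𝓝 u] fun u => fderiv ℝ g u + fderiv ℝ σ u := by
    filter_upwards [h3, h4] with y h3 h4 using fderiv_fun_add h3 h4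
  simp only [defect]
  rw [e.fderiv_eq, e.eq_of_nhds, fderiv_fun_add h5 h6]
  simp only [sub_apply, pairComp_apply, add_apply]
  abel

/-- Each induction step kills the leading homogeneous term of the defect by a correction of the same
degree. The correction is built from derivatives of the defect at `0`, so the family stays smooth in
`p`; this is the point of working to finite order here instead of using the exponential map. -/
lemma exists_normalizer {G : P → E → E →L[ℝ] E →L[ℝ] E}
    (hG : ContDiff ℝ ∞ fun q : P × E => G q.1 q.2) (k : ℕ) :
    ∃ τ : P → E → E, (ContDiff ℝ ∞ fun q : P × E => τ q.1 q.2) ∧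
      ∀ p, IsTangentToId (τ p) ∧ IsOrder (k + 2) (defect (G p) (τ p)) := by
  induction k with
  | zero =>
    refine ⟨fun _ u => u, contDiff_snd, fun p => ⟨.id, ?_⟩⟩
    have e : fderiv ℝ (fun u : E => u) = fun _ => ContinuousLinearMap.id ℝ E :=
      funext fun _ => fderiv_fun_id
    have : defect (G p) (fun u => u) = fun u => G p u u u := by
      ext u; simp [defect, e]
    rw [this]
    exact isBigO_clm_apply (isBigO_clm_apply (isBigO_pow_zero
      (contDiffAt_slice hG.contDiffAt).continuousAt) isBigO_self_pow_one rfl)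
      isBigO_self_pow_one rfl
  | succ k ih =>
    obtain ⟨τ, hτ, h⟩ := ih
    have hdef : ContDiff ℝ ∞ fun q : P × E => defect (G q.1) (τ q.1) q.2 := by
      refine contDiff_iff_contDiffAt.2 fun q => ?_
      have h1 := contDiffAt_fderiv_slice (f := τ) (hτ.contDiffAt (x := q))
      have h2 := contDiffAt_fderiv_slice (f := fun p => fderiv ℝ (τ p)) h1
      have h3 : ContDiffAt ℝ ∞ (fun q : P × E => G q.1 (τ q.1 q.2)) q :=
        ContDiffAt.comp (g := fun q : P × E => G q.1 q.2) (f := fun q : P × E => (q.1, τ q.1 q.2)) q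
          hG.contDiffAt (contDiffAt_fst.prodMk hτ.contDiffAt)
      unfold defect
      fun_prop
    let n := k + 2
    let c : P → E [×n]→L[ℝ] E := fun p => iteratedFDeriv ℝ n (defect (G p) (τ p)) 0
    have hc : ContDiff ℝ ∞ c := contDiff_iteratedFDeriv_slice (fun p => hdef.contDiffAt) n
    -- The first factor comes from the Taylor formula, the second undoes Euler's factor `n (n - 1)`,
    -- nonzero because `n ≥ 2`.
    let C : ℝ := (n.factorial : ℝ)⁻¹ * ((n : ℝ) * (n - 1 : ℕ))⁻¹
    let σ : P → E → E := fun p u => -(C • c p fun _ => u)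
    have hσ : ContDiff ℝ ∞ fun q : P × E => σ q.1 q.2 := by
      have h1 : ContDiff ℝ ∞ fun q : P × E => c q.1 fun _ => q.2 := contDiff_multilinear_diagonal hc
      exact (h1.const_smul C).neg
    have hσp : ∀ p, ContDiff ℝ ∞ (σ p) := fun p =>
      contDiff_iff_contDiffAt.2 fun u => contDiffAt_slice hσ.contDiffAt
    have hhom : ∀ p (s : ℝ) u, σ p (s • u) = s ^ n • σ p u := fun p s u => by
      have := (c p).map_smul_univ (fun _ => s) (fun _ => u)
      simp only [Finset.prod_const, Finset.card_univ, Fintype.card_fin] at this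
      simp only [σ, this, smul_neg, smul_comm C]
    have hσO : ∀ p, IsOrder n (σ p) := fun p => by
      have h1 : IsOrder n (fun u => c p fun _ => u) :=
        IsBigO.of_bound ‖c p‖ (Eventually.of_forall fun u => by
          simpa using (c p).le_opNorm fun _ => u)
      exact (h1.const_smul_left C).neg_left
    have hDσ : ∀ p, fderiv ℝ (σ p) 0 = 0 := fun p =>
      (isBigO_fderiv (hσp p).contDiffAt (k := k + 1) (hσO p)).eq_zero
    refine ⟨fun p u => τ p u + σ p u, hτ.add hσ, fun p => ?_⟩
    obtain ⟨ht, hd⟩ := h p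
    have hGp : ContDiffAt ℝ ∞ (G p) 0 := contDiffAt_slice hG.contDiffAt
    refine ⟨⟨?_, ?_, ?_⟩, ?_⟩
    · filter_upwards [ht.contDiffAt] with u hu using hu.add (hσp p).contDiffAt
    · simp [ht.map_zero, (hσO p).eq_zero]
    · rw [fderiv_fun_add (contDiffAt_differentiableAt ht.smooth)
        (contDiffAt_differentiableAt (hσp p).contDiffAt), ht.fderiv_zero, hDσ, add_zero]
    · have h1 := defect_add_isBigO hGp ht (hσp p).contDiffAt (k := k) (hσO p)
      have h2 := sub_leading_isBigO (contDiffAt_slice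
        (f := fun p => defect (G p) (τ p)) hdef.contDiffAt) hd
      refine (h1.add h2).congr_left fun u => ?_
      rw [fderiv_fderiv_of_homogeneous (hσp p) (hhom p)]
      have hC : ((n : ℝ) * (n - 1 : ℕ)) * C = (n.factorial : ℝ)⁻¹ := by
        have : ((n - 1 : ℕ) : ℝ) ≠ 0 := by simp [n]; positivity
        have : (n : ℝ) ≠ 0 := by simp [n]; positivity
        simp only [C]
        field_simp
      simp only [σ, smul_neg, smul_smul, hC, c]
      abel

end Normalizer

/-! ### Finite-dimensional spaces of coefficients. -/

section FiniteDimension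

variable {E F G : Type*} [NormedAddCommGroup E] [NormedSpace ℝ E] [FiniteDimensional ℝ E]
  [NormedAddCommGroup F] [NormedSpace ℝ F] [FiniteDimensional ℝ F]
  [NormedAddCommGroup G] [NormedSpace ℝ G]

instance (n : ℕ) : FiniteDimensional ℝ (E [×n]→L[ℝ] F) :=
  Module.Finite.of_injective (ContinuousMultilinearMap.toMultilinearMapLinear :
    (E [×n]→L[ℝ] F) →ₗ[ℝ] MultilinearMap ℝ (fun _ : Fin n => E) F)
    ContinuousMultilinearMap.toMultilinearMap_injective

instance (r : ℕ) : FiniteDimensional ℝ (TaylorCoeff E F r) :=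
  inferInstanceAs (FiniteDimensional ℝ (∀ m : Fin (r + 1), E [×(m : ℕ)]→L[ℝ] F))

/-- A map into a subspace of a finite-dimensional space is smooth if it is smooth as a map into the
whole space. -/
lemma contDiff_of_subtype {S : Submodule ℝ E} {f : G → S} (hf : ContDiff ℝ ∞ fun p => (f p : E)) :
    ContDiff ℝ ∞ f := by
  obtain ⟨q, hq⟩ := S.subtype.exists_leftInverse_of_injective S.ker_subtype
  have : f = fun p => LinearMap.toContinuousLinearMap q (f p : E) :=
    funext fun p => (LinearMap.congr_fun hq (f p)).symm
  rw [this]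
  exact (ContinuousLinearMap.contDiff _).comp hf

end FiniteDimension

lemma contDiff_coeff_diagonal {P E F : Type*} [NormedAddCommGroup P] [NormedSpace ℝ P]
    [NormedAddCommGroup E] [NormedSpace ℝ E]
    [NormedAddCommGroup F] [NormedSpace ℝ F] [CompleteSpace F] {r : ℕ}
    {S : Submodule ℝ (TaylorCoeff E F r)} {f : P → S} (hf : ContDiff ℝ ∞ f) (m : Fin (r + 1)) :
    ContDiff ℝ ∞ fun q : P × E => (f q.1 : TaylorCoeff E F r) m fun _ => q.2 :=
  contDiff_multilinear_diagonal (contDiff_pi.1 (S.subtypeL.contDiff.comp hf) m)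

/-! ### Tensors and symmetrization. -/

section Tensors

variable {E : Type*} [NormedAddCommGroup E] [NormedSpace ℝ E]

/-- A bilinear-map-valued multilinear map as a tensor, the two arguments of the bilinear map coming
first. -/
def tensorOf (m : ℕ) (B : E [×m]→L[ℝ] (E →L[ℝ] E →L[ℝ] E)) : E [×(m + 2)]→L[ℝ] E :=
  ContinuousLinearMap.uncurryLeft (Ei := fun _ : Fin (m + 2) => E)
    (((continuousMultilinearCurryLeftEquiv ℝ (fun _ : Fin (m + 1) => E) E).symm :
      (E →L[ℝ] E [×m]→L[ℝ] E) →L[ℝ] E [×(m + 1)]→L[ℝ] E) ∘L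
      ((ContinuousLinearMap.flipMultilinearEquiv ℝ (fun _ : Fin m => E) E E).symm :
        (E [×m]→L[ℝ] (E →L[ℝ] E)) →L[ℝ] (E →L[ℝ] E [×m]→L[ℝ] E)) ∘L B.flipLinear)

@[simp] lemma tensorOf_apply (m : ℕ) (B : E [×m]→L[ℝ] (E →L[ℝ] E →L[ℝ] E)) (b : Fin (m + 2) → E) :
    tensorOf m B b = B (Fin.tail (Fin.tail b)) (b 0) (b 1) := rfl

lemma tensorOf_cons (m : ℕ) (B : E [×m]→L[ℝ] (E →L[ℝ] E →L[ℝ] E)) (v w : E) (a : Fin m → E) :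
    tensorOf m B (Matrix.vecCons v (Matrix.vecCons w a)) = B a v w := rfl

/-- The inverse of `tensorOf`. -/
def ofTensor (m : ℕ) (T : E [×(m + 2)]→L[ℝ] E) : E [×m]→L[ℝ] (E →L[ℝ] E →L[ℝ] E) :=
  ContinuousLinearMap.flipMultilinear
    (((ContinuousLinearMap.flipMultilinearEquiv ℝ (fun _ : Fin m => E) E E) :
        (E →L[ℝ] E [×m]→L[ℝ] E) →L[ℝ] (E [×m]→L[ℝ] (E →L[ℝ] E))) ∘L
     ((continuousMultilinearCurryLeftEquiv ℝ (fun _ : Fin (m + 1) => E) E) :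
      (E [×(m + 1)]→L[ℝ] E) →L[ℝ] (E →L[ℝ] E [×m]→L[ℝ] E)) ∘L T.curryLeft)

@[simp] lemma ofTensor_apply (m : ℕ) (T : E [×(m + 2)]→L[ℝ] E) (a : Fin m → E) (v w : E) :
    ofTensor m T a v w = T (Matrix.vecCons v (Matrix.vecCons w a)) := rfl

lemma ofTensor_tensorOf (m : ℕ) (B : E [×m]→L[ℝ] (E →L[ℝ] E →L[ℝ] E)) :
    ofTensor m (tensorOf m B) = B := rfl

lemma vecCons_tail {m : ℕ} (b : Fin (m + 2) → E) :
    Matrix.vecCons (b 0) (Matrix.vecCons (b 1) (Fin.tail (Fin.tail b))) = b := by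
  ext i
  refine Fin.cases rfl (fun i => Fin.cases rfl (fun i => rfl) i) i

lemma tensorOf_ofTensor (m : ℕ) (T : E [×(m + 2)]→L[ℝ] E) :
    tensorOf m (ofTensor m T) = T := by
  ext b
  rw [tensorOf_apply, ofTensor_apply, vecCons_tail]

/-- The symmetrization of a tensor vanishes if and only if it vanishes on the diagonal. -/
lemma sum_perm_eq_zero_iff [CompleteSpace E] {n : ℕ} (T : E [×n]→L[ℝ] E) :
    (∀ a : Fin n → E, ∑ σ : Equiv.Perm (Fin n), T (a ∘ σ) = 0) ↔ ∀ u, T (fun _ => u) = 0 := by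
  constructor
  · intro h u
    have := h fun _ => u
    have e : ∀ σ : Equiv.Perm (Fin n), T ((fun _ => u) ∘ σ) = T fun _ => u := fun σ => rfl
    simp only [e, Finset.sum_const, Finset.card_univ, Fintype.card_perm, Fintype.card_fin,
      ← Nat.cast_smul_eq_nsmul ℝ] at this
    exact (smul_eq_zero.1 this).resolve_left (Nat.cast_ne_zero.2 n.factorial_ne_zero)
  · intro h a
    -- The symmetrization is a symmetric multilinear map which vanishes on the diagonal, hence it is
    -- zero.
    let S : E [×n]→L[ℝ] E := ∑ σ : Equiv.Perm (Fin n), T.domDomCongr σ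
    have hS : ∀ b, S b = ∑ σ : Equiv.Perm (Fin n), T (b ∘ σ) := fun b => by
      simp [S, Function.comp_def]
    have : S = 0 := by
      refine eq_zero_of_diagonal S (fun σ b => ?_) fun u => ?_
      · rw [hS, hS]
        exact Fintype.sum_equiv (Equiv.mulLeft σ) _ _ fun τ => rfl
      · rw [hS]
        exact Finset.sum_eq_zero fun σ _ => h u
    rw [← hS, this]; rfl

end Tensors

/-! ### The tensors of a germ in normal form. -/

section NormalGerms

variable {E : Type*} [NormedAddCommGroup E] [NormedSpace ℝ E] [CompleteSpace E]
  {Γ : E → E →L[ℝ] E →L[ℝ] E} {r : ℕ}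

/-- Up to `m!`, the diagonal value is the homogeneous part of degree `m + 2` of `Γ(u)(u, u)`. The
bound `O(|u|^(r+3))` eliminates precisely the degrees up to `r + 2`. -/
lemma tensorOf_diagonal_eq_zero (hΓ : ContDiffAt ℝ ∞ Γ 0)
    (h : IsOrder (r + 3) fun u => Γ u u u) {m : ℕ} (hm : m ≤ r) (u : E) :
    tensorOf m (iteratedFDeriv ℝ m Γ 0) (fun _ => u) = 0 := by
  induction m using Nat.strong_induction_on generalizing u with
  | _ m ih =>
    refine eq_zero_of_diagonal_isBigO _ ?_ u
    have h1 := isBigO_clm_apply (isBigO_clm_apply (taylor_isBigO hΓ m) isBigO_self_pow_one rfl)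
      isBigO_self_pow_one rfl
    have h2 := (isBigO_pow_norm_of_le h (by omega : m + 1 + 1 + 1 ≤ r + 3)).sub h1
    have h3 : IsOrder (m + 3) fun u => (m.factorial : ℝ)⁻¹ •
        tensorOf m (iteratedFDeriv ℝ m Γ 0) fun _ => u := by
      refine h2.congr_left fun u => ?_
      have h0 : ∀ j ∈ Finset.range m, ((j.factorial : ℝ)⁻¹ •
          iteratedFDeriv ℝ j Γ 0 fun _ => u) u u = 0 := fun j hj => by
        have hj := Finset.mem_range.1 hj
        have := ih j hj (by omega) u
        rw [tensorOf_apply] at this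
        have e : iteratedFDeriv ℝ j Γ 0 (fun _ => u) u u = 0 := this
        simp [e]
      rw [Finset.sum_range_succ, sub_apply, sub_apply, add_apply, add_apply, sum_apply, sum_apply,
        Finset.sum_eq_zero h0]
      simp
      rfl
    exact (isBigO_const_smul_left (by positivity)).1 h3

end NormalGerms

/-! ### Jets of Christoffel symbols and their polynomial representatives. -/

section Jets

variable {E : Type*} [NormedAddCommGroup E] [NormedSpace ℝ E] [FiniteDimensional ℝ E]
  {κ : Kind} {r : ℕ}

/-- `Γ` is, near `0`, the family of Christoffel symbols of a smooth connection of the given kind. -/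
structure IsConnGerm (κ : Kind) (Γ : E → E →L[ℝ] E →L[ℝ] E) : Prop where
  contDiffAt : ContDiffAt ℝ ∞ Γ 0
  symm : κ = .symmetric → ∀ᶠ u in 𝓝 0, ∀ v w, Γ u v w = Γ u w v

/-- The `r`-jet of a family of Christoffel symbols. -/
def germJet (r : ℕ) {Γ : E → E →L[ℝ] E →L[ℝ] E} (h : IsConnGerm κ Γ) : JetCoeff E κ r :=
  ⟨fun m => iteratedFDeriv ℝ m Γ 0, fun m σ a => iteratedFDeriv_perm h.contDiffAt σ a, by
    intro hκ m a v w
    have hev : ContinuousLinearMap.flipₗᵢ ℝ E E E ∘ Γ =ᶠ[𝓝 0] Γ := by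
      filter_upwards [h.symm hκ] with u hu
      ext v w
      exact hu w v
    have h := ContinuousLinearMap.iteratedFDeriv_comp_left
      ((ContinuousLinearMap.flipₗᵢ ℝ E E E).toContinuousLinearEquiv :
        (E →L[ℝ] E →L[ℝ] E) →L[ℝ] (E →L[ℝ] E →L[ℝ] E))
      h.contDiffAt (i := m) (by exact_mod_cast le_top)
    change iteratedFDeriv ℝ m (ContinuousLinearMap.flipₗᵢ ℝ E E E ∘ Γ) 0 = _ at h
    rw [(hev.iteratedFDeriv ℝ m).eq_of_nhds] at h
    exact congrArg (fun f => f a v w) h⟩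

lemma germJet_eq_iff {Γ Γ' : E → E →L[ℝ] E →L[ℝ] E} {h : IsConnGerm κ Γ} {h' : IsConnGerm κ Γ'} :
    germJet r h = germJet r h' ↔ IsOrder (r + 1) fun u => Γ u - Γ' u := by
  have := FiniteDimensional.complete ℝ E
  rw [sub_isBigO_iff h.contDiffAt h'.contDiffAt]
  constructor
  · intro e m hm
    exact congrFun (congrArg Subtype.val e) (⟨m, by omega⟩ : Fin (r + 1))
  · intro e
    exact Subtype.ext (funext fun m => e m (by omega))

lemma germJet_congr {Γ Γ' : E → E →L[ℝ] E →L[ℝ] E} {h : IsConnGerm κ Γ} {h' : IsConnGerm κ Γ'}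
    (e : Γ =ᶠ[𝓝 0] Γ') : germJet r h = germJet r h' :=
  Subtype.ext (funext fun m => (e.iteratedFDeriv ℝ m).eq_of_nhds)

lemma IsConnGerm.pullback {Γ : E → E →L[ℝ] E →L[ℝ] E} (h : IsConnGerm κ Γ) {g : E → E}
    (hg : IsTangentToId g) : IsConnGerm κ (pullback Γ g) := by
  have := FiniteDimensional.complete ℝ E
  refine ⟨contDiffAt_pullback h.contDiffAt hg, fun hκ => ?_⟩
  filter_upwards [hg.isInvertible, hg.contDiffAt, hg.tendsto (h.symm hκ)] with u h1 h2 h3 v w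
  refine h1.injective ?_
  rw [fderiv_pullback h1, fderiv_pullback h1, h3,
    ((contDiffAt_two h2).isSymmSndFDerivAt (by simp)).eq]

/-- Smoothness of the jets of a smooth family of connections. -/
lemma contDiff_germJet {P : Type*} [NormedAddCommGroup P] [NormedSpace ℝ P]
    {Γ : P → E → E →L[ℝ] E →L[ℝ] E} (h : ∀ p, IsConnGerm κ (Γ p))
    (hΓ : ∀ p, ContDiffAt ℝ ∞ (fun q : P × E => Γ q.1 q.2) (p, 0)) :
    ContDiff ℝ ∞ fun p => germJet r (h p) := by
  refine contDiff_of_subtype (E := TaylorCoeff E (E →L[ℝ] E →L[ℝ] E) r) ?_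
  exact contDiff_pi.2 fun m => contDiff_iteratedFDeriv_slice hΓ m

/-- The polynomial Christoffel symbols with a given jet. -/
def polyConn (A : JetCoeff E κ r) (u : E) : E →L[ℝ] E →L[ℝ] E :=
  ∑ m : Fin (r + 1), ((m : ℕ).factorial : ℝ)⁻¹ • A.1 m fun _ => u

lemma contDiff_polyConn {P : Type*} [NormedAddCommGroup P] [NormedSpace ℝ P]
    {A : P → JetCoeff E κ r} (hA : ContDiff ℝ ∞ A) :
    ContDiff ℝ ∞ fun q : P × E => polyConn (A q.1) q.2 := by
  have := FiniteDimensional.complete ℝ E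
  exact ContDiff.sum fun m _ => (contDiff_coeff_diagonal hA m).const_smul
    (((m : ℕ).factorial : ℝ)⁻¹)

lemma contDiff_polyConn_right (A : JetCoeff E κ r) : ContDiff ℝ ∞ (polyConn A) :=
  ContDiff.sum fun m _ => ((A.1 m).contDiff.comp (contDiff_pi.2 fun _ => contDiff_id)).const_smul
    (((m : ℕ).factorial : ℝ)⁻¹)

lemma polyConn_symm (A : JetCoeff E κ r) (hκ : κ = .symmetric) (u v w : E) :
    polyConn A u v w = polyConn A u w v := by
  simp only [polyConn, sum_apply, smul_apply]
  exact Finset.sum_congr rfl fun m _ => by rw [A.2.2 hκ m _ v w]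

lemma isConnGerm_polyConn (A : JetCoeff E κ r) : IsConnGerm κ (polyConn A) :=
  ⟨(contDiff_polyConn_right A).contDiffAt,
    fun hκ => Eventually.of_forall fun u => polyConn_symm A hκ u⟩

@[simp] lemma germJet_polyConn (A : JetCoeff E κ r) : germJet r (isConnGerm_polyConn A) = A := by
  have := FiniteDimensional.complete ℝ E
  obtain ⟨G, -, hG, hG'⟩ := exists_taylor_polynomial (F := E →L[ℝ] E →L[ℝ] E) A.1 A.2.1 (0 : E)
  have : G = polyConn A := by ext1 u; rw [hG]; simp [polyConn]
  exact Subtype.ext (funext fun m => by rw [← hG' m, this]; rfl)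

lemma germJet_eq_iff_polyConn {Γ : E → E →L[ℝ] E →L[ℝ] E} {h : IsConnGerm κ Γ} {A : JetCoeff E κ r} :
    germJet r h = A ↔ IsOrder (r + 1) fun u => Γ u - polyConn A u := by
  rw [← germJet_eq_iff (h := h) (h' := isConnGerm_polyConn A), germJet_polyConn]

end Jets

lemma contDiff_linear_coeff {P E F G : Type*} [NormedAddCommGroup P] [NormedSpace ℝ P]
    [NormedAddCommGroup E] [NormedSpace ℝ E] [FiniteDimensional ℝ E]
    [NormedAddCommGroup F] [NormedSpace ℝ F] [FiniteDimensional ℝ F] [NormedAddCommGroup G]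
    [NormedSpace ℝ G] {r : ℕ} {S : Submodule ℝ (TaylorCoeff E F r)} {f : P → S}
    (hf : ContDiff ℝ ∞ f) (m : Fin (r + 1)) (L : (E [×(m : ℕ)]→L[ℝ] F) →ₗ[ℝ] G) :
    ContDiff ℝ ∞ fun p => L ((f p : TaylorCoeff E F r) m) :=
  (LinearMap.toContinuousLinearMap L).contDiff.comp
    (contDiff_pi.1 (S.subtypeL.contDiff.comp hf) m)

/-! ### The normal form of a jet and the normal tensors. -/

section NormalForm

variable {E : Type*} [NormedAddCommGroup E] [NormedSpace ℝ E] [FiniteDimensional ℝ E]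
  {κ : Kind} {r : ℕ}

lemma exists_normalizer_polyConn (κ : Kind) (r : ℕ) :
    ∃ τ : JetCoeff E κ r → E → E, (ContDiff ℝ ∞ fun q : JetCoeff E κ r × E => τ q.1 q.2) ∧
      ∀ A, IsTangentToId (τ A) ∧ IsOrder (r + 3) fun u => pullback (polyConn A) (τ A) u u u := by
  have := FiniteDimensional.complete ℝ E
  -- The parameter is the jet itself, so one choice of the family provides normalizers of all jets,
  -- smooth in the jet.
  obtain ⟨τ, h, h'⟩ := exists_normalizer (contDiff_polyConn (contDiff_id (E := JetCoeff E κ r))) (r + 1)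
  exact ⟨τ, h, fun A => ⟨(h' A).1, (pullback_self_isBigO_iff (h' A).1).2 (h' A).2⟩⟩

/-- A map straightening the geodesics through `0` of `polyConn A`, up to order `r`. -/
def normalizer (A : JetCoeff E κ r) : E → E := (exists_normalizer_polyConn κ r).choose A

lemma contDiff_normalizer : ContDiff ℝ ∞ fun q : JetCoeff E κ r × E => normalizer q.1 q.2 :=
  (exists_normalizer_polyConn κ r).choose_spec.1

lemma isTangentToId_normalizer (A : JetCoeff E κ r) : IsTangentToId (normalizer A) :=
  ((exists_normalizer_polyConn κ r).choose_spec.2 A).1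

lemma pullback_normalizer_isBigO (A : JetCoeff E κ r) :
    IsOrder (r + 3) fun u => pullback (polyConn A) (normalizer A) u u u :=
  ((exists_normalizer_polyConn κ r).choose_spec.2 A).2

/-- The jet of Christoffel symbols in normal coordinates. -/
def normalForm (A : JetCoeff E κ r) : JetCoeff E κ r :=
  germJet r ((isConnGerm_polyConn A).pullback (isTangentToId_normalizer A))

lemma contDiffAt_pullback_slice {P : Type*} [NormedAddCommGroup P] [NormedSpace ℝ P]
    {Γ : P → E → E →L[ℝ] E →L[ℝ] E} {τ : P → E → E}
    (hΓ : ContDiff ℝ ∞ fun q : P × E => Γ q.1 q.2) (hτ : ∀ p, ContDiffAt ℝ ∞ (fun q : P × E => τ q.1 q.2) (p, 0))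
    (p : P) (hp : (fderiv ℝ (τ p) 0).IsInvertible) :
    ContDiffAt ℝ ∞ (fun q : P × E => pullback (Γ q.1) (τ q.1) q.2) (p, 0) := by
  have := FiniteDimensional.complete ℝ E
  have h1 := contDiffAt_fderiv_slice (f := τ) (hτ p)
  have h2 := contDiffAt_fderiv_slice (f := fun p => fderiv ℝ (τ p)) h1
  have h3 : ContDiffAt ℝ ∞ (fun q : P × E => Γ q.1 (τ q.1 q.2)) (p, 0) :=
    ContDiffAt.comp (g := fun q : P × E => Γ q.1 q.2) (f := fun q : P × E => (q.1, τ q.1 q.2)) (p, 0)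
      hΓ.contDiffAt (contDiffAt_fst.prodMk (hτ p))
  exact ContDiffAt.comp (f := fun q : P × E => (Γ q.1 (τ q.1 q.2), fderiv ℝ (τ q.1) q.2,
    fderiv ℝ (fderiv ℝ (τ q.1)) q.2)) (p, 0) (contDiffAt_transform hp) (h3.prodMk (h1.prodMk h2))

lemma contDiff_normalForm : ContDiff ℝ ∞ (normalForm (E := E) (κ := κ) (r := r)) :=
  contDiff_germJet _ fun A => contDiffAt_pullback_slice (contDiff_polyConn contDiff_id)
    (fun _ => contDiff_normalizer.contDiffAt) A (isTangentToId_normalizer A).isInvertible_zero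

/-- The normal form can be computed in any normal coordinates. -/
lemma germJet_pullback_of_normal {Γ : E → E →L[ℝ] E →L[ℝ] E} (h : IsConnGerm κ Γ) {g : E → E}
    (hg : IsTangentToId g) (hn : IsOrder (r + 3) fun u => pullback Γ g u u u) :
    germJet r (h.pullback hg) = normalForm (germJet r h) := by
  have := FiniteDimensional.complete ℝ E
  refine germJet_eq_iff.2 ?_
  exact pullback_sub_isBigO_of_normal h.contDiffAt hg (isTangentToId_normalizer _)
    (germJet_eq_iff_polyConn.1 rfl) hn (pullback_normalizer_isBigO _)

/-- The identity is already a normalizing map, and the normal form does not depend on the one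
chosen. -/
lemma germJet_eq_of_normal {Γ : E → E →L[ℝ] E →L[ℝ] E} (h : IsConnGerm κ Γ)
    (hn : IsOrder (r + 3) fun u => Γ u u u) : normalForm (germJet r h) = germJet r h := by
  have e := pullback_id (Γ := Γ)
  rw [← germJet_pullback_of_normal h IsTangentToId.id (by rwa [e])]
  exact germJet_congr (by rw [e])

/-- The action on germs descends to `r`-jets, so it may be computed on polynomial representatives.
-/
lemma germJet_pullback_congr {Γ Γ' : E → E →L[ℝ] E →L[ℝ] E} {h : IsConnGerm κ Γ}
    {h' : IsConnGerm κ Γ'} (e : germJet r h = germJet r h') {g : E → E} (hg : IsTangentToId g) :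
    germJet r (h.pullback hg) = germJet r (h'.pullback hg) := by
  have := FiniteDimensional.complete ℝ E
  refine germJet_eq_iff.2 (pullback_sub_isBigO h.contDiffAt hg hg (germJet_eq_iff.1 e) ?_)
  exact (isBigO_zero _ _).congr_left fun u => (sub_self _).symm

/-- The jet of the pullback of a connection with a given jet. -/
def pullJet (A : JetCoeff E κ r) {g : E → E} (hg : IsTangentToId g) : JetCoeff E κ r :=
  germJet r ((isConnGerm_polyConn A).pullback hg)

lemma germJet_pullback {Γ : E → E →L[ℝ] E →L[ℝ] E} (h : IsConnGerm κ Γ) {g : E → E}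
    (hg : IsTangentToId g) : germJet r (h.pullback hg) = pullJet (germJet r h) hg :=
  germJet_pullback_congr (h := h) (h' := isConnGerm_polyConn (germJet r h)) (by simp) hg

lemma pullJet_comp (A : JetCoeff E κ r) {g h : E → E} (hg : IsTangentToId g)
    (hh : IsTangentToId h) : pullJet A (hg.comp hh) = pullJet (pullJet A hg) hh := by
  have := FiniteDimensional.complete ℝ E
  exact (germJet_congr (pullback_comp hg hh)).trans
    (germJet_pullback ((isConnGerm_polyConn A).pullback hg) hh)

lemma pullJet_eq_self (A : JetCoeff E κ r) {g : E → E} (hg : IsTangentToId g)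
    (h : g =ᶠ[𝓝 0] fun u => u) : pullJet A hg = A := by
  rw [pullJet, germJet_eq_iff_polyConn]
  refine (isBigO_zero _ _).congr' ?_ EventuallyEq.rfl
  filter_upwards [pullback_congr_right (Γ := polyConn A) h] with u hu
  rw [hu, pullback_id]
  simp

/-- If `τ` normalizes `A`, then `g⁻¹ ∘ τ` normalizes the pullback of `A` by `g`, with the same
result. -/
lemma normalForm_pullJet (A : JetCoeff E κ r) {g : E → E} (hg : IsTangentToId g) :
    normalForm (pullJet A hg) = normalForm A := by
  have := FiniteDimensional.complete ℝ E
  obtain ⟨h, hh, h1, h2⟩ := hg.exists_inverse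
  let τ := normalizer A
  have hτ := isTangentToId_normalizer A
  have hP := (isConnGerm_polyConn A).pullback hg
  have e : pullback (pullback (polyConn A) g) (h ∘ τ) =ᶠ[𝓝 0] pullback (polyConn A) τ := by
    refine (pullback_comp hg (hh.comp hτ)).symm.trans (pullback_congr_right ?_)
    filter_upwards [hτ.tendsto h1] with u hu using hu
  have h3 := germJet_pullback_of_normal (r := r) hP (hh.comp hτ)
    ((pullback_normalizer_isBigO A).congr' (by
      filter_upwards [e] with u hu
      rw [hu]) EventuallyEq.rfl)
  exact h3.symm.trans (germJet_congr e)

lemma normalForm_eq_pullJet (A : JetCoeff E κ r) :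
    normalForm A = pullJet A (isTangentToId_normalizer A) := rfl

/-- One goes from `A` to the common normal form by its normalizer, then back to `A'` by the inverse
of the other normalizer. -/
lemma exists_pullJet_eq {A A' : JetCoeff E κ r} (h : normalForm A = normalForm A') :
    ∃ (θ : E → E) (hθ : IsTangentToId θ), A' = pullJet A hθ := by
  have := FiniteDimensional.complete ℝ E
  obtain ⟨g, hg, h1, -⟩ := (isTangentToId_normalizer A').exists_inverse
  refine ⟨normalizer A ∘ g, (isTangentToId_normalizer A).comp hg, ?_⟩
  rw [pullJet_comp A (isTangentToId_normalizer A) hg, ← normalForm_eq_pullJet, h,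
    normalForm_eq_pullJet, ← pullJet_comp, pullJet_eq_self _ _ h1]

/-- The normal tensors of a jet. -/
def normalTensors (A : JetCoeff E κ r) : NormalTensors E κ r := fun m =>
  ⟨tensorOf m ((normalForm A).1 m), by
    have := FiniteDimensional.complete ℝ E
    refine ⟨fun σ v w a => ?_, (sum_perm_eq_zero_iff _).2 fun u => ?_, fun hκ v w a => ?_⟩
    · rw [tensorOf_cons, tensorOf_cons, (normalForm A).2.1 m σ a]
    · exact tensorOf_diagonal_eq_zero
        ((isConnGerm_polyConn A).pullback (isTangentToId_normalizer A)).contDiffAt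
        (pullback_normalizer_isBigO A) (by omega) u
    · rw [tensorOf_cons, tensorOf_cons, (normalForm A).2.2 hκ m a v w]⟩

lemma normalTensors_eq_iff {A A' : JetCoeff E κ r} :
    normalTensors A = normalTensors A' ↔ normalForm A = normalForm A' := by
  constructor
  · intro h
    refine Subtype.ext (funext fun m => ?_)
    rw [← ofTensor_tensorOf m ((normalForm A).1 m), ← ofTensor_tensorOf m ((normalForm A').1 m)]
    exact congrArg (ofTensor m) (congrArg Subtype.val (congrFun h m))
  · intro h
    exact funext fun m => Subtype.ext (by simp only [normalTensors, h])

/-- The jet in normal form with given normal tensors. -/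
def ofTensors (T : NormalTensors E κ r) : JetCoeff E κ r :=
  ⟨fun m => ofTensor m (T m).1, fun m σ a => by
    ext v w
    exact (T m).2.1 σ v w a, fun hκ m a v w => (T m).2.2.2 hκ v w a⟩

/-- Each homogeneous term is a normal tensor on the diagonal, where it vanishes because its
symmetrization does. The coordinates of this polynomial are therefore exactly normal. -/
lemma polyConn_ofTensors_self (T : NormalTensors E κ r) (u : E) :
    polyConn (ofTensors T) u u u = 0 := by
  have := FiniteDimensional.complete ℝ E
  simp only [polyConn, sum_apply, smul_apply]
  refine Finset.sum_eq_zero fun m _ => ?_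
  have h := (sum_perm_eq_zero_iff _).1 (T m).2.2.1 u
  have e : (ofTensors T).1 m (fun _ => u) u u = (T m).1 fun _ => u := by
    change (T m).1 _ = _
    congr 1
    exact vecCons_tail (m := m) fun _ => u
  rw [e, h, smul_zero]

lemma normalForm_ofTensors (T : NormalTensors E κ r) : normalForm (ofTensors T) = ofTensors T := by
  have h := germJet_eq_of_normal (r := r) (isConnGerm_polyConn (ofTensors T))
    ((isBigO_zero _ _).congr_left fun u => (polyConn_ofTensors_self T u).symm)
  rwa [germJet_polyConn] at h

lemma normalTensors_ofTensors (T : NormalTensors E κ r) : normalTensors (ofTensors T) = T := by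
  refine funext fun m => Subtype.ext ?_
  simp only [normalTensors, normalForm_ofTensors]
  exact tensorOf_ofTensor m (T m).1

lemma ofTensors_normalTensors (A : JetCoeff E κ r) : ofTensors (normalTensors A) = normalForm A :=
  Subtype.ext (funext fun m => ofTensor_tensorOf m _)

/-- `tensorOf` as a linear map. -/
def tensorOfₗ (m : ℕ) : (E [×m]→L[ℝ] (E →L[ℝ] E →L[ℝ] E)) →ₗ[ℝ] E [×(m + 2)]→L[ℝ] E where
  toFun := tensorOf m
  map_add' A B := by ext; rfl
  map_smul' c A := by ext; rfl

lemma contDiff_normalTensors : ContDiff ℝ ∞ (normalTensors (E := E) (κ := κ) (r := r)) := by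
  refine contDiff_pi.2 fun m => contDiff_of_subtype (E := E [×((m : ℕ) + 2)]→L[ℝ] E) ?_
  have h := contDiff_linear_coeff (E := E) (F := E →L[ℝ] E →L[ℝ] E)
    (G := E [×((m : ℕ) + 2)]→L[ℝ] E) (S := JetCoeff E κ r)
    (contDiff_normalForm (E := E) (κ := κ) (r := r)) m
  exact h (tensorOfₗ m)

lemma contDiff_ofTensors : ContDiff ℝ ∞ (ofTensors (E := E) (κ := κ) (r := r)) := by
  let L : NormalTensors E κ r →ₗ[ℝ] JetCoeff E κ r :=
    { toFun := ofTensors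
      map_add' := fun A B => by rfl
      map_smul' := fun c A => by rfl }
  exact (LinearMap.toContinuousLinearMap L).contDiff

/-- Through each jet there is a smooth section of the map to the normal tensors. -/
lemma exists_section (A : JetCoeff E κ r) :
    ∃ s : NormalTensors E κ r → JetCoeff E κ r, ContDiff ℝ ∞ s ∧
      (∀ T, normalTensors (s T) = T) ∧ s (normalTensors A) = A := by
  have := FiniteDimensional.complete ℝ E
  obtain ⟨θ, hθ, h1, -⟩ := (isTangentToId_normalizer A).exists_inverse
  -- The map `θ`, inverse to the normalizer of `A`, is kept fixed while `T` varies: pulling back by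
  -- `θ` does not alter normal tensors and recovers `A` from its normal form.
  refine ⟨fun T => pullJet (ofTensors T) hθ, ?_, fun T => ?_, ?_⟩
  · refine contDiff_germJet _ fun T => contDiffAt_pullback_slice (Γ := fun T => polyConn (ofTensors T))
      (τ := fun _ => θ) ?_ (fun T => ?_) T hθ.isInvertible_zero
    · exact contDiff_polyConn contDiff_ofTensors
    · exact ContDiffAt.comp (g := θ) (f := Prod.snd) (T, (0 : E)) hθ.smooth contDiffAt_snd
  · rw [normalTensors_eq_iff.2 ((normalForm_pullJet _ hθ).trans rfl), normalTensors_ofTensors]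
  · simp only [ofTensors_normalTensors, normalForm_eq_pullJet]
    rw [← pullJet_comp, pullJet_eq_self _ _ h1]

end NormalForm

/-! ### Connections in the preferred chart. -/

section PreferredChart

variable {E : Type*} [NormedAddCommGroup E] [NormedSpace ℝ E]
  {X : Type*} [TopologicalSpace X] [ChartedSpace E X] [IsManifold 𝓘(ℝ, E) ∞ X]

lemma comps_chart {x y : X} (hy : y ∈ (chartAt E x).source) (D : Π z : X, TangentSpace 𝓘(ℝ, E) z) :
    comps x D (chartAt E x y) = chartD x y (D y) := by
  simp only [comps]; rw [(chartAt E x).left_inv hy]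

lemma chartD_injective {x z : X} (hz : z ∈ (chartAt E x).source) :
    Function.Injective (chartD (E := E) x z) :=
  Function.LeftInverse.injective (chartDSymm_chartD hz)

lemma comps_coordField_eventuallyEq {x y : X} (hy : y ∈ (chartAt E x).source) (w : E) :
    comps x (coordField E (chartAt E x) w) =ᶠ[𝓝 (chartAt E x y)] fun _ => w := by
  filter_upwards [(chartAt E x).open_target.mem_nhds ((chartAt E x).map_source hy)] with u' hu'
  exact comps_coordField hu' _

lemma mdifferentiableAt_coordField {x y : X} (hy : y ∈ (chartAt E x).source) (w : E) :
    MDiffAt (T% (coordField E (chartAt E x) w)) y :=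
  (mdifferentiableAt_iff_comps hy _).2
    ((differentiableAt_const w).congr_of_eventuallyEq (comps_coordField_eventuallyEq hy w))

lemma mdifferentiableAt_comp_chart {F : Type*} [NormedAddCommGroup F] [NormedSpace ℝ F] {x y : X}
    (hy : y ∈ (chartAt E x).source) (f : X → F) :
    MDifferentiableAt 𝓘(ℝ, E) 𝓘(ℝ, F) f y ↔
      DifferentiableAt ℝ (f ∘ (chartAt E x).symm) (chartAt E x y) := by
  rw [mdifferentiableAt_iff_source_of_mem_source (x := x) hy]
  simp only [mfld_simps, mdifferentiableWithinAt_univ, mdifferentiableAt_iff_differentiableAt]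

/-- The differential of a vector-valued function, in the preferred chart. -/
lemma mvfderiv_eq_comp_chartD {F : Type*} [NormedAddCommGroup F] [NormedSpace ℝ F] {x y : X}
    (hy : y ∈ (chartAt E x).source) {f : X → F} (hf : MDifferentiableAt 𝓘(ℝ, E) 𝓘(ℝ, F) f y) :
    mvfderiv 𝓘(ℝ, E) f y = fderiv ℝ (f ∘ (chartAt E x).symm) (chartAt E x y) ∘L chartD x y := by
  have hd := (mdifferentiableAt_comp_chart hy f).1 hf
  have hc : MDifferentiableAt 𝓘(ℝ, E) 𝓘(ℝ, E) (chartAt E x) y :=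
    mdifferentiableAt_atlas (chart_mem_atlas E x) hy
  have hev : f =ᶠ[𝓝 y] (f ∘ (chartAt E x).symm) ∘ chartAt E x := by
    filter_upwards [(chartAt E x).open_source.mem_nhds hy] with z hz
    simp [(chartAt E x).left_inv hz]
  rw [← chartD_eq_mvfderiv hy]
  ext v
  have h2 := mfderiv_comp y hd.mdifferentiableAt hc
  rw [← hev.mfderiv_eq, mfderiv_eq_fderiv] at h2
  exact DFunLike.congr_fun h2 v

/-- The tangent space at `x` is identified with `E` by the preferred chart itself, so tensors at `x`
and tensors in this chart need no linear correction. -/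
lemma chartD_self (x : X) : chartD (E := E) x x = ContinuousLinearMap.id ℝ E := by
  ext v
  have h := TangentBundle.continuousLinearMapAt_trivializationAt_eq_core (I := 𝓘(ℝ, E))
    (mem_chart_source E x)
  exact (DFunLike.congr_fun h v).trans
    ((tangentBundleCore 𝓘(ℝ, E) X).coordChange_self (achart E x) x (mem_chart_source E x) v)

/-- Additivity and the Leibniz rule extend agreement on the fields `C j` to their combinations with
function coefficients. Differentiability is carried along because additivity requires it of the
partial sums. -/
lemma cov_sum_congr {s : Set X} {cov cov' : (Π y : X, TangentSpace 𝓘(ℝ, E) y) →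
      (Π y : X, TangentSpace 𝓘(ℝ, E) y →L[ℝ] TangentSpace 𝓘(ℝ, E) y)}
    (h : IsCovariantDerivativeOn E cov s) (h' : IsCovariantDerivativeOn E cov' s) {x y : X}
    (hy : y ∈ s) (hyx : y ∈ (chartAt E x).source) {ι : Type*} (J : Finset ι) (f : ι → X → ℝ)
    (C : ι → Π z : X, TangentSpace 𝓘(ℝ, E) z) (hf : ∀ j, MDifferentiableAt 𝓘(ℝ, E) 𝓘(ℝ, ℝ) (f j) y)
    (hC : ∀ j, MDiffAt (T% (C j)) y) (hCC : ∀ j, cov (C j) y = cov' (C j) y) :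
    MDiffAt (T% (∑ j ∈ J, f j • C j)) y ∧
      cov (∑ j ∈ J, f j • C j) y = cov' (∑ j ∈ J, f j • C j) y := by
  classical
  induction J using Finset.induction_on with
  | empty =>
    have h0 : MDiffAt (T% (0 : Π z : X, TangentSpace 𝓘(ℝ, E) z)) y := by
      rw [mdifferentiableAt_iff_comps hyx]
      have : comps x (0 : Π z : X, TangentSpace 𝓘(ℝ, E) z) = fun _ => (0 : E) := by
        ext u; simp [comps]
      rw [this]
      exact differentiableAt_const _
    simp only [Finset.sum_empty]
    exact ⟨h0, by rw [h.zero hy, h'.zero hy]⟩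
  | insert j J hj ih =>
    have h1 : MDiffAt (T% (f j • C j)) y := by
      rw [mdifferentiableAt_iff_comps hyx, comps_smul]
      exact ((mdifferentiableAt_comp_chart hyx _).1 (hf j)).smul
        ((mdifferentiableAt_iff_comps hyx _).1 (hC j))
    rw [Finset.sum_insert hj]
    refine ⟨?_, ?_⟩
    · rw [mdifferentiableAt_iff_comps hyx, comps_add]
      exact ((mdifferentiableAt_iff_comps hyx _).1 h1).add
        ((mdifferentiableAt_iff_comps hyx _).1 ih.1)
    · rw [h.add h1 ih.1 hy, h'.add h1 ih.1 hy, ih.2, h.leibniz (hC j) (hf j) hy,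
        h'.leibniz (hC j) (hf j) hy, hCC j]

variable [FiniteDimensional ℝ E] {κ : Kind} {x : X}

/-- A connection is determined by its Christoffel symbols. -/
lemma cov_eq_covOf (nabla : LocalConnection E κ x) {D : Π z : X, TangentSpace 𝓘(ℝ, E) z} {y : X}
    (hyx : y ∈ (chartAt E x).source) (hy : y ∈ nabla.domain) (hD : MDiffAt (T% D) y) :
    nabla.cov D y = covOf x (christoffel nabla (chartAt E x)) D y := by
  let b := Module.finBasis ℝ E
  let s := nabla.domain ∩ (chartAt E x).source
  have h := nabla.isCovariantDerivativeOn.mono (s := s) Set.inter_subset_left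
  have h' := (covOf_isCov x (christoffel nabla (chartAt E x))).mono (s := s) Set.inter_subset_right
  have hys : y ∈ s := ⟨hy, hyx⟩
  -- The coefficients of `D` in the coordinate frame; near `y` the field is their combination, and
  -- covariant derivatives are local.
  let f : Fin (Module.finrank ℝ E) → X → ℝ := fun j z => b.coord j (chartD x z (D z))
  let C : Fin (Module.finrank ℝ E) → Π z : X, TangentSpace 𝓘(ℝ, E) z :=
    fun j => coordField E (chartAt E x) (b j)
  have hf : ∀ j, MDifferentiableAt 𝓘(ℝ, E) 𝓘(ℝ, ℝ) (f j) y := fun j => by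
    rw [mdifferentiableAt_comp_chart hyx]
    exact (LinearMap.toContinuousLinearMap (b.coord j)).differentiableAt.comp _
      ((mdifferentiableAt_iff_comps hyx D).1 hD)
  have hC : ∀ j, MDiffAt (T% (C j)) y := fun j => mdifferentiableAt_coordField hyx _
  have hCC : ∀ j, nabla.cov (C j) y = covOf x (christoffel nabla (chartAt E x)) (C j) y := by
    intro j
    ext v
    refine chartD_injective hyx ?_
    have hu := (chartAt E x).map_source hyx
    have h1 := christoffel_apply_basis nabla hu (chartD x y v) j
    simp only [endComps] at h1
    rw [(chartAt E x).left_inv hyx] at h1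
    simp only [ContinuousLinearMap.comp_apply, chartDSymm_chartD hyx] at h1
    simp only [covOf, ContinuousLinearMap.comp_apply, chartD_symm hyx]
    rw [(comps_coordField_eventuallyEq hyx (b j)).fderiv_eq,
      (comps_coordField_eventuallyEq hyx (b j)).eq_of_nhds]
    simpa using h1.symm
  have hsum : ∀ᶠ z in 𝓝 y, D z = (∑ j, f j • C j : Π z : X, TangentSpace 𝓘(ℝ, E) z) z := by
    filter_upwards [(chartAt E x).open_source.mem_nhds hyx] with z hz
    refine chartD_injective hz ?_
    have e : (∑ j, f j • C j) z = ∑ j, f j z • C j z := Finset.sum_apply _ _ _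
    have e' : ∀ j, chartD x z (C j z) = b j := fun j => by
      simp only [C, coordField, mvfderiv_inverse hz, chartD_symm hz]
    rw [e, map_sum]
    simp only [map_smul, e']
    exact (b.sum_repr _).symm
  obtain ⟨h1, h2⟩ := cov_sum_congr h h' hys hyx Finset.univ f C hf hC hCC
  have hs : s ∈ 𝓝 y := (nabla.isOpen_domain.inter (chartAt E x).open_source).mem_nhds hys
  rw [h.congr_of_eventuallyEq hD h1 hs hsum, h2, h'.congr_of_eventuallyEq hD h1 hs hsum]

lemma chartD_cov (nabla : LocalConnection E κ x) {D : Π z : X, TangentSpace 𝓘(ℝ, E) z} {y : X}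
    (hyx : y ∈ (chartAt E x).source) (hy : y ∈ nabla.domain) (hD : MDiffAt (T% D) y)
    (v : TangentSpace 𝓘(ℝ, E) y) :
    chartD x y (nabla.cov D y v) = fderiv ℝ (comps x D) (chartAt E x y) (chartD x y v) +
      christoffel nabla (chartAt E x) (chartAt E x y) (chartD x y v) (chartD x y (D y)) := by
  rw [cov_eq_covOf nabla hyx hy hD]
  simp [covOf, chartD_symm hyx, comps_chart hyx]

/-- Smoothness is needed on a neighbourhood, not only at the centre, in order to cut the symbols off
by a bump function. -/
lemma contDiffAt_christoffel (nabla : LocalConnection E κ x) {u : E}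
    (hu : u ∈ (chartAt E x).target) (hu' : (chartAt E x).symm u ∈ nabla.domain) :
    ContDiffAt ℝ ∞ (christoffel nabla (chartAt E x)) u := by
  set φ := chartAt E x with hφ
  set y := φ.symm u
  have hy : y ∈ φ.source := φ.map_target hu
  have hyu : φ y = u := φ.right_inv hu
  set V := nabla.domain ∩ φ.source with hV
  have hVo : IsOpen V := nabla.isOpen_domain.inter φ.open_source
  have hxV : y ∈ V := ⟨hu', hy⟩
  have hA : ∀ j, ContDiffAt ℝ ∞
      (endComps x (nabla.cov (coordField E φ (Module.finBasis ℝ E j)))) u := by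
    intro j
    rw [← hyu, ← contMDiffAt_hom_iff hy]
    refine ((nabla.contMDiff V Set.inter_subset_left hVo).contMDiff
      (σ := coordField E φ (Module.finBasis ℝ E j)) ?_ y hxV).contMDiffAt (hVo.mem_nhds hxV)
    intro z hz
    refine ContMDiffAt.contMDiffWithinAt ?_
    refine (contMDiffAt_iff_comps hz.2 ⊤ _).2 ?_
    exact (contDiffAt_const (c := Module.finBasis ℝ E j)).congr_of_eventuallyEq
      (comps_coordField_eventuallyEq hz.2 _)
  have key : christoffel nabla φ =ᶠ[𝓝 u] fun u =>
      ContinuousLinearMap.flipₗᵢ ℝ E E E (∑ j, ContinuousLinearMap.smulRightL ℝ E (E →L[ℝ] E)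
        (LinearMap.toContinuousLinearMap ((Module.finBasis ℝ E).coord j))
        (endComps x (nabla.cov (coordField E φ (Module.finBasis ℝ E j))) u)) := by
    filter_upwards [φ.open_target.mem_nhds hu] with u hu
    ext v w
    conv_lhs => rw [← (Module.finBasis ℝ E).sum_repr w]
    simp only [map_sum, map_smul]
    simp [hφ]
    exact Finset.sum_congr rfl fun j _ => by rw [christoffel_apply_basis nabla hu]
  refine ContDiffAt.congr_of_eventuallyEq ?_ key
  exact (ContinuousLinearMap.flipₗᵢ ℝ E E E).contDiff.contDiffAt.comp _
    (ContDiffAt.sum fun j _ => (ContinuousLinearMap.contDiff _).contDiffAt.comp _ (hA j))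

end PreferredChart

/-! ### Derivatives of local inverses and of push-forwards. -/

section LocalInverse

variable {E : Type*} [NormedAddCommGroup E] [NormedSpace ℝ E]

lemma fderiv_comp_eq_id {g h : E → E} {u : E} (hgh : g ∘ h =ᶠ[𝓝 u] id)
    (hg : DifferentiableAt ℝ g (h u)) (hh : DifferentiableAt ℝ h u) :
    fderiv ℝ g (h u) ∘L fderiv ℝ h u = ContinuousLinearMap.id ℝ E := by
  rw [← fderiv_comp _ hg hh, hgh.fderiv_eq, fderiv_id]

lemma inverse_fderiv_of_inverse {g h : E → E} {u : E} (hgh : g ∘ h =ᶠ[𝓝 u] id)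
    (hhg : h ∘ g =ᶠ[𝓝 (h u)] id) (hg : DifferentiableAt ℝ g (h u)) (hh : DifferentiableAt ℝ h u) :
    (fderiv ℝ h u).IsInvertible ∧ (fderiv ℝ h u).inverse = fderiv ℝ g (h u) := by
  have hu : g (h u) = u := hgh.eq_of_nhds
  have h1 := fderiv_comp_eq_id hgh hg hh
  have h2 := fderiv_comp_eq_id hhg (by rwa [hu]) hg
  rw [hu] at h2
  exact ⟨.of_inverse h2 h1, ContinuousLinearMap.inverse_eq h2 h1⟩

/-- The derivative of the push-forward `V` by `g` of the vector field `d`. -/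
lemma fderiv_pushforward {g d V : E → E} {u : E} (hg : ContDiffAt ℝ ∞ g u)
    (hd : DifferentiableAt ℝ d u) (hV : DifferentiableAt ℝ V (g u))
    (h : V ∘ g =ᶠ[𝓝 u] fun u => fderiv ℝ g u (d u)) (v : E) :
    fderiv ℝ V (g u) (fderiv ℝ g u v) =
      fderiv ℝ (fderiv ℝ g) u v (d u) + fderiv ℝ g u (fderiv ℝ d u v) := by
  have h1 := fderiv_comp u hV (contDiffAt_differentiableAt hg)
  rw [h.fderiv_eq, fderiv_clm_apply (contDiffAt_differentiableAt (contDiffAt_fderiv hg)) hd] at h1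
  have := congrArg (fun L => L v) h1
  simp only [ContinuousLinearMap.comp_apply] at this
  rw [← this]
  simp [add_comm]

/-- `pullback_comp`, at a given point. -/
lemma pullback_comp_apply {Γ : E → E →L[ℝ] E →L[ℝ] E} {g h : E → E} {u : E}
    (hg : ContDiffAt ℝ ∞ g (h u)) (hh : ContDiffAt ℝ ∞ h u) (hg' : (fderiv ℝ g (h u)).IsInvertible)
    (hh' : (fderiv ℝ h u).IsInvertible) : pullback Γ (g ∘ h) u = pullback (pullback Γ g) h u := by
  have hd : fderiv ℝ (g ∘ h) u = (fderiv ℝ g (h u)).comp (fderiv ℝ h u) :=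
    fderiv_comp _ (contDiffAt_differentiableAt hg) (contDiffAt_differentiableAt hh)
  refine pullback_eq_of_forall (by rw [hd]; exact hg'.comp hh') fun v w => ?_
  rw [fderiv_fderiv_comp (contDiffAt_two hg) (contDiffAt_two hh), hd]
  simp only [ContinuousLinearMap.comp_apply, Function.comp_apply]
  rw [fderiv_pullback hh', map_add, fderiv_pullback hg', add_assoc]

end LocalInverse

/-! ### Christoffel symbols in an arbitrary chart. -/

section Charts

variable {E : Type*} [NormedAddCommGroup E] [NormedSpace ℝ E]
  {X : Type*} [TopologicalSpace X] [ChartedSpace E X] [IsManifold 𝓘(ℝ, E) ∞ X]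
  {φ ψ : OpenPartialHomeomorph X E}

lemma contDiffAt_transition (hφ : φ ∈ IsManifold.maximalAtlas 𝓘(ℝ, E) ∞ X)
    (hψ : ψ ∈ IsManifold.maximalAtlas 𝓘(ℝ, E) ∞ X) {u : E} (hu : u ∈ φ.target)
    (hu' : φ.symm u ∈ ψ.source) : ContDiffAt ℝ ∞ (ψ ∘ φ.symm) u := by
  have h1 := contMDiffAt_symm_of_mem_maximalAtlas hφ hu
  have h2 := contMDiffAt_of_mem_maximalAtlas hψ hu'
  exact (h2.comp u h1).contDiffAt

lemma transition_comp (φ ψ : OpenPartialHomeomorph X E) {u : E} (hu : u ∈ φ.target)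
    (hu' : φ.symm u ∈ ψ.source) : (φ ∘ ψ.symm) ∘ (ψ ∘ φ.symm) =ᶠ[𝓝 u] id := by
  filter_upwards [φ.open_target.mem_nhds hu,
    φ.continuousAt_symm hu (ψ.open_source.mem_nhds hu')] with y hy hy'
  have hy' : φ.symm y ∈ ψ.source := hy'
  simp [ψ.left_inv hy', φ.right_inv hy]

lemma fderiv_transition (hφ : φ ∈ IsManifold.maximalAtlas 𝓘(ℝ, E) ∞ X)
    (hψ : ψ ∈ IsManifold.maximalAtlas 𝓘(ℝ, E) ∞ X) {u : E} (hu : u ∈ φ.target)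
    (hu' : φ.symm u ∈ ψ.source) : (fderiv ℝ (ψ ∘ φ.symm) u).IsInvertible ∧
      (fderiv ℝ (ψ ∘ φ.symm) u).inverse = fderiv ℝ (φ ∘ ψ.symm) (ψ (φ.symm u)) := by
  have hv : ψ (φ.symm u) ∈ ψ.target := ψ.map_source hu'
  have hv' : ψ.symm (ψ (φ.symm u)) ∈ φ.source := by rw [ψ.left_inv hu']; exact φ.map_target hu
  exact inverse_fderiv_of_inverse (transition_comp φ ψ hu hu') (transition_comp ψ φ hv hv')
    (contDiffAt_differentiableAt (contDiffAt_transition hψ hφ hv hv'))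
    (contDiffAt_differentiableAt (contDiffAt_transition hφ hψ hu hu'))

lemma mvfderiv_chart (hφ : φ ∈ IsManifold.maximalAtlas 𝓘(ℝ, E) ∞ X) {x z : X} (hz : z ∈ φ.source)
    (hz' : z ∈ (chartAt E x).source) : mvfderiv 𝓘(ℝ, E) φ z =
      fderiv ℝ (φ ∘ (chartAt E x).symm) (chartAt E x z) ∘L chartD x z :=
  mvfderiv_eq_comp_chartD hz' ((contMDiffAt_of_mem_maximalAtlas hφ hz).mdifferentiableAt (by simp))

lemma mvfderiv_chart_inverse (hφ : φ ∈ IsManifold.maximalAtlas 𝓘(ℝ, E) ∞ X) {x z : X}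
    (hz : z ∈ φ.source) (hz' : z ∈ (chartAt E x).source) : (mvfderiv 𝓘(ℝ, E) φ z).inverse =
      chartDSymm x z ∘L fderiv ℝ (chartAt E x ∘ φ.symm) (φ z) := by
  have hψ := IsManifold.chart_mem_maximalAtlas (I := 𝓘(ℝ, E)) (n := ∞) x
  have hu := φ.map_source hz
  have hv := (chartAt E x).map_source hz'
  have h1 := fderiv_transition hφ hψ hu (by rwa [φ.left_inv hz])
  have h2 := fderiv_transition hψ hφ hv (by rwa [(chartAt E x).left_inv hz'])
  rw [(chartAt E x).left_inv hz'] at h2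
  rw [mvfderiv_chart hφ hz hz', ← h2.2]
  obtain ⟨⟨L, hL⟩, -⟩ := h2
  rw [← hL]
  refine ContinuousLinearMap.inverse_eq ?_ ?_
  · ext v
    simp [chartD_symm hz']
  · ext v
    simp [chartDSymm_chartD hz']

lemma comps_coordField_of_mem_maximalAtlas (hφ : φ ∈ IsManifold.maximalAtlas 𝓘(ℝ, E) ∞ X) {x : X}
    {u : E} (hu : u ∈ (chartAt E x).target) (hu' : (chartAt E x).symm u ∈ φ.source) (w : E) :
    comps x (coordField E φ w) u =
      fderiv ℝ (chartAt E x ∘ φ.symm) (φ ((chartAt E x).symm u)) w := by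
  have hz := (chartAt E x).map_target hu
  simp only [comps, coordField]
  rw [mvfderiv_chart_inverse hφ hu' hz]
  exact chartD_symm hz _

variable [FiniteDimensional ℝ E] {κ : Kind} {x : X}

/-- The transformation rule of Christoffel symbols. -/
lemma christoffel_eq_pullback (nabla : LocalConnection E κ x)
    (hφ : φ ∈ IsManifold.maximalAtlas 𝓘(ℝ, E) ∞ X) {u : E} (hu : u ∈ φ.target)
    (hu' : φ.symm u ∈ (chartAt E x).source) (hd : φ.symm u ∈ nabla.domain) :
    christoffel nabla φ u =
      pullback (christoffel nabla (chartAt E x)) (chartAt E x ∘ φ.symm) u := by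
  have hψ := IsManifold.chart_mem_maximalAtlas (I := 𝓘(ℝ, E)) (n := ∞) x
  set ψ := chartAt E x with hψx
  set g := ψ ∘ φ.symm with hg
  set z := φ.symm u with hz
  have hzφ : z ∈ φ.source := φ.map_target hu
  have hφz : φ z = u := φ.right_inv hu
  have hgs := contDiffAt_transition hφ hψ hu hu'
  obtain ⟨hi, hi'⟩ := fderiv_transition hφ hψ hu hu'
  have hv : ψ z ∈ ψ.target := ψ.map_source hu'
  have hv' : ψ.symm (ψ z) ∈ φ.source := by rw [ψ.left_inv hu']; exact hzφ
  let b := Module.finBasis ℝ E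
  have key : ∀ v j, christoffel nabla φ u v (b j) = pullback (christoffel nabla ψ) g u v (b j) := by
    intro v j
    refine hi.injective ?_
    rw [fderiv_pullback hi]
    -- In the preferred chart, a coordinate field of `φ` is the push-forward of a constant field by
    -- the transition map `g`. Differentiating this produces the term `D²g`.
    have hC : comps x (coordField E φ (b j)) =ᶠ[𝓝 (ψ z)]
        fun u' => fderiv ℝ g ((φ ∘ ψ.symm) u') (b j) := by
      filter_upwards [ψ.open_target.mem_nhds hv,
        ψ.continuousAt_symm hv (φ.open_source.mem_nhds hv')] with u' h1 h2
      exact comps_coordField_of_mem_maximalAtlas hφ h1 h2 _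
    have hCd : DifferentiableAt ℝ (comps x (coordField E φ (b j))) (ψ z) := by
      refine DifferentiableAt.congr_of_eventuallyEq ?_ hC
      have h1 : DifferentiableAt ℝ (fderiv ℝ g) ((φ ∘ ψ.symm) (ψ z)) := by
        simp only [Function.comp_apply, ψ.left_inv hu', hφz]
        exact contDiffAt_differentiableAt (contDiffAt_fderiv hgs)
      exact (h1.comp (ψ z) (contDiffAt_differentiableAt (contDiffAt_transition hψ hφ hv hv'))).clm_apply
        (differentiableAt_const _)
    have hCg : comps x (coordField E φ (b j)) ∘ g =ᶠ[𝓝 u] fun u => fderiv ℝ g u (b j) := by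
      filter_upwards [hgs.continuousAt hC, transition_comp φ ψ hu hu'] with u' h1 h2
      refine Eq.trans h1 ?_
      rw [show (φ ∘ ψ.symm) (g u') = u' from h2]
    have hpush : fderiv ℝ (comps x (coordField E φ (b j))) (ψ z) (fderiv ℝ g u v) =
        fderiv ℝ (fderiv ℝ g) u v (b j) + fderiv ℝ g u (fderiv ℝ (fun _ : E => b j) u v) :=
      fderiv_pushforward hgs (differentiableAt_const (b j)) hCd hCg v
    have hCm : MDiffAt (T% (coordField E φ (b j))) z := (mdifferentiableAt_iff_comps hu' _).2 hCd
    have e1 : christoffel nabla φ u v (b j) = mvfderiv 𝓘(ℝ, E) φ z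
        (nabla.cov (coordField E φ (b j)) z ((mvfderiv 𝓘(ℝ, E) φ z).inverse v)) := by
      simp only [christoffel, ContinuousLinearMap.flip_apply, LinearMap.coe_toContinuousLinearMap',
        b, Module.Basis.constr_basis]
      rfl
    have e2 : chartD x z ((mvfderiv 𝓘(ℝ, E) φ z).inverse v) = fderiv ℝ g u v := by
      rw [mvfderiv_chart_inverse hφ hzφ hu', hφz]
      exact chartD_symm hu' _
    have e3 : chartD x z (coordField E φ (b j) z) = fderiv ℝ g u (b j) := by
      rw [← comps_chart hu']
      exact hCg.eq_of_nhds
    have e4 : ∀ w, fderiv ℝ g u (mvfderiv 𝓘(ℝ, E) φ z w) = chartD x z w := by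
      intro w
      rw [mvfderiv_chart hφ hzφ hu', ContinuousLinearMap.comp_apply, ← hi', hi.self_apply_inverse]
    rw [e1, e4, chartD_cov nabla hu' hd hCm, e2, e3]
    rw [← hψx, hpush]
    simp only [fderiv_fun_const, Pi.zero_apply, zero_apply, map_zero, add_zero]
    exact add_comm _ _
  ext v : 1
  refine ContinuousLinearMap.coe_injective (b.ext fun j => key v j)

end Charts

/-! ### The action of local diffeomorphisms in coordinates. -/

section LocalInverses

variable {E : Type*} [NormedAddCommGroup E] [NormedSpace ℝ E]
  {X : Type*} [TopologicalSpace X] [ChartedSpace E X] [IsManifold 𝓘(ℝ, E) ∞ X]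

/-- `f` is a local diffeomorphism at `y`, with local inverse `f'`. -/
structure IsLocalInverse (f f' : X → X) (y : X) : Prop where
  contMDiffAt : ContMDiffAt 𝓘(ℝ, E) 𝓘(ℝ, E) ∞ f y
  contMDiffAt' : ContMDiffAt 𝓘(ℝ, E) 𝓘(ℝ, E) ∞ f' (f y)
  left_inv : f' ∘ f =ᶠ[𝓝 y] id
  right_inv : f ∘ f' =ᶠ[𝓝 (f y)] id

variable (E) in
/-- A map in the preferred chart at `x`. -/
def inChart (x : X) (f : X → X) : E → E := chartAt E x ∘ f ∘ (chartAt E x).symm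

lemma PartialDiffeomorph.isLocalInverse (T : PartialDiffeomorph 𝓘(ℝ, E) 𝓘(ℝ, E) X X ∞) {y : X}
    (hy : y ∈ T.source) : IsLocalInverse (E := E) T T.symm y where
  contMDiffAt := T.contMDiffOn_toFun.contMDiffAt (T.open_source.mem_nhds hy)
  contMDiffAt' := T.contMDiffOn_invFun.contMDiffAt (T.open_target.mem_nhds (T.map_source hy))
  left_inv := by
    filter_upwards [T.open_source.mem_nhds hy] with z hz using T.left_inv hz
  right_inv := by
    filter_upwards [T.open_target.mem_nhds (T.map_source hy)] with z hz using T.right_inv hz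

namespace IsLocalInverse

variable {f f' : X → X} {x y : X}

lemma symm (h : IsLocalInverse (E := E) f f' y) : IsLocalInverse (E := E) f' f (f y) where
  contMDiffAt := h.contMDiffAt'
  contMDiffAt' := by rw [show f' (f y) = y from h.left_inv.eq_of_nhds]; exact h.contMDiffAt
  left_inv := h.right_inv
  right_inv := by rw [show f' (f y) = y from h.left_inv.eq_of_nhds]; exact h.left_inv

lemma inChart_apply (f : X → X) (hy : y ∈ (chartAt E x).source) :
    inChart E x f (chartAt E x y) = chartAt E x (f y) := by
  simp [inChart, (chartAt E x).left_inv hy]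

lemma contDiffAt_inChart (h : IsLocalInverse (E := E) f f' y) (hy : y ∈ (chartAt E x).source)
    (hfy : f y ∈ (chartAt E x).source) : ContDiffAt ℝ ∞ (inChart E x f) (chartAt E x y) := by
  have hψ := IsManifold.chart_mem_maximalAtlas (I := 𝓘(ℝ, E)) (n := ∞) x
  have h1 := contMDiffAt_symm_of_mem_maximalAtlas hψ ((chartAt E x).map_source hy)
  have h2 := contMDiffAt_of_mem_maximalAtlas hψ hfy
  have h3 : ContMDiffAt 𝓘(ℝ, E) 𝓘(ℝ, E) ∞ (chartAt E x ∘ f) y := h2.comp y h.contMDiffAt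
  rw [← (chartAt E x).left_inv hy] at h3
  exact (h3.comp _ h1).contDiffAt

lemma inChart_comp (h : IsLocalInverse (E := E) f f' y) (hy : y ∈ (chartAt E x).source)
    (hfy : f y ∈ (chartAt E x).source) :
    inChart E x f' ∘ inChart E x f =ᶠ[𝓝 (chartAt E x y)] id := by
  have hv := (chartAt E x).map_source hy
  have hc := (chartAt E x).continuousAt_symm hv
  rw [ContinuousAt, (chartAt E x).left_inv hy] at hc
  filter_upwards [(chartAt E x).open_target.mem_nhds hv, hc h.left_inv,
    hc (h.contMDiffAt.continuousAt ((chartAt E x).open_source.mem_nhds hfy))] with u h1 h2 h3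
  have h3 : f ((chartAt E x).symm u) ∈ (chartAt E x).source := h3
  have h2 : f' (f ((chartAt E x).symm u)) = (chartAt E x).symm u := h2
  simp [inChart, (chartAt E x).left_inv h3, h2, (chartAt E x).right_inv h1]

lemma fderiv_inChart (h : IsLocalInverse (E := E) f f' y) (hy : y ∈ (chartAt E x).source)
    (hfy : f y ∈ (chartAt E x).source) :
    (fderiv ℝ (inChart E x f) (chartAt E x y)).IsInvertible ∧
      (fderiv ℝ (inChart E x f) (chartAt E x y)).inverse =
        fderiv ℝ (inChart E x f') (chartAt E x (f y)) := by
  have hy' : f' (f y) = y := h.left_inv.eq_of_nhds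
  have h1 := h.inChart_comp hy hfy
  have h2 := h.symm.inChart_comp hfy (by rwa [hy'])
  have h3 := h.symm.contDiffAt_inChart hfy (by rwa [hy'])
  rw [← inChart_apply f hy] at h2 h3 ⊢
  exact inverse_fderiv_of_inverse h1 h2 (contDiffAt_differentiableAt h3)
    (contDiffAt_differentiableAt (h.contDiffAt_inChart hy hfy))

lemma chartD_mfderiv (h : IsLocalInverse (E := E) f f' y) (hy : y ∈ (chartAt E x).source)
    (hfy : f y ∈ (chartAt E x).source) (v : TangentSpace 𝓘(ℝ, E) y) :
    chartD x (f y) (mfderiv 𝓘(ℝ, E) 𝓘(ℝ, E) f y v) =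
      fderiv ℝ (inChart E x f) (chartAt E x y) (chartD x y v) := by
  have hψ := IsManifold.chart_mem_maximalAtlas (I := 𝓘(ℝ, E)) (n := ∞) x
  have h1 := (contMDiffAt_of_mem_maximalAtlas hψ hfy).mdifferentiableAt (by simp)
  have h2 := h.contMDiffAt.mdifferentiableAt (by simp)
  have h3 : mvfderiv 𝓘(ℝ, E) (chartAt E x ∘ f) y =
      mvfderiv 𝓘(ℝ, E) (chartAt E x) (f y) ∘L mfderiv 𝓘(ℝ, E) 𝓘(ℝ, E) f y := by
    ext w
    exact DFunLike.congr_fun (mfderiv_comp y h1 h2) w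
  rw [mvfderiv_eq_comp_chartD hy (h1.comp y h2), chartD_eq_mvfderiv hfy] at h3
  exact (DFunLike.congr_fun h3 v).symm

lemma chartD_mfderiv_inverse (h : IsLocalInverse (E := E) f f' y) (hy : y ∈ (chartAt E x).source)
    (hfy : f y ∈ (chartAt E x).source) (w : TangentSpace 𝓘(ℝ, E) (f y)) :
    chartD x y ((mfderiv 𝓘(ℝ, E) 𝓘(ℝ, E) f y).inverse w) =
      (fderiv ℝ (inChart E x f) (chartAt E x y)).inverse (chartD x (f y) w) := by
  obtain ⟨⟨L, hL⟩, -⟩ := h.fderiv_inChart (x := x) hy hfy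
  have e : ∀ v, chartD x (f y) (mfderiv 𝓘(ℝ, E) 𝓘(ℝ, E) f y v) = L (chartD x y v) := fun v => by
    rw [h.chartD_mfderiv hy hfy, ← hL]; rfl
  have : (mfderiv 𝓘(ℝ, E) 𝓘(ℝ, E) f y).inverse =
      chartDSymm x y ∘L (L.symm : E →L[ℝ] E) ∘L chartD x (f y) := by
    refine ContinuousLinearMap.inverse_eq ?_ ?_
    · ext v
      refine chartD_injective hfy ?_
      simp only [ContinuousLinearMap.comp_apply, e, chartD_symm hy]
      simp
    · ext v
      refine chartD_injective hy ?_
      simp only [ContinuousLinearMap.comp_apply, e, chartD_symm hy]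
      simp
  rw [this, ← hL]
  simp [chartD_symm hy]

end IsLocalInverse

/-- Pulling back by `f'` is pushing forward by its local inverse `f`. -/
lemma comps_mpullback {f f' : X → X} {x : X} {u : E} (hu : u ∈ (chartAt E x).target)
    (h : IsLocalInverse (E := E) f' f ((chartAt E x).symm u))
    (hu' : f' ((chartAt E x).symm u) ∈ (chartAt E x).source) (D : Π z : X, TangentSpace 𝓘(ℝ, E) z) :
    comps x (VectorField.mpullback 𝓘(ℝ, E) 𝓘(ℝ, E) f' D) u =
      fderiv ℝ (inChart E x f) (inChart E x f' u) (comps x D (inChart E x f' u)) := by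
  have hz := (chartAt E x).map_target hu
  have h1 : comps x (VectorField.mpullback 𝓘(ℝ, E) 𝓘(ℝ, E) f' D) u =
    chartD x ((chartAt E x).symm u) ((mfderiv 𝓘(ℝ, E) 𝓘(ℝ, E) f' ((chartAt E x).symm u)).inverse
      (D (f' ((chartAt E x).symm u)))) := rfl
  rw [h1, h.chartD_mfderiv_inverse hz hu', (h.fderiv_inChart hz hu').2, ← comps_chart hu']
  rfl

variable [FiniteDimensional ℝ E] {κ : Kind} {x : X}

/-- The coordinate expression of the transformed connection: differentiating the push-forward of `D`
yields the derivative of its components plus a `D²g` term, which the pulled-back symbols absorb. -/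
lemma chartD_transform (nabla : LocalConnection E κ x)
    (T : PartialDiffeomorph 𝓘(ℝ, E) 𝓘(ℝ, E) X X ∞) {y : X} (hyT : y ∈ T.source)
    (hy : y ∈ (chartAt E x).source) (hTy : T y ∈ (chartAt E x).source) (hd : T y ∈ nabla.domain)
    {D : Π z : X, TangentSpace 𝓘(ℝ, E) z} (hD : MDiffAt (T% D) y) (v : TangentSpace 𝓘(ℝ, E) y) :
    chartD x y ((mfderiv 𝓘(ℝ, E) 𝓘(ℝ, E) T y).inverse
      (nabla.cov (VectorField.mpullback 𝓘(ℝ, E) 𝓘(ℝ, E) T.symm D) (T y)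
        (mfderiv 𝓘(ℝ, E) 𝓘(ℝ, E) T y v))) =
      fderiv ℝ (comps x D) (chartAt E x y) (chartD x y v) +
        pullback (christoffel nabla (chartAt E x)) (inChart E x T) (chartAt E x y) (chartD x y v)
          (chartD x y (D y)) := by
  set ψ := chartAt E x with hψ
  set g := inChart E x T with hg
  have hT := PartialDiffeomorph.isLocalInverse T hyT
  have hgs : ContDiffAt ℝ ∞ g (ψ y) := hT.contDiffAt_inChart hy hTy
  obtain ⟨hi, -⟩ := hT.fderiv_inChart (x := x) hy hTy
  have hgy : g (ψ y) = ψ (T y) := IsLocalInverse.inChart_apply _ hy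
  have hTy' : T.symm (T y) = y := T.left_inv hyT
  have hs : ContDiffAt ℝ ∞ (inChart E x T.symm) (ψ (T y)) :=
    hT.symm.contDiffAt_inChart hTy (by rwa [hTy'])
  have hsy : inChart E x T.symm (ψ (T y)) = ψ y := by
    rw [IsLocalInverse.inChart_apply _ hTy, hTy']
  have hDd := (mdifferentiableAt_iff_comps hy D).1 hD
  set D' := VectorField.mpullback 𝓘(ℝ, E) 𝓘(ℝ, E) T.symm D
  have hC : comps x D' =ᶠ[𝓝 (ψ (T y))] fun u => fderiv ℝ g (inChart E x T.symm u)
      (comps x D (inChart E x T.symm u)) := by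
    have hv := ψ.map_source hTy
    have hc := ψ.continuousAt_symm hv
    rw [ContinuousAt, ψ.left_inv hTy] at hc
    have hc' : ContinuousAt T.symm (T y) := hT.symm.contMDiffAt.continuousAt
    rw [ContinuousAt, hTy'] at hc'
    filter_upwards [ψ.open_target.mem_nhds hv, hc (T.open_target.mem_nhds (T.map_source hyT)),
      hc (hc' (ψ.open_source.mem_nhds hy))] with u h1 h2 h3
    have h2 : ψ.symm u ∈ T.target := h2
    exact comps_mpullback h1 (PartialDiffeomorph.isLocalInverse T.symm h2) h3 D
  have hCd : DifferentiableAt ℝ (comps x D') (ψ (T y)) := by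
    refine DifferentiableAt.congr_of_eventuallyEq ?_ hC
    have hs' := contDiffAt_differentiableAt hs
    have h1 : DifferentiableAt ℝ (fderiv ℝ g) (inChart E x T.symm (ψ (T y))) := by
      rw [hsy]
      exact contDiffAt_differentiableAt (contDiffAt_fderiv hgs)
    have h2 : DifferentiableAt ℝ (comps x D) (inChart E x T.symm (ψ (T y))) := by rwa [hsy]
    exact (h1.comp _ hs').clm_apply (h2.comp _ hs')
  have hCg : comps x D' ∘ g =ᶠ[𝓝 (ψ y)] fun u => fderiv ℝ g u (comps x D u) := by
    have hgc := hgs.continuousAt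
    rw [ContinuousAt, hgy] at hgc
    filter_upwards [hgc hC, hT.inChart_comp hy hTy] with u h1 h2
    refine Eq.trans h1 ?_
    rw [show inChart E x T.symm (g u) = u from h2]
  have hpush : fderiv ℝ (comps x D') (g (ψ y)) (fderiv ℝ g (ψ y) (chartD x y v)) = _ :=
    fderiv_pushforward hgs hDd (by rwa [hgy]) hCg (chartD x y v)
  have hCm : MDiffAt (T% D') (T y) := (mdifferentiableAt_iff_comps hTy _).2 hCd
  rw [hT.chartD_mfderiv_inverse hy hTy, chartD_cov nabla hTy hd hCm, hT.chartD_mfderiv hy hTy]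
  refine hi.injective ?_
  have e3 : chartD x (T y) (D' (T y)) = fderiv ℝ g (ψ y) (chartD x y (D y)) := by
    rw [← comps_chart hTy, ← comps_chart hy, ← hψ, ← hgy]
    exact hCg.eq_of_nhds
  rw [hi.self_apply_inverse, map_add, fderiv_pullback hi, ← hψ, ← hgy, hpush, e3, comps_chart hy]
  abel

/-- The action of diffeomorphisms on connections, in terms of Christoffel symbols. -/
lemma isTransform_iff (τ : LocalDiffeo E x) (nabla nabla' : LocalConnection E κ x) :
    IsTransform τ nabla nabla' ↔ christoffel nabla' (chartAt E x) =ᶠ[𝓝 (chartAt E x x)]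
      pullback (christoffel nabla (chartAt E x)) τ.inChart := by
  have hx := mem_chart_source E x
  set ψ := chartAt E x with hψ
  set T := τ.toPartialDiffeo with hT
  have hTc : ContinuousAt T x :=
    (PartialDiffeomorph.isLocalInverse T τ.mem_source).contMDiffAt.continuousAt
  rw [ContinuousAt, τ.map_eq] at hTc
  have hev : ∀ᶠ y in 𝓝 x, y ∈ T.source ∧ y ∈ ψ.source ∧ T y ∈ ψ.source ∧ y ∈ nabla'.domain ∧
      T y ∈ nabla.domain := by
    filter_upwards [T.open_source.mem_nhds τ.mem_source, ψ.open_source.mem_nhds hx,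
      hTc (ψ.open_source.mem_nhds hx), nabla'.isOpen_domain.mem_nhds nabla'.mem_domain,
      hTc (nabla.isOpen_domain.mem_nhds nabla.mem_domain)] with y h1 h2 h3 h4 h5
    exact ⟨h1, h2, h3, h4, h5⟩
  have key : ∀ᶠ y in 𝓝 x, ((∀ D : Π z : X, TangentSpace 𝓘(ℝ, E) z, MDiffAt (T% D) y →
    ∀ v : TangentSpace 𝓘(ℝ, E) y, nabla'.cov D y v = (mfderiv 𝓘(ℝ, E) 𝓘(ℝ, E) T y).inverse
        (nabla.cov (VectorField.mpullback 𝓘(ℝ, E) 𝓘(ℝ, E) T.symm D) (T y)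
          (mfderiv 𝓘(ℝ, E) 𝓘(ℝ, E) T y v))) ↔
      christoffel nabla' ψ (ψ y) = pullback (christoffel nabla ψ) τ.inChart (ψ y)) := by
    filter_upwards [hev] with y ⟨h1, h2, h3, h4, h5⟩
    constructor
    · intro h
      ext v w
      -- Coordinate fields suffice as tests: the terms with derivatives of components agree on both
      -- sides, which leaves the Christoffel symbols.
      have h6 := h (coordField E ψ w) (mdifferentiableAt_coordField h2 w) (chartDSymm x y v)
      have h7 := congrArg (chartD x y) h6
      rw [chartD_transform nabla T h1 h2 h3 h5 (mdifferentiableAt_coordField h2 w),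
        chartD_cov nabla' h2 h4 (mdifferentiableAt_coordField h2 w), add_left_cancel_iff,
        chartD_symm h2, ← comps_chart h2, comps_coordField (ψ.map_source h2)] at h7
      exact h7
    · intro h D hD v
      refine chartD_injective h2 ?_
      rw [chartD_transform nabla T h1 h2 h3 h5 hD, chartD_cov nabla' h2 h4 hD, ← hψ, h]
      rfl
  have hmap : 𝓝 (ψ x) = Filter.map ψ (𝓝 x) := (ψ.map_nhds_eq hx).symm
  rw [EventuallyEq, hmap, Filter.eventually_map]
  exact eventually_congr key

end LocalInverses

/-! ### Global extension of germs. -/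

section Extension

variable {E F : Type*} [NormedAddCommGroup E] [NormedSpace ℝ E] [FiniteDimensional ℝ E]
  [NormedAddCommGroup F] [NormedSpace ℝ F]

/-- Germs of smooth functions extend to the whole space. -/
lemma exists_contDiff_smul {f : E → F} {a : E} (hf : ∀ᶠ u in 𝓝 a, ContDiffAt ℝ ∞ f u)
    {p : E → Prop} (hp : ∀ᶠ u in 𝓝 a, p u) :
    ∃ χ : E → ℝ, (ContDiff ℝ ∞ fun u => χ u • f u) ∧ (∀ᶠ u in 𝓝 a, χ u = 1) ∧
      ∀ u, χ u = 0 ∨ p u := by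
  obtain ⟨ε, hε, h⟩ := Metric.eventually_nhds_iff_ball.1 (hf.and hp)
  let χ : ContDiffBump a := ⟨ε / 4, ε / 2, by positivity, by linarith⟩
  refine ⟨χ, contDiff_iff_contDiffAt.2 fun u => ?_, χ.eventuallyEq_one, fun u => ?_⟩
  · by_cases hu : u ∈ Metric.ball a ε
    · exact χ.contDiffAt.smul (h u hu).1
    · have h0 : (fun u => χ u • f u) =ᶠ[𝓝 u] fun _ => 0 := by
        have : u ∈ (Metric.closedBall a (ε / 2))ᶜ := by
          simp only [Metric.mem_ball, not_lt] at hu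
          simp only [Set.mem_compl_iff, Metric.mem_closedBall, not_le]
          linarith
        filter_upwards [Metric.isClosed_closedBall.isOpen_compl.mem_nhds this] with y hy
        have hy : ε / 2 < dist y a := by simpa using hy
        rw [χ.zero_of_le_dist hy.le, zero_smul]
      exact contDiffAt_const.congr_of_eventuallyEq h0
  · by_cases hu : u ∈ Metric.ball a ε
    · exact Or.inr (h u hu).2
    · left
      refine χ.zero_of_le_dist ?_
      simp only [Metric.mem_ball, not_lt] at hu
      exact le_trans (show ε / 2 ≤ ε by linarith) hu

end Extension

/-! ### Lines and geodesics in normal coordinates. -/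

section Lines

variable {E : Type*} [NormedAddCommGroup E] [NormedSpace ℝ E]

lemma pullback_translate (Γ : E → E →L[ℝ] E →L[ℝ] E) (g : E → E) (a b u : E) :
    pullback (fun u => Γ (u + a)) (fun u => g (u + b) - a) u = pullback Γ g (u + b) := by
  have h1 : fderiv ℝ (fun u => g (u + b) - a) = fun u => fderiv ℝ g (u + b) := by
    ext1 u
    rw [fderiv_sub_const, fderiv_comp_add_right]
  simp only [pullback, h1]
  rw [fderiv_comp_add_right, sub_add_cancel]

/-- At `u = s v` the hypothesis reads `s² Γ(s v)(v, v) = 0`. Cancelling `s²` settles `s ≠ 0`, and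
continuity settles `s = 0`. -/
lemma apply_line_eq_zero {Γ : E → E →L[ℝ] E →L[ℝ] E} {U : Set E} (hΓ : ContinuousAt Γ 0)
    (hU : U ∈ 𝓝 0) (h : ∀ u ∈ U, Γ u u u = 0) {v : E} {t : ℝ} (ht : t • v ∈ U) :
    Γ (t • v) v v = 0 := by
  have key : ∀ s : ℝ, s ≠ 0 → s • v ∈ U → Γ (s • v) v v = 0 := by
    intro s hs hsU
    have := h _ hsU
    simp only [map_smul, smul_apply, smul_smul] at this
    exact (smul_eq_zero.1 this).resolve_left (mul_ne_zero hs hs)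
  by_cases h0 : t = 0
  · subst h0
    have hl : Tendsto (fun s : ℝ => s • v) (𝓝 0) (𝓝 0) := by
      simpa using (by fun_prop : Continuous fun s : ℝ => s • v).tendsto 0
    have h1 : Tendsto (fun s : ℝ => Γ (s • v) v v) (𝓝[≠] 0) (𝓝 (Γ 0 v v)) := by
      have h2 : ContinuousAt (fun u => Γ u v v) 0 := by fun_prop
      exact (h2.tendsto.comp hl).mono_left nhdsWithin_le_nhds
    have h3 : Tendsto (fun s : ℝ => Γ (s • v) v v) (𝓝[≠] 0) (𝓝 0) := by
      refine tendsto_const_nhds.congr' ?_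
      filter_upwards [self_mem_nhdsWithin, nhdsWithin_le_nhds (hl hU)] with s hs hsU
      exact (key s hs hsU).symm
    rw [zero_smul]
    exact tendsto_nhds_unique h1 h3
  · exact key t h0 ht

lemma deriv_deriv_comp_line {k : E → E} {v : E} {t : ℝ} (hk : ContDiffAt ℝ ∞ k (t • v)) :
    deriv (fun s : ℝ => k (s • v)) t = fderiv ℝ k (t • v) v ∧
      deriv (deriv fun s : ℝ => k (s • v)) t = fderiv ℝ (fderiv ℝ k) (t • v) v v := by
  have h1 : deriv (fun s : ℝ => k (s • v)) =ᶠ[𝓝 t] fun s => fderiv ℝ k (s • v) v := by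
    filter_upwards [(by fun_prop : Continuous fun s : ℝ => s • v).continuousAt
      (eventually_differentiableAt hk)] with s hs
    exact (hasDerivAt_line hs).deriv
  exact ⟨h1.eq_of_nhds, by rw [h1.deriv_eq]; exact (hasDerivAt_fderiv_line (contDiffAt_two hk)).deriv⟩

/-- Geodesics through `0` are straight lines when straight lines are geodesics. -/
lemma geodesic_eq_line {Γ : E → E →L[ℝ] E →L[ℝ] E} (hΓ : ContDiffAt ℝ ∞ Γ 0)
    (h : ∀ᶠ u in 𝓝 0, Γ u u u = 0) {c : ℝ → E} (hc : ContDiffAt ℝ ∞ c 0) (h0 : c 0 = 0)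
    (hcΓ : ∀ᶠ t in 𝓝 0, deriv (deriv c) t + Γ (c t) (deriv c t) (deriv c t) = 0) :
    c =ᶠ[𝓝 0] fun t => t • deriv c 0 := by
  set v := deriv c 0
  -- The geodesic equation as a first-order system in position and velocity. It is locally
  -- Lipschitz, and both the geodesic and the line solve it with the same initial data.
  let V : E × E → E × E := fun q => (q.2, -Γ q.1 q.2 q.2)
  have hV : ContDiffAt ℝ 1 V (0, v) := by
    have h1 : ContDiffAt ℝ 1 (fun q : E × E => Γ q.1) (0, v) :=
      ContDiffAt.comp (g := Γ) (f := Prod.fst) ((0 : E), v) (hΓ.of_le (by exact_mod_cast le_top))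
        contDiffAt_fst
    exact contDiffAt_snd.prodMk ((h1.clm_apply contDiffAt_snd).clm_apply contDiffAt_snd).neg
  obtain ⟨K, s, hs, hK⟩ := hV.exists_lipschitzOnWith
  have hc1 : ∀ᶠ t in 𝓝 0, HasDerivAt c (deriv c t) t := by
    filter_upwards [eventually_differentiableAt hc] with t ht using ht.hasDerivAt
  have hcd : ContDiffAt ℝ ∞ (deriv c) 0 := by
    have : deriv c = fun t => fderiv ℝ c t 1 := by ext t; simp
    rw [this]
    exact (contDiffAt_fderiv hc).clm_apply contDiffAt_const
  have hc2 : ∀ᶠ t in 𝓝 0, HasDerivAt (deriv c) (deriv (deriv c) t) t := by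
    filter_upwards [eventually_differentiableAt hcd] with t ht using ht.hasDerivAt
  have hl : Tendsto (fun t : ℝ => t • v) (𝓝 0) (𝓝 0) := by
    simpa using (by fun_prop : Continuous fun t : ℝ => t • v).tendsto 0
  have hcont1 : Tendsto (fun t => (c t, deriv c t)) (𝓝 0) (𝓝 (0, v)) := by
    have := hc.continuousAt.tendsto.prodMk_nhds hcd.continuousAt.tendsto
    rwa [h0] at this
  have hcont2 : Tendsto (fun t : ℝ => (t • v, v)) (𝓝 0) (𝓝 (0, v)) :=
    hl.prodMk_nhds tendsto_const_nhds
  obtain ⟨U, hU, hUU⟩ := h.exists_mem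
  have key : (fun t => (c t, deriv c t)) =ᶠ[𝓝 0] fun t : ℝ => (t • v, v) := by
    refine ODE_solution_unique_of_eventually (v := fun _ => V) (s := fun _ => s) (K := K)
      (Eventually.of_forall fun _ => hK) ?_ ?_ (by simp [h0, v])
    · filter_upwards [hc1, hc2, hcΓ, hcont1 hs] with t h1 h2 h3 h4
      refine ⟨?_, h4⟩
      have : V (c t, deriv c t) = (deriv c t, deriv (deriv c) t) := by
        simp only [V]
        rw [eq_neg_of_add_eq_zero_left h3]
      rw [this]
      exact h1.prodMk h2
    · filter_upwards [hcont2 hs, hl hU] with t h4 h5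
      refine ⟨?_, h4⟩
      have : V (t • v, v) = (v, 0) := by
        simp only [V]
        rw [apply_line_eq_zero hΓ.continuousAt hU hUU h5, neg_zero]
      rw [this]
      exact (by simpa using (hasDerivAt_id t).smul_const v : HasDerivAt (fun t : ℝ => t • v) v t).prodMk
        (hasDerivAt_const t v)
  filter_upwards [key] with t ht using congrArg Prod.fst ht

end Lines

/-! ### The Christoffel germ of a connection. -/

section NormalCharts

variable {E : Type*} [NormedAddCommGroup E] [NormedSpace ℝ E] [FiniteDimensional ℝ E]
  {X : Type*} [TopologicalSpace X] [ChartedSpace E X] [IsManifold 𝓘(ℝ, E) ∞ X]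
  {κ : Kind} {x : X} {r : ℕ}

/-- The Christoffel symbols in the preferred chart at `x`, translated so that it is centred. -/
def christoffelAt (nabla : LocalConnection E κ x) (u : E) : E →L[ℝ] E →L[ℝ] E :=
  christoffel nabla (chartAt E x) (u + chartAt E x x)

lemma tendsto_chart_symm (x : X) :
    Tendsto (fun u : E => (chartAt E x).symm (u + chartAt E x x)) (𝓝 0) (𝓝 x) := by
  have hx := mem_chart_source E x
  have h1 := (chartAt E x).continuousAt_symm ((chartAt E x).map_source hx)
  rw [ContinuousAt, (chartAt E x).left_inv hx] at h1
  refine h1.comp ?_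
  simpa using (by fun_prop : Continuous fun u : E => u + chartAt E x x).tendsto 0

lemma eventually_mem_target (x : X) : ∀ᶠ u : E in 𝓝 0, u + chartAt E x x ∈ (chartAt E x).target := by
  have h1 : Tendsto (fun u : E => u + chartAt E x x) (𝓝 0) (𝓝 (chartAt E x x)) := by
    simpa using (by fun_prop : Continuous fun u : E => u + chartAt E x x).tendsto 0
  exact h1 ((chartAt E x).open_target.mem_nhds ((chartAt E x).map_source (mem_chart_source E x)))

lemma eventually_contDiffAt_christoffelAt (nabla : LocalConnection E κ x) :
    ∀ᶠ u in 𝓝 0, ContDiffAt ℝ ∞ (christoffelAt nabla) u := by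
  filter_upwards [eventually_mem_target x,
    tendsto_chart_symm x (nabla.isOpen_domain.mem_nhds nabla.mem_domain)] with u h1 h2
  exact ContDiffAt.comp (g := christoffel nabla (chartAt E x)) u (contDiffAt_christoffel nabla h1 h2)
    (by fun_prop)

lemma isConnGerm_christoffelAt (nabla : LocalConnection E κ x) :
    IsConnGerm κ (christoffelAt nabla) := by
  refine ⟨(eventually_contDiffAt_christoffelAt nabla).self_of_nhds, fun hκ => ?_⟩
  subst hκ
  filter_upwards [eventually_mem_target x,
    tendsto_chart_symm x (nabla.isOpen_domain.mem_nhds nabla.mem_domain)] with u h1 h2 v w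
  exact christoffel_symm nabla h1 h2 v w

lemma germJet_christoffelAt (nabla : LocalConnection E κ x) :
    germJet r (isConnGerm_christoffelAt nabla) = jetCoeff r nabla := by
  refine Subtype.ext (funext fun m => ?_)
  change iteratedFDeriv ℝ m (fun u => christoffel nabla (chartAt E x) (u + chartAt E x x)) 0 = _
  rw [iteratedFDeriv_comp_add_right, zero_add]
  rfl

end NormalCharts

/-! ### Normal tensors computed in normal charts. -/

section NormalChartTensors

variable {E : Type*} [NormedAddCommGroup E] [NormedSpace ℝ E] [FiniteDimensional ℝ E]
  {X : Type*} [TopologicalSpace X] [ChartedSpace E X] [IsManifold 𝓘(ℝ, E) ∞ X]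
  {κ : Kind} {x : X} {r : ℕ} {φ : OpenPartialHomeomorph X E}

/-- Linear changes of coordinates have no second derivative, so the symbols and all their
derivatives transform as tensors. -/
lemma iteratedFDeriv_conj {Γ : E → E →L[ℝ] E →L[ℝ] E} (hΓ : ContDiffAt ℝ ∞ Γ 0) (L : E ≃L[ℝ] E)
    {Γ' : E → E →L[ℝ] E →L[ℝ] E} (hΓ' : ContDiffAt ℝ ∞ Γ' 0)
    (h : ∀ᶠ u in 𝓝 0, ∀ v w, Γ' u v w = L.symm (Γ (L u) (L v) (L w))) (m : ℕ) (a : Fin m → E)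
    (v w : E) : iteratedFDeriv ℝ m Γ' 0 a v w =
      L.symm (iteratedFDeriv ℝ m Γ 0 (fun i => L (a i)) (L v) (L w)) := by
  have key : ∀ (M : E →L[ℝ] E) (v w : E) (Γ : E → E →L[ℝ] E →L[ℝ] E), ContDiffAt ℝ ∞ Γ 0 →
      ∀ a, iteratedFDeriv ℝ m (fun u => M (Γ u v w)) 0 a = M (iteratedFDeriv ℝ m Γ 0 a v w) := by
    intro M v w Γ hΓ a
    have := ContinuousLinearMap.iteratedFDeriv_comp_left
      (M ∘L ContinuousLinearMap.apply ℝ E w ∘L ContinuousLinearMap.apply ℝ (E →L[ℝ] E) v) hΓ (i := m)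
      (by exact_mod_cast le_top)
    exact congrArg (fun f => f a) this
  rw [← ContinuousLinearMap.id_apply (R₁ := ℝ) (iteratedFDeriv ℝ m Γ' 0 a v w), ← key _ _ _ _ hΓ',
    show L.symm _ = (L.symm : E →L[ℝ] E) _ from rfl, ← key _ _ _ _ hΓ]
  have e : (fun u => ContinuousLinearMap.id ℝ E (Γ' u v w)) =ᶠ[𝓝 0]
      (fun u => (L.symm : E →L[ℝ] E) (Γ u (L v) (L w))) ∘ L := by
    filter_upwards [h] with u hu using hu v w
  rw [(e.iteratedFDeriv ℝ m).eq_of_nhds]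
  have h2 := L.iteratedFDerivWithin_comp_right (fun u => (L.symm : E →L[ℝ] E) (Γ u (L v) (L w)))
    uniqueDiffOn_univ (x := 0) (Set.mem_univ _) m
  simp only [Set.preimage_univ, iteratedFDerivWithin_univ, map_zero] at h2
  rw [h2]
  rfl

lemma fderiv_fderiv_clm (L : E →L[ℝ] E) (u : E) : fderiv ℝ (fderiv ℝ L) u = 0 := by
  have : fderiv ℝ L = fun _ => L := funext fun u => L.fderiv
  rw [this]
  simp

/-- The Christoffel symbols in a normal chart vanish on the diagonal. -/
lemma IsNormalChart.christoffel_self {nabla : LocalConnection E κ x} (h : IsNormalChart nabla φ) :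
    ∀ᶠ u in 𝓝 0, christoffel nabla φ u u u = 0 := by
  obtain ⟨ε, hε, hb, hg⟩ := h.isGeodesicOn
  filter_upwards [Metric.ball_mem_nhds (0 : E) hε] with u hu
  have h1 : (1 : ℝ) ∈ {t : ℝ | t • u ∈ Metric.ball (0 : E) ε} := by simpa using hu
  have hs : φ.symm ((1 : ℝ) • u) ∈ φ.source := φ.map_target (hb h1)
  -- The line `t ↦ t u` passes through `u` at `t = 1`; read in `φ` itself it has no acceleration, so
  -- the geodesic equation reduces to the radial contraction.
  have h2 := ((hg u).2 1 h1).2 φ h.mem_maximalAtlas hs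
  have hev : φ ∘ (fun t : ℝ => φ.symm (t • u)) =ᶠ[𝓝 1] fun t => id (t • u) := by
    have : ContinuousAt (fun t : ℝ => t • u) 1 := by fun_prop
    filter_upwards [this (φ.open_target.mem_nhds (hb h1))] with t ht
    exact φ.right_inv ht
  have hd := deriv_deriv_comp_line (k := id) (v := u) (t := 1) contDiffAt_id
  rw [hev.deriv.deriv_eq, hev.deriv_eq, hd.1, hd.2, φ.right_inv (hb h1)] at h2
  have h0 : fderiv ℝ (fderiv ℝ (id : E → E)) ((1 : ℝ) • u) = 0 :=
    fderiv_fderiv_clm (ContinuousLinearMap.id ℝ E) _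
  rw [h0] at h2
  simpa using h2

/-- The normal form, computed in coordinates which are normal but not tangent to the given ones. -/
lemma normalForm_apply_of_pullback {Γ Γ' : E → E →L[ℝ] E →L[ℝ] E} (h : IsConnGerm κ Γ) {g : E → E}
    (hg : ∀ᶠ u in 𝓝 0, ContDiffAt ℝ ∞ g u) (hg0 : g 0 = 0) (L : E ≃L[ℝ] E)
    (hL : fderiv ℝ g 0 = L) (hΓ' : Γ' =ᶠ[𝓝 0] pullback Γ g) (hn : ∀ᶠ u in 𝓝 0, Γ' u u u = 0)
    (m : Fin (r + 1)) (v w : E) (a : Fin m → E) :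
    (normalForm (germJet r h)).1 m a v w =
      L (iteratedFDeriv ℝ m Γ' 0 (fun i => L.symm (a i)) (L.symm v) (L.symm w)) := by
  have := FiniteDimensional.complete ℝ E
  have hinv0 : (fderiv ℝ g 0).IsInvertible := ⟨L, hL.symm⟩
  have hinv : ∀ᶠ u in 𝓝 0, (fderiv ℝ g u).IsInvertible :=
    (contDiffAt_fderiv hg.self_of_nhds).continuousAt (isOpen_setOf_isInvertible.mem_nhds hinv0)
  have hL0 : Tendsto (L.symm : E → E) (𝓝 0) (𝓝 0) := by simpa using L.symm.continuous.tendsto 0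
  have hLd : ∀ u, fderiv ℝ L.symm u = (L.symm : E →L[ℝ] E) := fun u => L.symm.fderiv
  -- Composing with the inverse of the differential makes the map tangent to the identity; it stays
  -- normalizing because `L` maps lines through `0` to lines.
  have he : IsTangentToId (g ∘ L.symm) := by
    refine ⟨?_, ?_, ?_⟩
    · filter_upwards [hL0 hg] with u hu
      have hu : ContDiffAt ℝ ∞ g (L.symm u) := hu
      exact hu.comp u L.symm.contDiff.contDiffAt
    · simp [hg0]
    · have hgd : DifferentiableAt ℝ g (L.symm 0) := by
        rw [map_zero]; exact contDiffAt_differentiableAt hg.self_of_nhds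
      rw [fderiv_comp _ hgd L.symm.differentiableAt, map_zero, hL, hLd]
      ext u; simp
  have hconj : ∀ᶠ u in 𝓝 0, ∀ v w, pullback Γ (g ∘ L.symm) u v w =
      L (Γ' (L.symm u) (L.symm v) (L.symm w)) := by
    filter_upwards [hL0 hg, hL0 hinv, hL0 hΓ'] with u h1 h2 h3 v w
    have h3 : Γ' (L.symm u) = pullback Γ g (L.symm u) := h3
    have hi : (fderiv ℝ (L.symm : E → E) u).IsInvertible := ⟨L.symm, (hLd u).symm⟩
    have h4 := pullback_comp_apply (Γ := Γ) h1 L.symm.contDiff.contDiffAt h2 hi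
    have h5 := fderiv_pullback (Γ := pullback Γ g) hi v w
    rw [hLd, show fderiv ℝ (fderiv ℝ (L.symm : E → E)) u = 0 from
      fderiv_fderiv_clm (L.symm : E →L[ℝ] E) u, ← h3, ← h4] at h5
    simp only [zero_apply, add_zero] at h5
    exact L.symm_apply_eq.1 h5
  have hΓ's : ContDiffAt ℝ ∞ Γ' 0 := by
    refine (contDiffAt_pullback_of ?_ hg.self_of_nhds hinv0).congr_of_eventuallyEq hΓ'
    rw [hg0]
    exact h.contDiffAt
  have hn' : IsOrder (r + 3) fun u => pullback Γ (g ∘ L.symm) u u u := by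
    refine (isBigO_zero _ _).congr' ?_ EventuallyEq.rfl
    filter_upwards [hconj, hL0 hn] with u h1 h2
    have h2 : Γ' (L.symm u) (L.symm u) (L.symm u) = 0 := h2
    rw [h1, h2, map_zero]
  rw [← germJet_pullback_of_normal h he hn']
  exact iteratedFDeriv_conj hΓ's L.symm (h.pullback he).contDiffAt hconj m a v w

lemma IsNormalChart.tendsto_symm {nabla : LocalConnection E κ x} (h : IsNormalChart nabla φ) :
    (0 : E) ∈ φ.target ∧ φ.symm 0 = x ∧ Tendsto φ.symm (𝓝 0) (𝓝 x) := by
  have h0 : (0 : E) ∈ φ.target := by rw [← h.map_eq_zero]; exact φ.map_source h.mem_source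
  have hs0 : φ.symm 0 = x := by rw [← h.map_eq_zero]; exact φ.left_inv h.mem_source
  exact ⟨h0, hs0, by simpa [hs0] using (φ.continuousAt_symm h0).tendsto⟩

/-- The normal tensors of the jet of a connection are computed in any normal chart. -/
lemma IsNormalChart.normalTensors_apply {nabla : LocalConnection E κ x}
    (h : IsNormalChart nabla φ) (m : Fin (r + 1)) (v w : E) (a : Fin m → E) :
    (normalTensors (jetCoeff r nabla) m).1 (Matrix.vecCons v (Matrix.vecCons w a)) =
      (mvfderiv 𝓘(ℝ, E) φ x).inverse
      (iteratedFDeriv ℝ m (christoffel nabla φ) 0 (fun i => mvfderiv 𝓘(ℝ, E) φ x (a i))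
        (mvfderiv 𝓘(ℝ, E) φ x v) (mvfderiv 𝓘(ℝ, E) φ x w)) := by
  have hψ := IsManifold.chart_mem_maximalAtlas (I := 𝓘(ℝ, E)) (n := ∞) x
  have hx := mem_chart_source E x
  have hφ := h.mem_maximalAtlas
  set ψ := chartAt E x with hψx
  obtain ⟨h0, hs0, hst⟩ := h.tendsto_symm
  have hev : ∀ᶠ u in 𝓝 0, u ∈ φ.target ∧ φ.symm u ∈ ψ.source ∧ φ.symm u ∈ nabla.domain := by
    filter_upwards [φ.open_target.mem_nhds h0, hst (ψ.open_source.mem_nhds hx),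
      hst (nabla.isOpen_domain.mem_nhds nabla.mem_domain)] with u h1 h2 h3 using ⟨h1, h2, h3⟩
  let g : E → E := fun u => (ψ ∘ φ.symm) u - ψ x
  have hg1 : ∀ u, fderiv ℝ g u = fderiv ℝ (ψ ∘ φ.symm) u := fun u => fderiv_sub_const _
  have hgs : ∀ᶠ u in 𝓝 0, ContDiffAt ℝ ∞ g u := by
    filter_upwards [hev] with u ⟨h1, h2, h3⟩
    exact (contDiffAt_transition hφ hψ h1 h2).sub contDiffAt_const
  have hΓ : christoffel nabla φ =ᶠ[𝓝 0] pullback (christoffelAt nabla) g := by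
    filter_upwards [hev] with u ⟨h1, h2, h3⟩
    rw [christoffel_eq_pullback nabla hφ h1 h2 h3]
    have := pullback_translate (christoffel nabla ψ) (ψ ∘ φ.symm) (ψ x) 0 u
    simp only [add_zero] at this
    exact this.symm
  obtain ⟨⟨L, hL⟩, hL'⟩ := fderiv_transition hφ hψ h0 (by rwa [hs0])
  rw [hs0, ← hL, ContinuousLinearMap.inverse_equiv] at hL'
  -- `L` is the differential at `0` of the transition from `φ` to the preferred chart, so its
  -- inverse is the differential of `φ` at `x`.
  have hφx : mvfderiv 𝓘(ℝ, E) φ x = (L.symm : E →L[ℝ] E) := by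
    rw [mvfderiv_chart hφ h.mem_source hx, chartD_self, ← hL']
    rfl
  have hφx' : (mvfderiv 𝓘(ℝ, E) φ x).inverse = (L : E →L[ℝ] E) := by
    rw [hφx]
    exact ContinuousLinearMap.inverse_equiv L.symm
  have key := normalForm_apply_of_pullback (r := r) (isConnGerm_christoffelAt nabla) hgs
    (by simp [g, hs0]) L (by rw [hg1, hL]) hΓ h.christoffel_self m v w a
  rw [germJet_christoffelAt] at key
  rw [hφx', hφx]
  exact (tensorOf_cons m _ v w a).trans key

end NormalChartTensors

/-! ### Existence of normal charts. -/

section ExistsNormalChart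

variable {E : Type*} [NormedAddCommGroup E] [NormedSpace ℝ E] [FiniteDimensional ℝ E]
  {X : Type*} [TopologicalSpace X] [ChartedSpace E X] [IsManifold 𝓘(ℝ, E) ∞ X]
  {κ : Kind} {x : X}

/-- Germs of Christoffel symbols admit exact normal coordinates. -/
lemma exists_pullback_self_eq_zero {Γ : E → E →L[ℝ] E →L[ℝ] E}
    (hΓ : ∀ᶠ u in 𝓝 0, ContDiffAt ℝ ∞ Γ u) :
    ∃ e : E → E, IsTangentToId e ∧ ∀ᶠ u in 𝓝 0, pullback Γ e u u u = 0 := by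
  have := FiniteDimensional.complete ℝ E
  obtain ⟨χ, h1, h2, -⟩ := exists_contDiff_smul hΓ (p := fun _ => True) (by simp)
  obtain ⟨e, he, hd⟩ := exists_defect_eq_zero h1
  have hev : (fun u => χ u • Γ u) =ᶠ[𝓝 0] Γ := by
    filter_upwards [h2] with u hu
    rw [hu, one_smul]
  refine ⟨e, he, ?_⟩
  filter_upwards [hd, pullback_congr_left he hev, he.isInvertible] with u h1 h2 h3
  rw [← h2]
  refine h3.injective ?_
  rw [fderiv_pullback_self h3, h1, map_zero]

/-- The Christoffel symbols in the composition of the centred preferred chart and `Φ.symm`. -/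
lemma pullback_christoffel_of_symm_eq (nabla : LocalConnection E κ x)
    {φ ψ : OpenPartialHomeomorph X E} (hφ : φ ∈ IsManifold.maximalAtlas 𝓘(ℝ, E) ∞ X)
    (hψ : ψ ∈ IsManifold.maximalAtlas 𝓘(ℝ, E) ∞ X) {e : E → E} {u : E} (hu : u ∈ φ.target)
    (hφe : ∀ᶠ u in 𝓝 u, φ.symm u = (chartAt E x).symm (e u + chartAt E x x) ∧
      e u + chartAt E x x ∈ (chartAt E x).target)
    (hd : φ.symm u ∈ nabla.domain) (hψu : φ.symm u ∈ ψ.source) :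
    pullback (christoffel nabla ψ) (ψ ∘ φ.symm) u = pullback (christoffelAt nabla) e u := by
  have hψ₀ := IsManifold.chart_mem_maximalAtlas (I := 𝓘(ℝ, E)) (n := ∞) x
  set ψ₀ := chartAt E x with hψ₀x
  have hφψ₀ : φ.symm u ∈ ψ₀.source := by
    rw [hφe.self_of_nhds.1]; exact ψ₀.map_target hφe.self_of_nhds.2
  have hv : (ψ ∘ φ.symm) u ∈ ψ.target := ψ.map_source hψu
  have hvs : ψ.symm ((ψ ∘ φ.symm) u) = φ.symm u := ψ.left_inv hψu
  have h1 : christoffel nabla ψ ((ψ ∘ φ.symm) u) =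
      pullback (christoffel nabla ψ₀) (ψ₀ ∘ ψ.symm) ((ψ ∘ φ.symm) u) :=
    christoffel_eq_pullback nabla hψ hv (by rwa [hvs]) (by rwa [hvs])
  have h2 : pullback (christoffel nabla ψ) (ψ ∘ φ.symm) u =
      pullback (pullback (christoffel nabla ψ₀) (ψ₀ ∘ ψ.symm)) (ψ ∘ φ.symm) u := by
    rw [pullback, h1]
    rfl
  have h3 : (ψ₀ ∘ ψ.symm) ∘ (ψ ∘ φ.symm) =ᶠ[𝓝 u] fun u => e u + ψ₀ x := by
    filter_upwards [hφe, φ.continuousAt_symm hu (ψ.open_source.mem_nhds hψu)] with y ⟨hy1, hy2⟩ hy3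
    have hy3 : φ.symm y ∈ ψ.source := hy3
    simp only [Function.comp_apply, ψ.left_inv hy3]
    rw [hy1, ψ₀.right_inv hy2]
  rw [h2, ← pullback_comp_apply (contDiffAt_transition hψ hψ₀ hv (by rwa [hvs]))
    (contDiffAt_transition hφ hψ hu hψu) (fderiv_transition hψ hψ₀ hv (by rwa [hvs])).1
    (fderiv_transition hφ hψ hu hψu).1]
  have h4 := pullback_translate (christoffel nabla ψ₀) (fun u => e u + ψ₀ x) (ψ₀ x) 0 u
  simp only [add_zero, add_sub_cancel_right] at h4
  have h5 : pullback (christoffelAt nabla) e u = pullback (fun u => christoffel nabla ψ₀ (u + ψ₀ x)) e u := rfl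
  rw [h5, h4, pullback, pullback, h3.eq_of_nhds, h3.fderiv_eq, h3.fderiv.fderiv_eq]

/-- Normal charts exist. -/
lemma exists_isNormalChart (nabla : LocalConnection E κ x) : ∃ φ, IsNormalChart nabla φ := by
  have := FiniteDimensional.complete ℝ E
  have hψ := IsManifold.chart_mem_maximalAtlas (I := 𝓘(ℝ, E)) (n := ∞) x
  have hx := mem_chart_source E x
  obtain ⟨e, he, hpe⟩ := exists_pullback_self_eq_zero (eventually_contDiffAt_christoffelAt nabla)
  -- Conditions to hold on the whole target of the new chart: normality, and that the point lies in
  -- the preferred chart and in the domain of the connection.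
  have hp : ∀ᶠ u in 𝓝 0, pullback (christoffelAt nabla) e u u u = 0 ∧
      e u + chartAt E x x ∈ (chartAt E x).target ∧
      (chartAt E x).symm (e u + chartAt E x x) ∈ nabla.domain := by
    filter_upwards [hpe, he.tendsto (eventually_mem_target x), he.tendsto (tendsto_chart_symm x
      (nabla.isOpen_domain.mem_nhds nabla.mem_domain))] with u h1 h2 h3 using ⟨h1, h2, h3⟩
  obtain ⟨Φ, hΦ, h0, hΦs, hΦt⟩ := exists_openPartialHomeomorph he.contDiffAt he.isInvertible_zero hp
  set ψ := chartAt E x with hψx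
  -- The centred preferred chart followed by the inverse of `e`.
  let φ : OpenPartialHomeomorph X E :=
    ψ ≫ₕ (Homeomorph.addRight (-ψ x)).toOpenPartialHomeomorph ≫ₕ Φ.symm
  have hφ : ∀ z, φ z = Φ.symm (ψ z - ψ x) := fun z => by
    simp [φ, sub_eq_add_neg]
  have hφs : ∀ u, φ.symm u = ψ.symm (e u + ψ x) := fun u => by
    simp only [φ, mfld_simps]
    simp only [hΦ, neg_neg, Homeomorph.addRight_symm, Homeomorph.coe_addRight]
  have hsource : ∀ z, z ∈ φ.source ↔ z ∈ ψ.source ∧ ψ z - ψ x ∈ Φ.target := fun z => by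
    simp [φ, sub_eq_add_neg]
  have htarget : ∀ u, u ∈ φ.target ↔ u ∈ Φ.source := fun u => by
    simp only [φ, mfld_simps]
    simp only [hΦ, neg_neg, Homeomorph.addRight_symm, Homeomorph.coe_addRight]
    exact ⟨fun h => h.1, fun h => ⟨h, by simpa using (hΦs u h).1.2.1⟩⟩
  have hxs : x ∈ φ.source := by
    rw [hsource, sub_self]
    refine ⟨hx, ?_⟩
    have := Φ.map_source h0
    rwa [hΦ, he.map_zero] at this
  have hx0 : φ x = 0 := by
    rw [hφ, sub_self]
    have := Φ.left_inv h0
    rwa [hΦ, he.map_zero] at this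
  have hatlas : φ ∈ IsManifold.maximalAtlas 𝓘(ℝ, E) ∞ X := by
    refine φ.mem_maximalAtlas_of_contMDiffOn (fun z hz => ?_) fun u hu => ?_
    · obtain ⟨h1, h2⟩ := (hsource z).1 hz
      have h3 : ContMDiffAt 𝓘(ℝ, E) 𝓘(ℝ, E) ∞ (fun z => ψ z - ψ x) z :=
        (contMDiffAt_of_mem_maximalAtlas hψ h1).sub contMDiffAt_const
      have h4 := (hΦt _ h2).contMDiffAt.comp z h3
      exact (h4.congr_of_eventuallyEq (Eventually.of_forall hφ)).contMDiffWithinAt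
    · have hu' := (htarget u).1 hu
      obtain ⟨⟨-, h1, -⟩, h2, -⟩ := hΦs u hu'
      have h3 : ContMDiffAt 𝓘(ℝ, E) 𝓘(ℝ, E) ∞ (fun u => e u + ψ x) u :=
        (h2.add contDiffAt_const).contMDiffAt
      have h4 := (contMDiffAt_symm_of_mem_maximalAtlas hψ h1).comp u h3
      exact (h4.congr_of_eventuallyEq (Eventually.of_forall hφs)).contMDiffWithinAt
  have hdom : ∀ u ∈ φ.target, φ.symm u ∈ nabla.domain := fun u hu => by
    rw [hφs]
    exact (hΦs u ((htarget u).1 hu)).1.2.2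
  -- The pullback to `φ` of the symbols in a chart `ψ'` does not depend on `ψ'`. Hence the geodesic
  -- equation of a line can be checked in every chart at once.
  have hpull : ∀ u ∈ φ.target, ∀ ψ' ∈ IsManifold.maximalAtlas 𝓘(ℝ, E) ∞ X, φ.symm u ∈ ψ'.source →
      pullback (christoffel nabla ψ') (ψ' ∘ φ.symm) u = pullback (christoffelAt nabla) e u := by
    intro u hu ψ' hψ' hu'
    refine pullback_christoffel_of_symm_eq nabla hatlas hψ' hu ?_ (hdom u hu) hu'
    filter_upwards [φ.open_target.mem_nhds hu] with y hy
    exact ⟨hφs y, (hΦs y ((htarget y).1 hy)).1.2.1⟩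
  have hcont : ContDiffAt ℝ ∞ (pullback (christoffelAt nabla) e) 0 :=
    contDiffAt_pullback (isConnGerm_christoffelAt nabla).contDiffAt he
  have hφ0 : (0 : E) ∈ φ.target := (htarget 0).2 h0
  refine ⟨φ, hatlas, hxs, hx0, ?_, ?_⟩
  · obtain ⟨ε, hε, hball⟩ := Metric.mem_nhds_iff.1 (φ.open_target.mem_nhds hφ0)
    refine ⟨ε, hε, hball, fun v => ⟨fun t ht => ?_, fun t ht => ⟨hdom _ (hball ht), ?_⟩⟩⟩
    · have h1 : ContMDiffAt 𝓘(ℝ, ℝ) 𝓘(ℝ, E) ∞ (fun t : ℝ => t • v) t :=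
        (contDiffAt_id.smul contDiffAt_const).contMDiffAt
      exact ((contMDiffAt_symm_of_mem_maximalAtlas hatlas (hball ht)).comp t h1).contMDiffWithinAt
    · intro ψ' hψ' hs
      have hu := hball ht
      have hk := contDiffAt_transition hatlas hψ' hu hs
      obtain ⟨hi, -⟩ := fderiv_transition hatlas hψ' hu hs
      have h1 := deriv_deriv_comp_line hk
      have h2 : ψ' ∘ (fun t : ℝ => φ.symm (t • v)) = fun t : ℝ => (ψ' ∘ φ.symm) (t • v) := rfl
      rw [h2, h1.1, h1.2]
      -- The geodesic equation for the image of the line in `ψ'` is the transformation rule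
      -- evaluated on `(v, v)`.
      have h3 := fderiv_pullback (Γ := christoffel nabla ψ') hi v v
      rw [hpull _ hu ψ' hψ' hs, apply_line_eq_zero hcont.continuousAt (φ.open_target.mem_nhds hφ0)
        (fun u hu => (hΦs u ((htarget u).1 hu)).1.1) hu, map_zero] at h3
      rw [add_comm]
      exact h3.symm
  · intro γ δ hδ hγ hγ0
    have h0δ : Set.Ioo (-δ) δ ∈ 𝓝 (0 : ℝ) := Ioo_mem_nhds (by linarith) hδ
    have hγs : ContMDiffAt 𝓘(ℝ, ℝ) 𝓘(ℝ, E) ∞ γ 0 := hγ.1.contMDiffAt h0δ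
    have hγφ : ∀ᶠ t in 𝓝 0, γ t ∈ φ.source :=
      hγs.continuousAt (φ.open_source.mem_nhds (by rwa [hγ0]))
    have hc : ContDiffAt ℝ ∞ (φ ∘ γ) 0 :=
      ((contMDiffAt_of_mem_maximalAtlas hatlas (by rwa [hγ0])).comp 0 hγs).contDiffAt
    -- For `ψ' = φ` the transition map is the identity.
    have hev : ∀ᶠ u in 𝓝 0, christoffel nabla φ u = pullback (christoffelAt nabla) e u := by
      filter_upwards [φ.open_target.mem_nhds hφ0] with u hu
      rw [← hpull u hu φ hatlas (φ.map_target hu)]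
      have h1 : φ ∘ φ.symm =ᶠ[𝓝 u] fun u => u := by
        filter_upwards [φ.open_target.mem_nhds hu] with y hy using φ.right_inv hy
      have h2 := congrFun (pullback_id (Γ := christoffel nabla φ)) u
      rw [pullback, h1.eq_of_nhds, h1.fderiv_eq, h1.fderiv.fderiv_eq]
      exact h2.symm
    have hline := geodesic_eq_line (hcont.congr_of_eventuallyEq hev)
      (by filter_upwards [hev, φ.open_target.mem_nhds hφ0] with u h1 h2
          rw [h1, (hΦs u ((htarget u).1 h2)).1.1]) hc (by simp [hγ0, hx0])
      (by filter_upwards [h0δ, hγφ] with t h1 h2 using (hγ.2 t h1).2 φ hatlas h2)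
    refine ⟨deriv (φ ∘ γ) 0, ?_⟩
    filter_upwards [hline, hγφ] with t h1 h2
    rw [← h1]
    exact (φ.left_inv h2).symm

end ExistsNormalChart

/-! ### Orbits and normal tensors. -/

section Orbits

variable {E : Type*} [NormedAddCommGroup E] [NormedSpace ℝ E] [FiniteDimensional ℝ E]
  {X : Type*} [TopologicalSpace X] [ChartedSpace E X] [IsManifold 𝓘(ℝ, E) ∞ X]
  {κ : Kind} {x : X} {r : ℕ}

lemma LocalDiffeo.fderiv_inChart_of_jet_eq {k : ℕ} {τ τ' : LocalDiffeo E x}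
    (h : τ.jet (k + 1) = τ'.jet (k + 1)) :
    fderiv ℝ τ.inChart (chartAt E x x) = fderiv ℝ τ'.inChart (chartAt E x x) := by
  have h1 : (fun m : Fin (k + 1 + 1) => iteratedFDeriv ℝ m τ.inChart (chartAt E x x)) =
      fun m : Fin (k + 1 + 1) => iteratedFDeriv ℝ m τ'.inChart (chartAt E x x) := Quotient.exact h
  have h2 : iteratedFDeriv ℝ 1 τ.inChart (chartAt E x x) =
    iteratedFDeriv ℝ 1 τ'.inChart (chartAt E x x) := congrFun h1 (1 : Fin (k + 1 + 1))
  ext v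
  have h3 := congrArg (fun f => f fun _ => v) h2
  simpa [iteratedFDeriv_one_apply] using h3

/-- Local diffeomorphisms with differential `id`, in the centred preferred chart. -/
lemma LocalDiffeo.isTangentToId (τ : LocalDiffeo E x)
    (h : fderiv ℝ τ.inChart (chartAt E x x) = ContinuousLinearMap.id ℝ E) :
    IsTangentToId fun u => τ.inChart (u + chartAt E x x) - chartAt E x x := by
  have hT : Tendsto τ.toPartialDiffeo (𝓝 x) (𝓝 x) := by
    have h1 := (PartialDiffeomorph.isLocalInverse τ.toPartialDiffeo
      τ.mem_source).contMDiffAt.continuousAt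
    rwa [ContinuousAt, τ.map_eq] at h1
  have hψ := (chartAt E x).open_source.mem_nhds (mem_chart_source E x)
  refine ⟨?_, ?_, ?_⟩
  · filter_upwards [eventually_mem_target x, tendsto_chart_symm x hψ,
      tendsto_chart_symm x (hT hψ),
      tendsto_chart_symm x (τ.toPartialDiffeo.open_source.mem_nhds τ.mem_source)] with u h1 h2 h3 h4
    have h5 := (PartialDiffeomorph.isLocalInverse τ.toPartialDiffeo h4).contDiffAt_inChart h2 h3
    rw [(chartAt E x).right_inv h1] at h5
    exact (ContDiffAt.comp (g := τ.inChart) u h5 (by fun_prop)).sub contDiffAt_const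
  · simp [LocalDiffeo.inChart, (chartAt E x).left_inv (mem_chart_source E x), τ.map_eq]
  · rw [fderiv_sub_const, fderiv_comp_add_right, zero_add, h]

lemma isTransform_iff_christoffelAt (τ : LocalDiffeo E x) (nabla nabla' : LocalConnection E κ x) :
    IsTransform τ nabla nabla' ↔ christoffelAt nabla' =ᶠ[𝓝 0] pullback (christoffelAt nabla)
      fun u => τ.inChart (u + chartAt E x x) - chartAt E x x := by
  rw [isTransform_iff]
  have hm : 𝓝 (chartAt E x x) = Filter.map (fun u : E => u + chartAt E x x) (𝓝 0) := by
    have h := (Homeomorph.addRight (chartAt E x x)).map_nhds_eq 0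
    simp only [Homeomorph.coe_addRight, zero_add] at h
    exact h.symm
  have h1 : pullback (christoffelAt nabla) (fun u => τ.inChart (u + chartAt E x x) - chartAt E x x) =
    fun u => pullback (christoffel nabla (chartAt E x)) τ.inChart (u + chartAt E x x) := by
    ext1 u
    exact pullback_translate _ _ _ _ _
  rw [hm, h1, EventuallyEq, Filter.eventually_map]
  rfl

lemma IsTransform.jetCoeff_eq {τ : LocalDiffeo E x} {nabla nabla' : LocalConnection E κ x}
    (h : IsTransform τ nabla nabla')
    (hτ : fderiv ℝ τ.inChart (chartAt E x x) = ContinuousLinearMap.id ℝ E) :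
    jetCoeff r nabla' = pullJet (jetCoeff r nabla) (τ.isTangentToId hτ) := by
  rw [← germJet_christoffelAt, ← germJet_christoffelAt, ← germJet_pullback]
  exact germJet_congr ((isTransform_iff_christoffelAt τ nabla nabla').1 h)

/-- Germs of maps tangent to the identity come from local diffeomorphisms. -/
lemma exists_localDiffeo (x : X) {θ : E → E} (hθ : IsTangentToId θ) :
    ∃ τ : LocalDiffeo E x, (fun u => τ.inChart (u + chartAt E x x) - chartAt E x x) =ᶠ[𝓝 0] θ := by
  have := FiniteDimensional.complete ℝ E
  have hψ := IsManifold.chart_mem_maximalAtlas (I := 𝓘(ℝ, E)) (n := ∞) x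
  have hx := mem_chart_source E x
  obtain ⟨Φ, hΦ, h0, hΦs, hΦt⟩ := exists_openPartialHomeomorph hθ.contDiffAt hθ.isInvertible_zero
    ((eventually_mem_target x).and (hθ.tendsto (eventually_mem_target x)))
  set ψ := chartAt E x with hψx
  -- The local inversion of `θ`, conjugated by the centred preferred chart.
  let T : OpenPartialHomeomorph X X :=
    ψ ≫ₕ (Homeomorph.addRight (-ψ x)).toOpenPartialHomeomorph ≫ₕ Φ ≫ₕ
      (Homeomorph.addRight (ψ x)).toOpenPartialHomeomorph ≫ₕ ψ.symm
  have hT : ∀ z, T z = ψ.symm (θ (ψ z - ψ x) + ψ x) := fun z => by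
    simp [T, hΦ, sub_eq_add_neg]
  have hTs : ∀ z, T.symm z = ψ.symm (Φ.symm (ψ z - ψ x) + ψ x) := fun z => by
    simp only [T, mfld_simps]
    simp only [neg_neg, Homeomorph.addRight_symm, Homeomorph.coe_addRight, sub_eq_add_neg]
  have hsource : ∀ z, z ∈ T.source ↔ z ∈ ψ.source ∧ ψ z - ψ x ∈ Φ.source := fun z => by
    simp only [T, mfld_simps]
    simp only [hΦ, Homeomorph.coe_addRight, ← sub_eq_add_neg]
    exact ⟨fun h => ⟨h.1, h.2.1⟩, fun h => ⟨h.1, h.2, (hΦs _ h.2).1.2⟩⟩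
  have htarget : ∀ z ∈ T.target, z ∈ ψ.source ∧ ψ z - ψ x ∈ Φ.target := fun z hz => by
    simp only [T, mfld_simps] at hz
    simp only [Homeomorph.addRight_symm, Homeomorph.coe_addRight, ← sub_eq_add_neg] at hz
    exact ⟨by tauto, by tauto⟩
  have hxT : x ∈ T.source := by rw [hsource, sub_self]; exact ⟨hx, h0⟩
  have hTx : T x = x := by rw [hT, sub_self, hθ.map_zero, zero_add, ψ.left_inv hx]
  have hsm : ∀ z ∈ T.source, ContMDiffAt 𝓘(ℝ, E) 𝓘(ℝ, E) ∞ T z := fun z hz => by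
    obtain ⟨h1, h2⟩ := (hsource z).1 hz
    obtain ⟨⟨-, h3⟩, h4, -⟩ := hΦs _ h2
    have h5 : ContMDiffAt 𝓘(ℝ, E) 𝓘(ℝ, E) ∞ (fun z => ψ z - ψ x) z :=
      (contMDiffAt_of_mem_maximalAtlas hψ h1).sub contMDiffAt_const
    have h6 : ContMDiffAt 𝓘(ℝ, E) 𝓘(ℝ, E) ∞ (fun z => θ (ψ z - ψ x) + ψ x) z :=
      (h4.contMDiffAt.comp z h5).add contMDiffAt_const
    exact ((contMDiffAt_symm_of_mem_maximalAtlas hψ h3).comp z h6).congr_of_eventuallyEq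
      (Eventually.of_forall hT)
  have hsm' : ∀ z ∈ T.target, ContMDiffAt 𝓘(ℝ, E) 𝓘(ℝ, E) ∞ T.symm z := fun z hz => by
    obtain ⟨h1, h2⟩ := htarget z hz
    obtain ⟨⟨h3, -⟩, -⟩ := hΦs _ (Φ.map_target h2)
    have h5 : ContMDiffAt 𝓘(ℝ, E) 𝓘(ℝ, E) ∞ (fun z => ψ z - ψ x) z :=
      (contMDiffAt_of_mem_maximalAtlas hψ h1).sub contMDiffAt_const
    have h6 : ContMDiffAt 𝓘(ℝ, E) 𝓘(ℝ, E) ∞ (fun z => Φ.symm (ψ z - ψ x) + ψ x) z :=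
      ((hΦt _ h2).contMDiffAt.comp z h5).add contMDiffAt_const
    exact ((contMDiffAt_symm_of_mem_maximalAtlas hψ h3).comp z h6).congr_of_eventuallyEq
      (Eventually.of_forall hTs)
  let τ : LocalDiffeo E x :=
    { toPartialDiffeo :=
        { toPartialEquiv := T.toPartialEquiv
          open_source := T.open_source
          open_target := T.open_target
          contMDiffOn_toFun := fun z hz => (hsm z hz).contMDiffWithinAt
          contMDiffOn_invFun := fun z hz => (hsm' z hz).contMDiffWithinAt }
      mem_source := hxT
      map_eq := hTx }
  refine ⟨τ, ?_⟩
  filter_upwards [eventually_mem_target x, hθ.tendsto (eventually_mem_target x)] with u h1 h2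
  have h3 : τ.inChart (u + ψ x) = ψ (T (ψ.symm (u + ψ x))) := rfl
  have h2 : θ u + ψ x ∈ ψ.target := h2
  rw [h3, hT, ψ.right_inv h1, add_sub_cancel_right, ψ.right_inv h2, add_sub_cancel_right]

lemma exists_christoffel_eq (x : X) {G : E → E →L[ℝ] E →L[ℝ] E} (hG : ContDiff ℝ ∞ G)
    (hs : κ = .symmetric → ∀ u v w, G u v w = G u w v) :
    ∃ nabla : LocalConnection E κ x,
      ∀ u ∈ (chartAt E x).target, christoffel nabla (chartAt E x) u = G u :=
  ⟨connectionOf x G hG hs, fun _ hu => christoffel_of_covOf _ rfl hu⟩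

/-- Germs of Christoffel symbols come from connections. -/
lemma exists_localConnection (x : X) {Γ : E → E →L[ℝ] E →L[ℝ] E}
    (hΓ : ∀ᶠ u in 𝓝 0, ContDiffAt ℝ ∞ Γ u)
    (hs : κ = .symmetric → ∀ᶠ u in 𝓝 0, ∀ v w, Γ u v w = Γ u w v) :
    ∃ nabla : LocalConnection E κ x, christoffelAt nabla =ᶠ[𝓝 0] Γ := by
  have hs' : ∀ᶠ u in 𝓝 0, κ = .symmetric → ∀ v w, Γ u v w = Γ u w v := by
    by_cases hκ : κ = .symmetric
    · exact (hs hκ).mono fun u h _ => h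
    · exact Eventually.of_forall fun u h => absurd h hκ
  obtain ⟨χ, h1, h2, h3⟩ := exists_contDiff_smul hΓ hs'
  have h4 : ContDiff ℝ ∞ fun u => χ (u - chartAt E x x) • Γ (u - chartAt E x x) :=
    ContDiff.comp (g := fun u => χ u • Γ u) (f := fun u => u - chartAt E x x) h1
      (contDiff_id.sub contDiff_const)
  obtain ⟨nabla, hn⟩ := exists_christoffel_eq (κ := κ) x h4 fun hκ u v w => by
    rcases h3 (u - chartAt E x x) with h | h
    · simp [h]
    · simp [h hκ v w]
  refine ⟨nabla, ?_⟩
  filter_upwards [h2, eventually_mem_target x] with u hu h6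
  rw [christoffelAt, hn _ h6]
  simp [hu]

/-- Two jets are in the same orbit if and only if they have the same normal tensors. -/
lemma mem_orbit_iff {j j' : ConnJet E κ x r} : j' ∈ orbit j ↔
    normalTensors (jetEquiv E κ x r j') = normalTensors (jetEquiv E κ x r j) := by
  rw [normalTensors_eq_iff]
  constructor
  · rintro ⟨h, ⟨τ', rfl, hτ'⟩, τ, nabla, nabla', hτ, rfl, rfl, htr⟩
    -- The representative `τ` that transports the connection need not be the one `τ'` known to have
    -- identity differential; they share an `(r + 2)`-jet and hence the first derivative.
    have hd := (LocalDiffeo.fderiv_inChart_of_jet_eq hτ).trans hτ'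
    have h1 := htr.jetCoeff_eq (r := r) hd
    change normalForm (jetCoeff r nabla') = normalForm (jetCoeff r nabla)
    rw [h1, normalForm_pullJet]
  · intro h
    obtain ⟨θ, hθ, h1⟩ := exists_pullJet_eq h.symm
    obtain ⟨τ, hτ⟩ := exists_localDiffeo x hθ
    set A := jetEquiv E κ x r j with hA
    -- Membership in the orbit only needs some representatives: the polynomial one for `j`, and its
    -- exact transform by `θ` for `j'`.
    obtain ⟨nabla, hn⟩ := exists_localConnection (κ := κ) x
      (Γ := polyConn A) (Eventually.of_forall fun u => (contDiff_polyConn_right A).contDiffAt)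
      (isConnGerm_polyConn A).symm
    have hg := (isConnGerm_polyConn A).pullback hθ
    have := FiniteDimensional.complete ℝ E
    have hs : ∀ᶠ u in 𝓝 0, ContDiffAt ℝ ∞ (pullback (polyConn A) θ) u := by
      filter_upwards [hθ.contDiffAt, hθ.isInvertible] with u h2 h3
      exact contDiffAt_pullback_of (contDiff_polyConn_right A).contDiffAt h2 h3
    obtain ⟨nabla', hn'⟩ := exists_localConnection (κ := κ) x
      (Γ := pullback (polyConn A) θ) hs hg.symm
    have hd : fderiv ℝ τ.inChart (chartAt E x x) = ContinuousLinearMap.id ℝ E := by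
      have h2 := hτ.fderiv_eq (𝕜 := ℝ)
      rwa [fderiv_sub_const, fderiv_comp_add_right, zero_add, hθ.fderiv_zero] at h2
    refine ⟨τ.jet (r + 2), ⟨τ, rfl, hd⟩, τ, nabla, nabla', rfl, ?_, ?_, ?_⟩
    · apply (jetEquiv E κ x r).injective
      change jetCoeff r nabla = A
      rw [← germJet_christoffelAt, germJet_congr (h' := isConnGerm_polyConn A) hn, germJet_polyConn]
    · apply (jetEquiv E κ x r).injective
      change jetCoeff r nabla' = _
      rw [h1, ← germJet_christoffelAt, germJet_congr (h' := hg) hn', pullJet]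
    · rw [isTransform_iff_christoffelAt]
      refine hn'.trans ?_
      filter_upwards [pullback_congr_left hθ hn, pullback_congr_right (Γ := christoffelAt nabla) hτ]
        with u h2 h3
      rw [h3, ← h2]

end Orbits

/-! ### Quotients and submersions from smooth sections. -/

section Quotients

variable {V W : Type*} [NormedAddCommGroup V] [NormedSpace ℝ V] [NormedAddCommGroup W]
  [NormedSpace ℝ W]

section Quotient

variable {M : Type*} [TopologicalSpace M] [ChartedSpace V M] {R : M → M → Prop} {π : M → W}
  {σ : W → M}

/-- The quotient by the fibres of a map with a continuous section. -/
def quotHomeo (hR : ∀ j j', R j j' ↔ π j' = π j) (hπ : Continuous π) (hσ : Continuous σ)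
    (hπσ : ∀ T, π (σ T) = T) : Quot R ≃ₜ W where
  toFun := Quot.lift π fun j j' h => ((hR j j').1 h).symm
  invFun T := Quot.mk R (σ T)
  left_inv q := by
    induction q using Quot.ind with
    | mk j => exact (Quot.sound ((hR _ _).2 (hπσ _).symm))
  right_inv T := hπσ T
  continuous_toFun := continuous_quot_lift _ hπ
  continuous_invFun := continuous_quot_mk.comp hσ

/-- The quotient by the fibres of a smooth map with a smooth section is a manifold. -/
lemma exists_chartedSpace_quot [IsManifold 𝓘(ℝ, V) ∞ M] (hR : ∀ j j', R j j' ↔ π j' = π j)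
    (hπ : ContMDiff 𝓘(ℝ, V) 𝓘(ℝ, W) ∞ π) (hσ : ContMDiff 𝓘(ℝ, W) 𝓘(ℝ, V) ∞ σ)
    (hπσ : ∀ T, π (σ T) = T) :
    ∃ _ : ChartedSpace W (Quot R), IsManifold 𝓘(ℝ, W) ∞ (Quot R) ∧
      (∀ (U : Set (Quot R)) (f : Quot R → ℝ), IsOpen U →
        (ContMDiffOn 𝓘(ℝ, W) 𝓘(ℝ, ℝ) ∞ f U ↔
          ContMDiffOn 𝓘(ℝ, V) 𝓘(ℝ, ℝ) ∞ (fun j => f (Quot.mk _ j)) (Quot.mk _ ⁻¹' U))) ∧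
      ∃ Φ : Diffeomorph 𝓘(ℝ, W) 𝓘(ℝ, W) (Quot R) W ∞, ∀ j, Φ (Quot.mk _ j) = π j := by
  let h := quotHomeo hR hπ.continuous hσ.continuous hπσ
  let : ChartedSpace W (Quot R) := h.toOpenPartialHomeomorph.singletonChartedSpace rfl
  have : IsManifold 𝓘(ℝ, W) ∞ (Quot R) := h.toOpenPartialHomeomorph.isManifold_singleton rfl
  have hat : h.toOpenPartialHomeomorph ∈ IsManifold.maximalAtlas 𝓘(ℝ, W) ∞ (Quot R) :=
    IsManifold.subset_maximalAtlas rfl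
  have h1 : ContMDiff 𝓘(ℝ, W) 𝓘(ℝ, W) ∞ h := fun q =>
    contMDiffAt_of_mem_maximalAtlas hat (Set.mem_univ q)
  have h2 : ContMDiff 𝓘(ℝ, W) 𝓘(ℝ, W) ∞ h.symm := fun T =>
    contMDiffAt_symm_of_mem_maximalAtlas hat (Set.mem_univ T)
  -- In the global chart of the quotient, the projection is `π`.
  have h3 : ContMDiff 𝓘(ℝ, V) 𝓘(ℝ, W) ∞ (Quot.mk R) := by
    have : Quot.mk R = h.symm ∘ π := by
      ext j
      exact (h.symm_apply_apply (Quot.mk R j)).symm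
    rw [this]
    exact h2.comp hπ
  refine ⟨inferInstance, this, fun U f hU => ⟨fun hf => ?_, fun hf => ?_⟩, ⟨⟨h.toEquiv, h1, h2⟩,
    fun _ => rfl⟩⟩
  · exact hf.comp h3.contMDiffOn fun _ hj => hj
  · have h4 : f = (fun j => f (Quot.mk R j)) ∘ σ ∘ h := by
      ext q
      exact congrArg f (h.symm_apply_apply q).symm
    rw [h4]
    refine hf.comp (hσ.comp h1).contMDiffOn fun q hq => ?_
    have h5 : Quot.mk R ((σ ∘ h) q) = q := h.symm_apply_apply q
    rwa [Set.mem_preimage, Set.mem_preimage, h5]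

end Quotient

section Submersion

variable [FiniteDimensional ℝ V] {M : Type*} [TopologicalSpace M] [ChartedSpace V M]
  [IsManifold 𝓘(ℝ, V) ∞ M] {P : V → W}

/-- Smooth maps with smooth sections through each point are submersions. -/
lemma isSubmersion_of_exists_section {h : M ≃ₜ V}
    (hh : h.toOpenPartialHomeomorph ∈ IsManifold.maximalAtlas 𝓘(ℝ, V) ∞ M)
    (hP : ContDiff ℝ ∞ P)
    (hs : ∀ A, ∃ s : W → V, ContDiff ℝ ∞ s ∧ (∀ T, P (s T) = T) ∧ s (P A) = A) :
    Manifold.IsSubmersion 𝓘(ℝ, V) 𝓘(ℝ, W) ∞ (P ∘ h) := by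
  have hV := FiniteDimensional.complete ℝ V
  have hsurj : ∀ A, ∃ S : W →L[ℝ] V, Function.RightInverse S (fderiv ℝ P A) := fun A => by
    obtain ⟨s, hs, h1, h2⟩ := hs A
    refine ⟨fderiv ℝ s (P A), fun T => ?_⟩
    have h3 : P ∘ s = id := funext h1
    have h4 : fderiv ℝ (P ∘ s) (P A) = _ := fderiv_comp (P A) (hP.differentiable (by simp) _)
      (hs.differentiable (by simp) _)
    rw [h3, fderiv_id, h2] at h4
    exact (congrArg (fun L => L T) h4).symm
  choose S hS using hsurj
  -- The derivative of a section through `A` is a right inverse of the derivative of `P`, so it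
  -- splits off the kernel.
  let L (A : V) : V ≃L[ℝ] W × (fderiv ℝ P A).ker :=
    ContinuousLinearEquiv.equivOfRightInverse (fderiv ℝ P A) (S A) (hS A)
  have hfin : FiniteDimensional ℝ W :=
    FiniteDimensional.of_surjective (fderiv ℝ P 0).toLinearMap (hS 0).surjective
  -- A submersion requires one complement for all points; the kernels all have dimension `dim V -
  -- dim W`, so the kernel at `0` serves everywhere.
  have hrank : ∀ A, Module.finrank ℝ (fderiv ℝ P A).ker = Module.finrank ℝ (fderiv ℝ P 0).ker := by
    intro A
    have h1 := (L A).toLinearEquiv.finrank_eq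
    have h2 := (L 0).toLinearEquiv.finrank_eq
    rw [Module.finrank_prod] at h1 h2
    omega
  refine ⟨(fderiv ℝ P 0).ker, inferInstance, inferInstance, fun m => ?_⟩
  obtain ⟨c⟩ : Nonempty ((fderiv ℝ P (h m)).ker ≃L[ℝ] (fderiv ℝ P 0).ker) :=
    FiniteDimensional.nonempty_continuousLinearEquiv_of_finrank_eq (hrank _)
  let e : V ≃L[ℝ] W × (fderiv ℝ P 0).ker :=
    (L (h m)).trans ((ContinuousLinearEquiv.refl ℝ W).prodCongr c)
  have he : ∀ v, (e v).1 = fderiv ℝ P (h m) v := fun v => rfl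
  -- The coordinate change straightening `P`: its derivative at `h m` is the identity, and `(e (Q
  -- A)).1 = P A`.
  let Q : V → V := fun A => e.symm (P A, (e A).2)
  have hQ : ContDiff ℝ ∞ Q := e.symm.contDiff.comp (hP.prodMk (contDiff_snd.comp e.contDiff))
  have hQd : fderiv ℝ Q (h m) = ContinuousLinearMap.id ℝ V := by
    let p : V →L[ℝ] (fderiv ℝ P 0).ker :=
      (ContinuousLinearMap.snd ℝ W (fderiv ℝ P 0).ker).comp (e : V →L[ℝ] W × (fderiv ℝ P 0).ker)
    have h1 : HasFDerivAt (fun A => (P A, (e A).2)) ((fderiv ℝ P (h m)).prod p) (h m) :=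
      (hP.differentiable (by simp) _).hasFDerivAt.prodMk p.hasFDerivAt
    have h2 : fderiv ℝ Q (h m) = _ :=
      ((e.symm : W × (fderiv ℝ P 0).ker →L[ℝ] V).hasFDerivAt.comp (h m) h1).fderiv
    rw [h2]
    ext v
    have h3 : (fderiv ℝ P (h m) v, (e v).2) = e v := Prod.ext (he v).symm rfl
    change e.symm (fderiv ℝ P (h m) v, (e v).2) = v
    rw [h3, e.symm_apply_apply]
  obtain ⟨Φ, hΦ, h0, hΦs, hΦt⟩ := exists_openPartialHomeomorph (f := Q) (a := h m)
    (Eventually.of_forall fun u => hQ.contDiffAt)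
    (by rw [hQd]; exact ⟨.refl ℝ V, rfl⟩) (p := fun _ => True) (by simp)
  let φ : OpenPartialHomeomorph M V := h.toOpenPartialHomeomorph ≫ₕ Φ
  have hφs : ∀ z, z ∈ φ.source ↔ h z ∈ Φ.source := fun z => by simp [φ]
  have hφt : φ.target = Φ.target := by simp [φ]
  have hφ : φ ∈ IsManifold.maximalAtlas 𝓘(ℝ, V) ∞ M := by
    refine φ.mem_maximalAtlas_of_contMDiffOn (fun z hz => ?_) fun u hu => ?_
    · have h1 : ContMDiffAt 𝓘(ℝ, V) 𝓘(ℝ, V) ∞ h z :=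
        contMDiffAt_of_mem_maximalAtlas hh (Set.mem_univ z)
      have h2 : ContMDiffAt 𝓘(ℝ, V) 𝓘(ℝ, V) ∞ Φ (h z) := by
        rw [hΦ]; exact hQ.contDiffAt.contMDiffAt
      exact (h2.comp z h1).contMDiffWithinAt
    · rw [hφt] at hu
      have h1 : ContMDiffAt 𝓘(ℝ, V) 𝓘(ℝ, V) ∞ h.symm (Φ.symm u) :=
        contMDiffAt_symm_of_mem_maximalAtlas hh (Set.mem_univ _)
      exact (h1.comp u (hΦt u hu).contMDiffAt).contMDiffWithinAt
  refine Manifold.IsSubmersionAtOfComplement.mk_of_charts e φ (OpenPartialHomeomorph.refl W)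
    ((hφs m).2 h0) (Set.mem_univ _) hφ ?_ (fun _ _ => Set.mem_univ _) fun u hu => ?_
  · exact IsManifold.chart_mem_maximalAtlas (I := 𝓘(ℝ, W)) (n := ∞) (0 : W)
  · have hu : u ∈ Φ.target := by simpa [φ] using hu
    have h1 : P (h (h.symm (Φ.symm u))) = (e u).1 := by
      rw [h.apply_symm_apply]
      have h2 : Q (Φ.symm u) = u := by rw [← hΦ]; exact Φ.right_inv hu
      have h3 : e (Q (Φ.symm u)) = (P (Φ.symm u), (e (Φ.symm u)).2) := e.apply_symm_apply _
      rw [h2] at h3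
      rw [h3]
    simpa [φ] using h1

end Submersion
end Quotients

/-! ### The global chart of the jet space. -/

section Reduction

variable {E : Type*} [NormedAddCommGroup E] [NormedSpace ℝ E] [FiniteDimensional ℝ E]
  {X : Type*} [TopologicalSpace X] [ChartedSpace E X] [IsManifold 𝓘(ℝ, E) ∞ X]

lemma jetHomeo_mem_maximalAtlas (κ : Kind) (x : X) (r : ℕ) :
    (jetHomeo E κ x r).toOpenPartialHomeomorph ∈
      IsManifold.maximalAtlas 𝓘(ℝ, JetCoeff E κ r) ∞ (ConnJet E κ x r) :=
  IsManifold.subset_maximalAtlas rfl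

lemma contMDiff_jetHomeo (κ : Kind) (x : X) (r : ℕ) :
    ContMDiff 𝓘(ℝ, JetCoeff E κ r) 𝓘(ℝ, JetCoeff E κ r) ∞ (jetHomeo E κ x r) := fun j =>
  contMDiffAt_of_mem_maximalAtlas (jetHomeo_mem_maximalAtlas κ x r) (Set.mem_univ j)

lemma contMDiff_jetHomeo_symm (κ : Kind) (x : X) (r : ℕ) :
    ContMDiff 𝓘(ℝ, JetCoeff E κ r) 𝓘(ℝ, JetCoeff E κ r) ∞ (jetHomeo E κ x r).symm := fun A =>
  contMDiffAt_symm_of_mem_maximalAtlas (jetHomeo_mem_maximalAtlas κ x r) (Set.mem_univ A)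

end Reduction

end ConnectionJets

end

open ConnectionJets in
theorem theorem3p2 {E : Type*} [NormedAddCommGroup E] [NormedSpace ℝ E] [FiniteDimensional ℝ E]
    {X : Type*} [TopologicalSpace X] [ChartedSpace E X] [IsManifold 𝓘(ℝ, E) ∞ X]
    (κ : Kind) (x : X) (r : ℕ) :
    ∃ π : ConnJet E κ x r → NormalTensors E κ r,
      (∀ (nabla : LocalConnection E κ x) (m : Fin (r + 1)),
        IsNormalTensor nabla m (π (jet r nabla) m : E [×((m : ℕ) + 2)]→L[ℝ] E)) ∧
      Function.Surjective π ∧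
      ContMDiff 𝓘(ℝ, JetCoeff E κ r) 𝓘(ℝ, NormalTensors E κ r) ∞ π ∧
      Manifold.IsSubmersion 𝓘(ℝ, JetCoeff E κ r) 𝓘(ℝ, NormalTensors E κ r) ∞ π ∧
      (∀ j, π ⁻¹' {π j} = orbit j) ∧
      ∃ _ : ChartedSpace (NormalTensors E κ r) (OrbitSpace E κ x r),
        IsManifold 𝓘(ℝ, NormalTensors E κ r) ∞ (OrbitSpace E κ x r) ∧
        (∀ (V : Set (OrbitSpace E κ x r)) (f : OrbitSpace E κ x r → ℝ), IsOpen V →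
          (ContMDiffOn 𝓘(ℝ, NormalTensors E κ r) 𝓘(ℝ, ℝ) ∞ f V ↔
            ContMDiffOn 𝓘(ℝ, JetCoeff E κ r) 𝓘(ℝ, ℝ) ∞ (fun j => f (Quot.mk _ j))
              (Quot.mk _ ⁻¹' V))) ∧
        ∃ Φ : Diffeomorph 𝓘(ℝ, NormalTensors E κ r) 𝓘(ℝ, NormalTensors E κ r)
            (OrbitSpace E κ x r) (NormalTensors E κ r) ∞,
          ∀ j, Φ (Quot.mk _ j) = π j := by
  -- For surjectivity and the quotient any global smooth section will do; the base jet `0` is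
  -- arbitrary. The submersion property uses sections through all jets.
  obtain ⟨s, hs, hs', -⟩ := exists_section (0 : JetCoeff E κ r)
  have hπ : ContMDiff 𝓘(ℝ, JetCoeff E κ r) 𝓘(ℝ, NormalTensors E κ r) ∞
      (normalTensors ∘ jetHomeo E κ x r) :=
    contDiff_normalTensors.contMDiff.comp (contMDiff_jetHomeo κ x r)
  have hσ : ContMDiff 𝓘(ℝ, NormalTensors E κ r) 𝓘(ℝ, JetCoeff E κ r) ∞
      ((jetHomeo E κ x r).symm ∘ s) :=
    (contMDiff_jetHomeo_symm κ x r).comp hs.contMDiff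
  have hπσ : ∀ T, (normalTensors ∘ jetHomeo E κ x r) (((jetHomeo E κ x r).symm ∘ s) T) = T :=
    fun T => by
      simp only [Function.comp_apply, Homeomorph.apply_symm_apply, hs']
  refine ⟨normalTensors ∘ jetHomeo E κ x r, fun nabla m => ⟨exists_isNormalChart nabla,
    fun φ hφ v w a => hφ.normalTensors_apply m v w a⟩, fun T => ⟨_, hπσ T⟩, hπ,
    isSubmersion_of_exists_section (jetHomeo_mem_maximalAtlas κ x r) contDiff_normalTensors
      exists_section, fun j => Set.ext fun j' => mem_orbit_iff.symm,
    exists_chartedSpace_quot (fun j j' => mem_orbit_iff) hπ hσ hπσ⟩
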